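/- **Sheaf side.** Let $\mathbf{CSur}$ be the category of nonempty countable sets and surjective functions. A functor $F:\mathbf{CSur}^{op}\to\mathbf{Set}$ is an atomic sheaf if for every $p:\Omega'\twoheadrightarrow\Omega$ and every $y\in F(\Omega')$ with $F(q)(y)=F(r)(y)$ for all $q,r:\Omega''\twoheadrightarrow\Omega'$ with $pq=pr$, there is a unique $x\in F(\Omega)$ with $F(p)(x)=y$. Let $\mathbf{DSh}$ be the category of atomic sheaves. Let $\mathbb P(\Omega)$ be the set of pairs $\mathcal P=(\mathcal F,\mu)$ of a $\sigma$-algebra on $\Omega$ and a probability measure on it; $p:\Omega'\twoheadrightarrow\Omega$ acts by pullback $p^{-1}(\mathcal F,\mu)=(\{p^{-1}(G)\mid G\in\mathcal F\},\,p^{-1}(G)\mapsto\mu(G))$. Let $$\mathbb P^2_\perp(\Omega)=\{((\pi_1 p)^{-1}\mathcal P_1,(\pi_2 p)^{-1}\mathcal P_2)\mid \mathcal P_i\in\mathbb P(\Omega_i),\ p:\Omega\twoheadrightarrow\Omega_1\times\Omega_2\}\subseteq\mathbb P(\Omega)^2$$ with inclusion $i$; let $\bullet:\mathbb P^2_\perp\to\mathbb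 P$ send this pair to $p^{-1}(\mathcal P_1\otimes\mathcal P_2)$, let $(\mathcal F,\mu)\sqsubseteq(\mathcal G,\nu)$ mean $\mathcal F\subseteq\mathcal G$ and $\nu|_{\mathcal F}=\mu$ (a map $\mathbb P\times\mathbb P\to\mathrm{Prop}$ to the constant sheaf $\{\top,\bot\}$), and let $\mathrm{emp}:1\to\mathbb P$ pick the trivial probability space $(\{\emptyset,\Omega\},\mu)$. **Group side.** Let $G$ be the group, under composition, of measurable maps $[0,1]\to[0,1]$ that are invertible modulo almost-everywhere equality (with quasi-measure-preserving inverse), modulo almost-everywhere equality. For a countable partition $\mathcal A$ of $[0,1]$ into Lebesgue-measurable nonnegligible sets let $\mathrm{Fix}\,\mathcal A=\{\pi\in G\mid \pi(A)=_{a.e.}A\text{ for all }A\in\mathcal A\}$; give $G$ the topology generated by the cosets $\pi\,\mathrm{Fix}\,\mathcal A$. Let $\mathbf{DSet}$ be the category of sets with a right $G$-action all of whose stabilizers are open, and equivariant functions. Let $\overline{\mathbb P}$ be the set of countable measured partitions $(\mathcal A,\mu)$: $\mathcal A$ as above, $\mu:\mathcal A\to[0,1]$ with $\sum_{A\in\mathcal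 A}\mu(A)=1$, identified when the partitions agree up to negligible sets and the weights agree; $G$ acts by $(\{A_i\},\mu)\cdot\pi=(\{\pi^{-1}(A_i)\},\mu\circ\pi)$, i.e. $\pi^{-1}(A_i)$ keeps the weight of $A_i$. Say $(\mathcal A,\mu)$ is the independent combination of $(\mathcal A_1,\mu_1)$ and $(\mathcal A_2,\mu_2)$ if the elements of $\mathcal A$ are, up to negligible sets, exactly the intersections $A_1\cap A_2$ with $A_1\in\mathcal A_1$, $A_2\in\mathcal A_2$ (so all of these are nonnegligible), and $\mu(A_1\cap A_2)=\mu_1(A_1)\mu_2(A_2)$ for all $A_1,A_2$. Let $\overline{\mathbb P}{}^2_\perp\subseteq\overline{\mathbb P}{}^2$ be the set of pairs that have an independent combination, $\overline i$ its inclusion, $\overline\bullet$ the independent combination; let $(\mathcal A,\mu)\mathrel{\overline\sqsubseteq}(\mathcal B,\nu)$ mean that $\mathcal A$ is coarser than $\mathcal B$ up to negligible sets and that $\mu(A)=\sum_{B\subseteq A}\nu(B)$ for all $A\in\mathcal A$ (a map to $\overline{\mathrm{Prop}}=\{\top,\bot\}$ with trivial action); and let $\overline{\mathrm{emp}}$ be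 the partition with a single part of weight $1$. **Theorem.** Let $\Phi:\mathbf{DSh}\to\mathbf{DSet}$ be the functor sending $F$ to $\operatorname{colim}_{\mathcal A}F(\mathcal A)$, the colimit over the countable measurable partitions $\mathcal A$ of $[0,1]$ ordered by refinement (each regarded as the countable set of its parts), with action $[\{A_i\}_{i\in I},x]\cdot\pi=[\{\pi^{-1}(A_i)\}_{i\in I},x]$ for $x\in F(I)$. 1. $\Phi$ is an equivalence of categories. 2. $\mathbb P^2_\perp$, with the maps $\mathbb P(\Omega_1)\times\mathbb P(\Omega_2)\to\mathbb P^2_\perp(\Omega_1\times\Omega_2)$, $(\mathcal P_1,\mathcal P_2)\mapsto(\pi_1^{-1}\mathcal P_1,\pi_2^{-1}\mathcal P_2)$, is the Day convolution of $\mathbb P$ with itself for the product of sample spaces. 3. $(\sqsubseteq,\mathbb P^2_\perp,i,\bullet,\mathrm{emp})$ and $(\overline\sqsubseteq,\overline{\mathbb P}{}^2_\perp,\overline i,\overline\bullet,\overline{\mathrm{emp}})$ are resource monoids internal to $\mathbf{DSh}$ and $\mathbf{DSet}$: posets with least element $\mathrm{emp}$, and a partial operation that is commutative, associative, has unit $\mathrm{emp}$,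 and is monotone (if $x\sqsubseteq x'$, $y\sqsubseteq y'$ and $x'\bullet y'$ is defined, then $x\bullet y$ is defined and $x\bullet y\sqsubseteq x'\bullet y'$). 4. The two resource monoids correspond across $\Phi$: there are isomorphisms $\Phi(\mathbb P)\cong\overline{\mathbb P}$, $\Phi(\mathbb P\times\mathbb P)\cong\overline{\mathbb P}\times\overline{\mathbb P}$, $\Phi(\mathbb P^2_\perp)\cong\overline{\mathbb P}{}^2_\perp$, $\Phi(\mathrm{Prop})\cong\overline{\mathrm{Prop}}$, $\Phi(1)\cong1$ that are compatible with the product projections and with $\top:1\to\mathrm{Prop}$ and carry $\Phi(\sqsubseteq),\Phi(i),\Phi(\bullet),\Phi(\mathrm{emp})$ to $\overline\sqsubseteq,\overline i,\overline\bullet,\overline{\mathrm{emp}}$. -/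

import Mathlib

open CategoryTheory MeasureTheory Opposite

namespace ProbSep

/-! ### Discrete sample spaces and atomic sheaves -/

/-- Nonempty countable sets. -/
structure CSur : Type 1 where
  carrier : Type
  [countable : Countable carrier]
  [nonempty : Nonempty carrier]

attribute [instance] CSur.countable CSur.nonempty

/-- Surjective functions between nonempty countable sets. -/
@[ext]
structure CSur.Hom (X Y : CSur) : Type where
  toFun : X.carrier → Y.carrier
  surj : Function.Surjective toFun

instance : Category CSur where
  Hom := CSur.Hom
  id _ := ⟨id, Function.surjective_id⟩
  comp f g := ⟨g.toFun ∘ f.toFun, g.surj.comp f.surj⟩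

/-- The product of two sample spaces. -/
abbrev CSur.prod (X Y : CSur) : CSur := ⟨X.carrier × Y.carrier⟩

def CSur.fst (X Y : CSur) : X.prod Y ⟶ X := ⟨Prod.fst, Prod.fst_surjective⟩

def CSur.snd (X Y : CSur) : X.prod Y ⟶ Y := ⟨Prod.snd, Prod.snd_surjective⟩

/-- The product `f × g` of two surjections. -/
def CSur.prodMap {X X' Y Y' : CSur} (f : X' ⟶ X) (g : Y' ⟶ Y) : X'.prod Y' ⟶ X.prod Y :=
  ⟨Prod.map f.toFun g.toFun, f.surj.prodMap g.surj⟩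

/-- `y` is restrictable along `p`. -/
def Restrictable (F : CSurᵒᵖ ⥤ Type) {Ω' Ω : CSur} (p : Ω' ⟶ Ω) (y : F.obj (op Ω')) : Prop :=
  ∀ (Ω'' : CSur) (q r : Ω'' ⟶ Ω'), q ≫ p = r ≫ p → F.map q.op y = F.map r.op y

/-- Atomic sheaves: functors with a (unique) restriction operation. -/
def IsAtomicSheaf : ObjectProperty (CSurᵒᵖ ⥤ Type) := fun F =>
  ∀ (Ω' Ω : CSur) (p : Ω' ⟶ Ω) (y : F.obj (op Ω')), Restrictable F p y →
    ∃! x : F.obj (op Ω), F.map p.op x = y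

/-- The category of atomic sheaves on `CSur`. -/
abbrev DSh : Type 1 := IsAtomicSheaf.FullSubcategory

/-! ### Probability spaces on a sample space -/

/-- A probability space on the set `Ω`: a `σ`-algebra and a probability measure on it. -/
structure ProbOn (Ω : Type) : Type where
  alg : MeasurableSpace Ω
  meas : @Measure Ω alg
  prob : @IsProbabilityMeasure Ω alg meas

namespace ProbOn

theorem ext' {Ω : Type} {P Q : ProbOn Ω} (h : P.alg = Q.alg)
    (h' : ∀ s, MeasurableSet[P.alg] s → P.meas s = Q.meas s) : P = Q := by
  obtain ⟨m, μ, hμ⟩ := P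
  obtain ⟨m', ν, hν⟩ := Q
  obtain rfl : m = m' := h
  obtain rfl : μ = ν := Measure.ext h'
  rfl

theorem eq_of_isPiSystem {Ω : Type} {P Q : ProbOn Ω} {C : Set (Set Ω)}
    (hP : P.alg = MeasurableSpace.generateFrom C) (hQ : Q.alg = MeasurableSpace.generateFrom C)
    (hC : IsPiSystem C) (h : ∀ s ∈ C, P.meas s = Q.meas s) : P = Q := by
  obtain ⟨m, μ, hμ⟩ := P
  obtain ⟨m', ν, hν⟩ := Q
  obtain rfl : m = m' := hP.trans hQ.symm
  have : μ = ν := ext_of_generate_finite C hP hC h (by rw [measure_univ, measure_univ])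
  subst this
  rfl

/-- The subspace ordering. -/
def le {Ω : Type} (P Q : ProbOn Ω) : Prop :=
  P.alg ≤ Q.alg ∧ ∀ s, MeasurableSet[P.alg] s → Q.meas s = P.meas s

theorem meas_image_iUnion {X Y : Type} {f : X → Y} (hf : Function.Surjective f) (P : ProbOn Y)
    ⦃s : ℕ → Set X⦄ (hs : ∀ i, MeasurableSet[P.alg.comap f] (s i))
    (hd : Pairwise (Function.onFun Disjoint s)) :
    P.meas (f '' ⋃ i, s i) = ∑' i, P.meas (f '' s i) := by
  let _ := P.alg
  choose t ht hts using hs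
  have hst : ∀ i, f '' s i = t i := fun i => by rw [← hts i, Set.image_preimage_eq _ hf]
  rw [Set.image_iUnion, measure_iUnion]
  · intro i j hij
    have := hd hij
    simp only [Function.onFun] at this ⊢
    rw [hst, hst]
    rw [← hts, ← hts] at this
    exact Disjoint.of_preimage hf this
  · intro i; rw [hst]; exact ht i

/-- The pullback of a probability space along a surjection: its events are the sets `f ⁻¹' G`
with `G` an event, and `f ⁻¹' G` has the measure of `G = f '' (f ⁻¹' G)`. -/
noncomputable def pull {X Y : Type} (f : X → Y) (hf : Function.Surjective f) (P : ProbOn Y) :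
    ProbOn X where
  alg := P.alg.comap f
  meas := @Measure.ofMeasurable X (P.alg.comap f) (fun s _ => P.meas (f '' s)) (by simp)
    (meas_image_iUnion hf P)
  prob := by
    let _ := P.alg
    have := P.prob
    refine @IsProbabilityMeasure.mk X (P.alg.comap f) _ ?_
    refine (@Measure.ofMeasurable_apply X (P.alg.comap f) _ _ _ _ MeasurableSet.univ).trans ?_
    rw [Set.image_univ, hf.range_eq]
    exact measure_univ

theorem pull_apply {X Y : Type} (f : X → Y) (hf : Function.Surjective f) (P : ProbOn Y)
    {s : Set Y} (hs : MeasurableSet[P.alg] s) : (P.pull f hf).meas (f ⁻¹' s) = P.meas s := by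
  have : MeasurableSet[P.alg.comap f] (f ⁻¹' s) := ⟨s, hs, rfl⟩
  have h := @Measure.ofMeasurable_apply X (P.alg.comap f) (fun s _ => P.meas (f '' s))
    (by simp) (meas_image_iUnion hf P) _ this
  rw [Set.image_preimage_eq _ hf] at h
  exact h

theorem pull_alg {X Y : Type} (f : X → Y) (hf : Function.Surjective f) (P : ProbOn Y) :
    (P.pull f hf).alg = P.alg.comap f := rfl

theorem eq_pull {X Y : Type} {f : X → Y} {hf : Function.Surjective f} {P : ProbOn X} {Q : ProbOn Y}
    (h : P.alg = Q.alg.comap f)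
    (h' : ∀ s, MeasurableSet[Q.alg] s → P.meas (f ⁻¹' s) = Q.meas s) : P = Q.pull f hf := by
  refine ext' h ?_
  intro t ht
  obtain ⟨s, hs, rfl⟩ : MeasurableSet[Q.alg.comap f] t := h ▸ ht
  rw [pull_apply _ _ _ hs, h' s hs]

theorem pull_id {X : Type} (P : ProbOn X) : P.pull id Function.surjective_id = P :=
  (eq_pull MeasurableSpace.comap_id.symm fun _ _ => rfl).symm

theorem pull_pull {X Y Z : Type} (f : X → Y) (hf : Function.Surjective f) (g : Y → Z)
    (hg : Function.Surjective g) (P : ProbOn Z) :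
    (P.pull g hg).pull f hf = P.pull (g ∘ f) (hg.comp hf) := by
  refine eq_pull (MeasurableSpace.comap_comp) ?_
  intro s hs
  rw [Set.preimage_comp, pull_apply f hf (P.pull g hg) (s := g ⁻¹' s) ⟨s, hs, rfl⟩,
    pull_apply _ _ _ hs]

theorem measurableSet_pull {X Y : Type} (f : X → Y) (hf : Function.Surjective f) (P : ProbOn Y)
    {s : Set Y} : MeasurableSet[(P.pull f hf).alg] (f ⁻¹' s) ↔ MeasurableSet[P.alg] s := by
  constructor
  · rintro ⟨t, ht, h⟩
    rwa [← Set.preimage_injective.2 hf h]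
  · intro h
    exact ⟨s, h, rfl⟩

theorem pull_injective {X Y : Type} (f : X → Y) (hf : Function.Surjective f) :
    Function.Injective (pull f hf) := by
  intro P Q h
  refine ext' ?_ ?_
  · ext s
    rw [← measurableSet_pull f hf, h, measurableSet_pull]
  · intro s hs
    rw [← pull_apply f hf P hs, h, pull_apply]
    rwa [← measurableSet_pull f hf, ← h, measurableSet_pull]

theorem le_pull {X Y : Type} (f : X → Y) (hf : Function.Surjective f) (P Q : ProbOn Y) :
    (P.pull f hf).le (Q.pull f hf) ↔ P.le Q := by
  constructor
  · rintro ⟨h, h'⟩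
    have hPQ : P.alg ≤ Q.alg := fun s hs => by
      rw [← measurableSet_pull f hf] at hs ⊢
      exact h _ hs
    refine ⟨hPQ, fun s hs => ?_⟩
    have := h' (f ⁻¹' s) ((measurableSet_pull f hf P).2 hs)
    rwa [pull_apply _ _ _ hs, pull_apply _ _ _ (hPQ s hs)] at this
  · rintro ⟨h, h'⟩
    refine ⟨MeasurableSpace.comap_mono h, ?_⟩
    rintro _ ⟨s, hs, rfl⟩
    rw [pull_apply _ _ _ hs, pull_apply _ _ _ (h s hs), h' s hs]

/-- The finest `σ`-algebra making `f` measurable, with the image measure. -/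
noncomputable def push {X Y : Type} (f : X → Y) (P : ProbOn X) : ProbOn Y :=
  letI := P.alg
  letI := P.alg.map f
  haveI := P.prob
  { alg := P.alg.map f
    meas := P.meas.map f
    prob := Measure.isProbabilityMeasure_map (measurable_iff_le_map.2 le_rfl).aemeasurable }

theorem push_apply {X Y : Type} (f : X → Y) (P : ProbOn X) {s : Set Y}
    (hs : MeasurableSet[P.alg] (f ⁻¹' s)) : (P.push f).meas s = P.meas (f ⁻¹' s) := by
  let _ := P.alg
  let _ := P.alg.map f
  exact Measure.map_apply (measurable_iff_le_map.2 le_rfl) hs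

theorem pull_push {X Y : Type} (f : X → Y) (hf : Function.Surjective f) (P : ProbOn X)
    (h : ∀ s, MeasurableSet[P.alg] s → f ⁻¹' (f '' s) = s) : (P.push f).pull f hf = P := by
  refine (eq_pull ?_ ?_).symm
  · refine le_antisymm ?_ MeasurableSpace.comap_map_le
    intro s hs
    refine ⟨f '' s, ?_, h s hs⟩
    change MeasurableSet[P.alg] _
    rwa [h s hs]
  · intro s hs
    exact (push_apply f P hs).symm

/-- The product probability space. -/
noncomputable def prod {X Y : Type} (P : ProbOn X) (Q : ProbOn Y) : ProbOn (X × Y) :=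
  letI := P.alg
  letI := Q.alg
  haveI := P.prob
  haveI := Q.prob
  { alg := inferInstance
    meas := P.meas.prod Q.meas
    prob := inferInstance }

theorem prod_apply {X Y : Type} (P : ProbOn X) (Q : ProbOn Y) (s : Set X) (t : Set Y) :
    (P.prod Q).meas (s ×ˢ t) = P.meas s * Q.meas t := by
  let _ := P.alg
  let _ := Q.alg
  have := P.prob
  have := Q.prob
  exact Measure.prod_prod s t

/-- The trivial probability space. -/
noncomputable def triv (Ω : Type) [Nonempty Ω] : ProbOn Ω :=
  letI : MeasurableSpace Ω := ⊥
  { alg := ⊥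
    meas := Measure.dirac (Classical.arbitrary Ω)
    prob := inferInstance }

theorem triv_pull {X Y : Type} [Nonempty X] [Nonempty Y] (f : X → Y) (hf : Function.Surjective f) :
    (triv Y).pull f hf = triv X := by
  refine (eq_pull MeasurableSpace.comap_bot.symm ?_).symm
  intro s hs
  let _ : MeasurableSpace X := ⊥
  let _ : MeasurableSpace Y := ⊥
  have := (triv X).prob
  have := (triv Y).prob
  rcases MeasurableSpace.measurableSet_bot_iff.1 hs with rfl | rfl
  · simp
  · rw [Set.preimage_univ]
    exact (measure_univ (μ := (triv X).meas)).trans (measure_univ (μ := (triv Y).meas)).symm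

end ProbOn

/-- The presheaf of probability spaces. -/
noncomputable def DP : CSurᵒᵖ ⥤ Type where
  obj Ω := ProbOn Ω.unop.carrier
  map p := ↾(ProbOn.pull p.unop.toFun p.unop.surj)
  map_id Ω := by
    ext P
    exact ProbOn.pull_id P
  map_comp p q := by
    ext P
    exact (ProbOn.pull_pull q.unop.toFun q.unop.surj p.unop.toFun p.unop.surj P).symm

/-- The kernel pair of a surjection. -/
def CSur.kernelPair {Ω' Ω : CSur} (p : Ω' ⟶ Ω) : CSur where
  carrier := {x : Ω'.carrier × Ω'.carrier // p.toFun x.1 = p.toFun x.2}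
  nonempty := ⟨⟨(Classical.arbitrary _, Classical.arbitrary _), rfl⟩⟩

theorem ProbOn.exists_restriction {Ω' Ω : CSur} (p : Ω' ⟶ Ω) (y : ProbOn Ω'.carrier)
    (hy : Restrictable DP p y) : ∃ x : ProbOn Ω.carrier, x.pull p.toFun p.surj = y := by
  let q : CSur.kernelPair p ⟶ Ω' := ⟨fun x => x.1.1, fun a => ⟨⟨(a, a), rfl⟩, rfl⟩⟩
  let r : CSur.kernelPair p ⟶ Ω' := ⟨fun x => x.1.2, fun a => ⟨⟨(a, a), rfl⟩, rfl⟩⟩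
  have hqr : y.pull q.toFun q.surj = y.pull r.toFun r.surj :=
    hy _ q r (CSur.Hom.ext (funext fun x => x.2))
  have key : ∀ s, MeasurableSet[y.alg] s → ∀ a b, p.toFun a = p.toFun b → a ∈ s → b ∈ s := by
    intro s hs a b hab ha
    have h1 : MeasurableSet[(y.pull r.toFun r.surj).alg] (q.toFun ⁻¹' s) := by
      rw [← hqr]
      exact ⟨s, hs, rfl⟩
    obtain ⟨t, -, ht⟩ := h1
    have hst : ∀ c, c ∈ t ↔ c ∈ s := fun c =>
      Set.ext_iff.1 ht (⟨(c, c), rfl⟩ : (CSur.kernelPair p).carrier)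
    exact (hst b).1 ((Set.ext_iff.1 ht (⟨(a, b), hab⟩ : (CSur.kernelPair p).carrier)).2 ha)
  have key' : ∀ s, MeasurableSet[y.alg] s → p.toFun ⁻¹' (p.toFun '' s) = s := by
    intro s hs
    refine Set.Subset.antisymm ?_ (Set.subset_preimage_image _ _)
    rintro b ⟨a, ha, hab⟩
    exact key s hs a b hab ha
  exact ⟨y.push p.toFun, ProbOn.pull_push _ _ y key'⟩

theorem DP_isAtomicSheaf : IsAtomicSheaf DP := by
  intro Ω' Ω p y hy
  obtain ⟨x, hx⟩ := ProbOn.exists_restriction p y hy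
  exact ⟨x, hx, fun x' hx' => ProbOn.pull_injective _ p.surj (hx'.trans hx.symm)⟩


/-! ### Pairs of probability spaces that factor through a product -/

/-- The pullback of a probability space along a morphism of `CSur`. -/
noncomputable abbrev CSur.pb {Ω' Ω : CSur} (p : Ω' ⟶ Ω) (P : ProbOn Ω.carrier) :
    ProbOn Ω'.carrier :=
  P.pull p.toFun p.surj

theorem CSur.pb_comp {Ω'' Ω' Ω : CSur} (q : Ω'' ⟶ Ω') (p : Ω' ⟶ Ω) (P : ProbOn Ω.carrier) :
    CSur.pb (q ≫ p) P = CSur.pb q (CSur.pb p P) :=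
  (ProbOn.pull_pull q.toFun q.surj p.toFun p.surj P).symm

/-- `p : Ω ↠ Ω₁ × Ω₂` and `P₁`, `P₂` exhibit `x` as the pair of the pullbacks of `P₁`, `P₂` along
the two components of `p`. -/
def IsFactorization {Ω Ω₁ Ω₂ : CSur} (p : Ω ⟶ Ω₁.prod Ω₂) (P₁ : ProbOn Ω₁.carrier)
    (P₂ : ProbOn Ω₂.carrier) (x : ProbOn Ω.carrier × ProbOn Ω.carrier) : Prop :=
  CSur.pb (p ≫ CSur.fst Ω₁ Ω₂) P₁ = x.1 ∧ CSur.pb (p ≫ CSur.snd Ω₁ Ω₂) P₂ = x.2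

/-- The pair `x` factors through a product of sample spaces. -/
def Factors (Ω : CSur) (x : ProbOn Ω.carrier × ProbOn Ω.carrier) : Prop :=
  ∃ (Ω₁ Ω₂ : CSur) (p : Ω ⟶ Ω₁.prod Ω₂) (P₁ : ProbOn Ω₁.carrier) (P₂ : ProbOn Ω₂.carrier),
    IsFactorization p P₁ P₂ x

theorem IsFactorization.comp {Ω' Ω Ω₁ Ω₂ : CSur} (q : Ω' ⟶ Ω) {p : Ω ⟶ Ω₁.prod Ω₂}
    {P₁ : ProbOn Ω₁.carrier} {P₂ : ProbOn Ω₂.carrier} {x : ProbOn Ω.carrier × ProbOn Ω.carrier}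
    (h : IsFactorization p P₁ P₂ x) :
    IsFactorization (q ≫ p) P₁ P₂ (CSur.pb q x.1, CSur.pb q x.2) := by
  refine ⟨?_, ?_⟩
  · rw [Category.assoc, CSur.pb_comp, h.1]
  · rw [Category.assoc, CSur.pb_comp, h.2]

theorem Factors.comp {Ω' Ω : CSur} (q : Ω' ⟶ Ω) {x : ProbOn Ω.carrier × ProbOn Ω.carrier}
    (h : Factors Ω x) : Factors Ω' (CSur.pb q x.1, CSur.pb q x.2) := by
  obtain ⟨Ω₁, Ω₂, p, P₁, P₂, h⟩ := h
  exact ⟨Ω₁, Ω₂, q ≫ p, P₁, P₂, h.comp q⟩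

theorem Factors.inter_nonempty {Ω : CSur} {x : ProbOn Ω.carrier × ProbOn Ω.carrier}
    (h : Factors Ω x) {s t : Set Ω.carrier} (hs : MeasurableSet[x.1.alg] s)
    (ht : MeasurableSet[x.2.alg] t) (hs' : s.Nonempty) (ht' : t.Nonempty) :
    (s ∩ t).Nonempty := by
  obtain ⟨Ω₁, Ω₂, p, P₁, P₂, h1, h2⟩ := h
  rw [← h1] at hs
  rw [← h2] at ht
  obtain ⟨s, -, rfl⟩ := hs
  obtain ⟨t, -, rfl⟩ := ht
  obtain ⟨a, ha⟩ := hs'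
  obtain ⟨b, hb⟩ := ht'
  obtain ⟨c, hc⟩ := p.surj ((p.toFun a).1, (p.toFun b).2)
  refine ⟨c, ?_, ?_⟩
  · change (p.toFun c).1 ∈ s
    rw [hc]
    exact ha
  · change (p.toFun c).2 ∈ t
    rw [hc]
    exact hb

/-- Two points are equivalent if no event separates them. -/
def ProbOn.atomSetoid {Ω : Type} (P : ProbOn Ω) : Setoid Ω where
  r a b := ∀ s, MeasurableSet[P.alg] s → (a ∈ s ↔ b ∈ s)
  iseqv := ⟨fun _ _ _ => Iff.rfl, fun h s hs => (h s hs).symm,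
    fun h h' s hs => (h s hs).trans (h' s hs)⟩

theorem ProbOn.measurableSet_class {Ω : Type} [Countable Ω] (P : ProbOn Ω) (a : Ω) :
    MeasurableSet[P.alg] {b | P.atomSetoid a b} := by
  let _ := P.alg
  convert MeasurableSet.measurableAtom_of_countable a using 1
  ext b
  constructor
  · intro h
    simp only [measurableAtom, Set.mem_iInter]
    exact fun s ha hs => (h s hs).1 ha
  · intro h s hs
    refine ⟨fun ha => mem_of_mem_measurableAtom h hs ha, fun hb => ?_⟩
    by_contra ha
    exact mem_of_mem_measurableAtom h hs.compl ha hb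

theorem factors_of_inter_nonempty {Ω : CSur} (x : ProbOn Ω.carrier × ProbOn Ω.carrier)
    (h : ∀ s t : Set Ω.carrier, MeasurableSet[x.1.alg] s → MeasurableSet[x.2.alg] t →
      s.Nonempty → t.Nonempty → (s ∩ t).Nonempty) : Factors Ω x := by
  have sat : ∀ (P : ProbOn Ω.carrier) (s : Set Ω.carrier), MeasurableSet[P.alg] s →
      Quotient.mk P.atomSetoid ⁻¹' (Quotient.mk P.atomSetoid '' s) = s := by
    intro P s hs
    refine Set.Subset.antisymm ?_ (Set.subset_preimage_image _ _)
    rintro b ⟨a, ha, hab⟩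
    exact (Quotient.exact hab s hs).1 ha
  have ne : ∀ P : ProbOn Ω.carrier, Nonempty (Quotient P.atomSetoid) :=
    fun P => ⟨Quotient.mk _ (Classical.arbitrary _)⟩
  refine ⟨@CSur.mk (Quotient x.1.atomSetoid) _ (ne _), @CSur.mk (Quotient x.2.atomSetoid) _ (ne _),
    ⟨fun a => (Quotient.mk _ a, Quotient.mk _ a), ?_⟩,
    x.1.push (Quotient.mk _), x.2.push (Quotient.mk _), ?_, ?_⟩
  · rintro ⟨a, b⟩
    induction a using Quotient.inductionOn with | _ a
    induction b using Quotient.inductionOn with | _ b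
    obtain ⟨c, hc, hc'⟩ := h _ _ (x.1.measurableSet_class a) (x.2.measurableSet_class b)
      ⟨a, x.1.atomSetoid.refl a⟩ ⟨b, x.2.atomSetoid.refl b⟩
    exact ⟨c, Prod.ext (Quotient.sound (x.1.atomSetoid.symm hc))
      (Quotient.sound (x.2.atomSetoid.symm hc'))⟩
  · exact ProbOn.pull_push _ _ x.1 (sat x.1)
  · exact ProbOn.pull_push _ _ x.2 (sat x.2)

theorem Factors.of_comp {Ω' Ω : CSur} (q : Ω' ⟶ Ω) {x : ProbOn Ω.carrier × ProbOn Ω.carrier}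
    (h : Factors Ω' (CSur.pb q x.1, CSur.pb q x.2)) : Factors Ω x := by
  refine factors_of_inter_nonempty x fun s t hs ht hs' ht' => ?_
  obtain ⟨c, hc, hc'⟩ := h.inter_nonempty (s := q.toFun ⁻¹' s) (t := q.toFun ⁻¹' t)
    ⟨s, hs, rfl⟩ ⟨t, ht, rfl⟩ (hs'.preimage q.surj) (ht'.preimage q.surj)
  exact ⟨q.toFun c, hc, hc'⟩

theorem IsFactorization.join_unique {Ω Ω₁ Ω₂ Ω₁' Ω₂' : CSur} {p : Ω ⟶ Ω₁.prod Ω₂}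
    {P₁ : ProbOn Ω₁.carrier} {P₂ : ProbOn Ω₂.carrier} {p' : Ω ⟶ Ω₁'.prod Ω₂'}
    {P₁' : ProbOn Ω₁'.carrier} {P₂' : ProbOn Ω₂'.carrier}
    {x : ProbOn Ω.carrier × ProbOn Ω.carrier} (h : IsFactorization p P₁ P₂ x)
    (h' : IsFactorization p' P₁' P₂' x) :
    CSur.pb p (P₁.prod P₂) = CSur.pb p' (P₁'.prod P₂') := by
  have alg : ∀ {Ω₁ Ω₂ : CSur} {p : Ω ⟶ Ω₁.prod Ω₂} {P₁ : ProbOn Ω₁.carrier}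
      {P₂ : ProbOn Ω₂.carrier}, IsFactorization p P₁ P₂ x →
      (CSur.pb p (P₁.prod P₂)).alg = x.1.alg ⊔ x.2.alg := by
    intro Ω₁ Ω₂ p P₁ P₂ h
    rw [← h.1, ← h.2]
    change MeasurableSpace.comap p.toFun (P₁.alg.comap Prod.fst ⊔ P₂.alg.comap Prod.snd) = _
    rw [MeasurableSpace.comap_sup, MeasurableSpace.comap_comp, MeasurableSpace.comap_comp]
    rfl
  have val : ∀ {Ω₁ Ω₂ : CSur} {p : Ω ⟶ Ω₁.prod Ω₂} {P₁ : ProbOn Ω₁.carrier}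
      {P₂ : ProbOn Ω₂.carrier}, IsFactorization p P₁ P₂ x →
      ∀ s t, MeasurableSet[x.1.alg] s → MeasurableSet[x.2.alg] t →
        (CSur.pb p (P₁.prod P₂)).meas (s ∩ t) = x.1.meas s * x.2.meas t := by
    intro Ω₁ Ω₂ p P₁ P₂ h s t hs ht
    rw [← h.1] at hs ⊢
    rw [← h.2] at ht ⊢
    obtain ⟨s, hs, rfl⟩ := hs
    obtain ⟨t, ht, rfl⟩ := ht
    rw [ProbOn.pull_apply _ _ _ hs, ProbOn.pull_apply _ _ _ ht, ← ProbOn.prod_apply,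
      ← ProbOn.pull_apply p.toFun p.surj]
    · rfl
    · let _ := P₁.alg
      let _ := P₂.alg
      exact MeasurableSet.prod hs ht
  have hgen : x.1.alg ⊔ x.2.alg = MeasurableSpace.generateFrom
      {u | ∃ s t, MeasurableSet[x.1.alg] s ∧ MeasurableSet[x.2.alg] t ∧ u = s ∩ t} := by
    refine le_antisymm (sup_le ?_ ?_) (MeasurableSpace.generateFrom_le ?_)
    · exact fun s hs => MeasurableSpace.measurableSet_generateFrom
        ⟨s, Set.univ, hs, MeasurableSet.univ, (Set.inter_univ s).symm⟩
    · exact fun s hs => MeasurableSpace.measurableSet_generateFrom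
        ⟨Set.univ, s, MeasurableSet.univ, hs, (Set.univ_inter s).symm⟩
    · rintro _ ⟨s, t, hs, ht, rfl⟩
      exact @MeasurableSet.inter _ (x.1.alg ⊔ x.2.alg) _ _ ((le_sup_left : x.1.alg ≤ _) s hs)
        ((le_sup_right : x.2.alg ≤ _) t ht)
  refine ProbOn.eq_of_isPiSystem (hgen ▸ alg h) (hgen ▸ alg h') ?_ ?_
  · rintro _ ⟨s, t, hs, ht, rfl⟩ _ ⟨s', t', hs', ht', rfl⟩ -
    exact ⟨s ∩ s', t ∩ t', @MeasurableSet.inter _ x.1.alg _ _ hs hs',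
      @MeasurableSet.inter _ x.2.alg _ _ ht ht', Set.inter_inter_inter_comm _ _ _ _⟩
  · rintro _ ⟨s, t, hs, ht, rfl⟩
    rw [val h s t hs ht, val h' s t hs ht]

/-- The join of a pair that factors through `p : Ω ↠ Ω₁ × Ω₂` as the pullbacks of `P₁` and `P₂`:
the pullback along `p` of the product space of `P₁` and `P₂`
(independent of the factorization by `IsFactorization.join_unique`). -/
noncomputable def joinVal {Ω : CSur} {x : ProbOn Ω.carrier × ProbOn Ω.carrier}
    (h : Factors Ω x) : ProbOn Ω.carrier :=
  CSur.pb h.choose_spec.choose_spec.choose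
    (h.choose_spec.choose_spec.choose_spec.choose.prod
      h.choose_spec.choose_spec.choose_spec.choose_spec.choose)

theorem IsFactorization.joinVal_eq {Ω Ω₁ Ω₂ : CSur} {p : Ω ⟶ Ω₁.prod Ω₂}
    {P₁ : ProbOn Ω₁.carrier} {P₂ : ProbOn Ω₂.carrier} {x : ProbOn Ω.carrier × ProbOn Ω.carrier}
    (h : IsFactorization p P₁ P₂ x) (hx : Factors Ω x) :
    joinVal hx = CSur.pb p (P₁.prod P₂) :=
  IsFactorization.join_unique hx.choose_spec.choose_spec.choose_spec.choose_spec.choose_spec h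

theorem joinVal_comp {Ω' Ω : CSur} (q : Ω' ⟶ Ω) {x : ProbOn Ω.carrier × ProbOn Ω.carrier}
    (hx : Factors Ω x) : joinVal (hx.comp q) = CSur.pb q (joinVal hx) := by
  obtain ⟨Ω₁, Ω₂, p, P₁, P₂, h⟩ := id hx
  rw [h.joinVal_eq hx, (h.comp q).joinVal_eq, CSur.pb_comp]

/-! ### The sheaves -/

/-- The presheaf of pairs of probability spaces. -/
noncomputable def DPP : CSurᵒᵖ ⥤ Type where
  obj Ω := ProbOn Ω.unop.carrier × ProbOn Ω.unop.carrier
  map p := ↾(fun x => (CSur.pb p.unop x.1, CSur.pb p.unop x.2))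
  map_id Ω := by
    refine ConcreteCategory.hom_ext _ _ fun x => ?_
    exact Prod.ext_iff.2 ⟨ProbOn.pull_id x.1, ProbOn.pull_id x.2⟩
  map_comp p q := by
    refine ConcreteCategory.hom_ext _ _ fun x => ?_
    exact Prod.ext_iff.2 ⟨CSur.pb_comp q.unop p.unop x.1, CSur.pb_comp q.unop p.unop x.2⟩

theorem DPP_isAtomicSheaf : IsAtomicSheaf DPP := by
  intro Ω' Ω p y hy
  obtain ⟨x₁, h₁⟩ := ProbOn.exists_restriction p y.1
    fun Ω'' q r h => congrArg Prod.fst (hy Ω'' q r h)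
  obtain ⟨x₂, h₂⟩ := ProbOn.exists_restriction p y.2
    fun Ω'' q r h => congrArg Prod.snd (hy Ω'' q r h)
  refine ⟨(x₁, x₂), Prod.ext h₁ h₂, fun x' hx' => Prod.ext ?_ ?_⟩
  · exact ProbOn.pull_injective _ p.surj ((congrArg Prod.fst hx').trans h₁.symm)
  · exact ProbOn.pull_injective _ p.surj ((congrArg Prod.snd hx').trans h₂.symm)

/-- The presheaf `P²_⊥` of pairs of probability spaces that factor through a product. -/
noncomputable def DP2 : CSurᵒᵖ ⥤ Type where
  obj Ω := {x : ProbOn Ω.unop.carrier × ProbOn Ω.unop.carrier // Factors Ω.unop x}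
  map p := ↾(fun x => ⟨(CSur.pb p.unop x.1.1, CSur.pb p.unop x.1.2), x.2.comp p.unop⟩)
  map_id Ω := by
    refine ConcreteCategory.hom_ext _ _ fun x => ?_
    exact Subtype.ext (Prod.ext_iff.2 ⟨ProbOn.pull_id x.1.1, ProbOn.pull_id x.1.2⟩)
  map_comp p q := by
    refine ConcreteCategory.hom_ext _ _ fun x => ?_
    exact Subtype.ext
      (Prod.ext_iff.2 ⟨CSur.pb_comp q.unop p.unop x.1.1, CSur.pb_comp q.unop p.unop x.1.2⟩)

theorem DP2_isAtomicSheaf : IsAtomicSheaf DP2 := by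
  intro Ω' Ω p y hy
  obtain ⟨x, hx, hx'⟩ := DPP_isAtomicSheaf Ω' Ω p y.1
    fun Ω'' q r h => congrArg Subtype.val (hy Ω'' q r h)
  have hF : Factors Ω x := Factors.of_comp p (by
    have h : (CSur.pb p x.1, CSur.pb p x.2) = y.1 := hx
    rw [h]
    exact y.2)
  exact ⟨⟨x, hF⟩, Subtype.ext hx, fun z hz => Subtype.ext (hx' z.1 (congrArg Subtype.val hz))⟩

theorem const_isAtomicSheaf (A : Type) : IsAtomicSheaf ((Functor.const CSurᵒᵖ).obj A) :=
  fun _ _ _ y _ => ⟨y, rfl, fun _ h => h⟩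

/-- The atomic sheaf `P` of probability spaces. -/
noncomputable def shP : DSh := ⟨DP, DP_isAtomicSheaf⟩

/-- The atomic sheaf `P × P`. -/
noncomputable def shPP : DSh := ⟨DPP, DPP_isAtomicSheaf⟩

/-- The atomic sheaf `P²_⊥`. -/
noncomputable def shP2 : DSh := ⟨DP2, DP2_isAtomicSheaf⟩

/-- The constant sheaf of truth values. -/
def shProp : DSh := ⟨(Functor.const CSurᵒᵖ).obj Prop, const_isAtomicSheaf Prop⟩

/-- The terminal sheaf. -/
def shOne : DSh := ⟨(Functor.const CSurᵒᵖ).obj PUnit, const_isAtomicSheaf PUnit⟩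

noncomputable def shFst : shPP ⟶ shP :=
  ObjectProperty.homMk { app := fun _ => ↾(fun x => x.1) }

noncomputable def shSnd : shPP ⟶ shP :=
  ObjectProperty.homMk { app := fun _ => ↾(fun x => x.2) }

/-- The global element `true`. -/
def shTrue : shOne ⟶ shProp :=
  ObjectProperty.homMk { app := fun _ => ↾(fun _ => True) }

/-- The subspace ordering as a natural transformation. -/
noncomputable def shOrd : shPP ⟶ shProp :=
  ObjectProperty.homMk
    { app := fun _ => ↾(fun x => x.1.le x.2)
      naturality := by
        intro Ω Ω' p
        ext x
        exact propext (ProbOn.le_pull p.unop.toFun p.unop.surj x.1 x.2) }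

/-- The inclusion of `P²_⊥` in `P × P`. -/
noncomputable def shInc : shP2 ⟶ shPP :=
  ObjectProperty.homMk { app := fun _ => ↾(fun x => x.1) }

/-- The join `P²_⊥ ⟶ P`. -/
noncomputable def shJoin : shP2 ⟶ shP :=
  ObjectProperty.homMk
    { app := fun _ => ↾(fun x => joinVal x.2)
      naturality := by
        intro Ω Ω' p
        ext x
        exact joinVal_comp p.unop x.2 }

/-- The trivial probability space as a global element. -/
noncomputable def shEmp : shOne ⟶ shP :=
  ObjectProperty.homMk
    { app := fun Ω => ↾(fun _ => ProbOn.triv Ω.unop.carrier)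
      naturality := by
        intro Ω Ω' p
        ext x
        exact (ProbOn.triv_pull p.unop.toFun p.unop.surj).symm }

/-- `T`, with the pairing `u`, is the Day convolution of the presheaves `F` and `G` for the product
of sample spaces: `u` is the universal family of maps `F Ω₁ × G Ω₂ → H (Ω₁ × Ω₂)` natural in
`Ω₁` and `Ω₂`. -/
def IsDayConvolution (F G T : CSurᵒᵖ ⥤ Type)
    (u : ∀ Ω₁ Ω₂ : CSur, F.obj (op Ω₁) → G.obj (op Ω₂) → T.obj (op (Ω₁.prod Ω₂))) : Prop :=
  (∀ (Ω₁ Ω₁' Ω₂ Ω₂' : CSur) (f : Ω₁' ⟶ Ω₁) (g : Ω₂' ⟶ Ω₂) (a : F.obj (op Ω₁))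
    (b : G.obj (op Ω₂)),
    u Ω₁' Ω₂' (F.map f.op a) (G.map g.op b) = T.map (CSur.prodMap f g).op (u Ω₁ Ω₂ a b)) ∧
  ∀ (H : CSurᵒᵖ ⥤ Type)
    (φ : ∀ Ω₁ Ω₂ : CSur, F.obj (op Ω₁) → G.obj (op Ω₂) → H.obj (op (Ω₁.prod Ω₂))),
    (∀ (Ω₁ Ω₁' Ω₂ Ω₂' : CSur) (f : Ω₁' ⟶ Ω₁) (g : Ω₂' ⟶ Ω₂) (a : F.obj (op Ω₁))
      (b : G.obj (op Ω₂)),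
      φ Ω₁' Ω₂' (F.map f.op a) (G.map g.op b) = H.map (CSur.prodMap f g).op (φ Ω₁ Ω₂ a b)) →
    ∃! ψ : T ⟶ H, ∀ (Ω₁ Ω₂ : CSur) (a : F.obj (op Ω₁)) (b : G.obj (op Ω₂)),
      ψ.app (op (Ω₁.prod Ω₂)) (u Ω₁ Ω₂ a b) = φ Ω₁ Ω₂ a b

/-- The pair `(π₁⁻¹ P₁, π₂⁻¹ P₂)` on `Ω₁ × Ω₂`. -/
noncomputable def dayPairing (Ω₁ Ω₂ : CSur) (P₁ : shP.obj.obj (op Ω₁)) (P₂ : shP.obj.obj (op Ω₂)) :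
    shP2.obj.obj (op (Ω₁.prod Ω₂)) :=
  ⟨(CSur.pb (CSur.fst Ω₁ Ω₂) P₁, CSur.pb (CSur.snd Ω₁ Ω₂) P₂),
    Ω₁, Ω₂, 𝟙 _, P₁, P₂, by rw [Category.id_comp], by rw [Category.id_comp]⟩

/-! ### The automorphism group of `[0,1]` -/

/-- Measurable self-maps of `[0,1]` for which preimages of negligible sets are negligible
(so that composition is well defined modulo almost-everywhere equality). Every Lebesgue-measurable
map is almost everywhere equal to a Borel-measurable one, so Borel maps suffice. -/
def nsMaps : Submonoid (Function.End unitInterval) where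
  carrier := {f | Measure.QuasiMeasurePreserving f volume volume}
  one_mem' := Measure.QuasiMeasurePreserving.id _
  mul_mem' hf hg := Measure.QuasiMeasurePreserving.comp hf hg

/-- Almost-everywhere equality. -/
def nsCon : Con nsMaps where
  r f g := f.1 =ᵐ[volume] g.1
  iseqv := ⟨fun _ => ae_eq_refl _, fun h => h.symm, fun h h' => h.trans h'⟩
  mul' {f f' g g'} hf hg := by
    have h1 : f.1 ∘ g.1 =ᵐ[volume] f'.1 ∘ g.1 := g.2.ae_eq hf
    have h2 : f'.1 ∘ g.1 =ᵐ[volume] f'.1 ∘ g'.1 := hg.fun_comp f'.1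
    exact h1.trans h2

/-- The group of measurable maps `[0,1] → [0,1]` that are invertible modulo almost-everywhere
equality, identified when equal almost everywhere; the multiplication is composition. -/
def AutI : Type := nsCon.Quotientˣ

instance : Group AutI := inferInstanceAs (Group nsCon.Quotientˣ)

namespace AutI

/-- A representative of an automorphism. -/
noncomputable def rep (π : AutI) : unitInterval → unitInterval :=
  (Quotient.out (s := nsCon.toSetoid) π.val).1

theorem rep_qmp (π : AutI) : Measure.QuasiMeasurePreserving π.rep volume volume :=
  (Quotient.out (s := nsCon.toSetoid) π.val).2

theorem mk_rep (π : AutI) : ((⟨π.rep, π.rep_qmp⟩ : nsMaps) : nsCon.Quotient) = π.val :=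
  Quotient.out_eq (s := nsCon.toSetoid) π.val

theorem rep_one : (1 : AutI).rep =ᵐ[volume] id :=
  nsCon.eq.1 ((mk_rep 1).trans rfl : _ = ((1 : nsMaps) : nsCon.Quotient))

theorem rep_mul (π σ : AutI) : (π * σ).rep =ᵐ[volume] π.rep ∘ σ.rep := by
  have h : ((⟨(π * σ).rep, (π * σ).rep_qmp⟩ : nsMaps) : nsCon.Quotient) =
      (((⟨π.rep, π.rep_qmp⟩ : nsMaps) * (⟨σ.rep, σ.rep_qmp⟩ : nsMaps) : nsMaps) :
        nsCon.Quotient) := by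
    rw [mk_rep, Con.coe_mul, mk_rep, mk_rep]
    rfl
  exact nsCon.eq.1 h

theorem preimage_one (s : Set unitInterval) : (1 : AutI).rep ⁻¹' s =ᵐ[volume] s := by
  filter_upwards [rep_one] with x hx
  change s ((1 : AutI).rep x) = s x
  rw [hx]
  rfl

theorem preimage_mul (π σ : AutI) (s : Set unitInterval) :
    (π * σ).rep ⁻¹' s =ᵐ[volume] σ.rep ⁻¹' (π.rep ⁻¹' s) := by
  filter_upwards [rep_mul π σ] with x hx
  change s ((π * σ).rep x) = s (π.rep (σ.rep x))
  rw [hx]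
  rfl

end AutI

/-! ### Countable measurable partitions of `[0,1]` -/

/-- A countable partition of `[0,1]` into Lebesgue-measurable nonnegligible sets
(indexed by a set of natural numbers). -/
structure Partn : Type where
  I : Set ℕ
  part : I → Set unitInterval
  meas : ∀ i, NullMeasurableSet (part i) volume
  nonnull : ∀ i, volume (part i) ≠ 0
  disj : Pairwise (Function.onFun Disjoint part)
  cover : ⋃ i, part i = Set.univ

namespace Partn

theorem part_inj (A : Partn) {i j : A.I} {s : Set unitInterval}
    (hi : A.part i =ᵐ[volume] s) (hj : A.part j =ᵐ[volume] s) : i = j := by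
  by_contra h
  have h1 : A.part i =ᵐ[volume] A.part j := hi.trans hj.symm
  have h2 : (A.part i ∩ A.part j : Set _) =ᵐ[volume] A.part i := by
    have := (ae_eq_refl (A.part i)).inter h1.symm
    rwa [Set.inter_self] at this
  have h3 := measure_congr h2
  rw [Set.disjoint_iff_inter_eq_empty.1 (A.disj h), measure_empty] at h3
  exact A.nonnull i h3.symm

theorem nonempty (A : Partn) : Nonempty A.I := by
  have h : (⟨0, by simp⟩ : unitInterval) ∈ ⋃ i, A.part i := A.cover ▸ Set.mem_univ _
  obtain ⟨i, -⟩ := Set.mem_iUnion.1 h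
  exact ⟨i⟩

/-- The set of parts of a partition, as a sample space. -/
def space (A : Partn) : CSur := @CSur.mk A.I _ A.nonempty

/-- The partition of the preimages of the parts. -/
noncomputable def act (A : Partn) (π : AutI) : Partn where
  I := A.I
  part i := π.rep ⁻¹' A.part i
  meas i := (A.meas i).preimage π.rep_qmp
  nonnull i h := by
    have h1 := π⁻¹.rep_qmp.preimage_null h
    rw [measure_congr (AutI.preimage_mul π π⁻¹ _).symm, mul_inv_cancel,
      measure_congr (AutI.preimage_one _)] at h1
    exact A.nonnull i h1
  disj i j h := (A.disj h).preimage _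
  cover := by rw [← Set.preimage_iUnion, A.cover, Set.preimage_univ]

/-- The permutations that fix every part of the partition up to a negligible set. -/
def fix (A : Partn) : Set AutI := {π | ∀ i, π.rep ⁻¹' A.part i =ᵐ[volume] A.part i}

/-- Almost-everywhere equality of partitions. -/
def AEEq (A B : Partn) : Prop := ∀ i, ∃! j, A.part i =ᵐ[volume] B.part j

/-- Almost every point of a nonnegligible set lies in some part. -/
theorem exists_inter (A : Partn) (s : Set unitInterval) (hs : volume s ≠ 0) :
    ∃ i, volume (A.part i ∩ s) ≠ 0 := by
  by_contra! h
  refine hs ?_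
  rw [← Set.univ_inter s, ← A.cover, Set.iUnion_inter]
  exact measure_iUnion_null h

theorem AEEq.symm {A B : Partn} (h : AEEq A B) : AEEq B A := by
  intro j
  obtain ⟨i, hi⟩ := A.exists_inter _ (B.nonnull j)
  obtain ⟨j', hj', -⟩ := h i
  have : j' = j := by
    by_contra hne
    have h1 : (A.part i ∩ B.part j : Set _) =ᵐ[volume] (B.part j' ∩ B.part j : Set _) :=
      hj'.inter (ae_eq_refl _)
    rw [Set.disjoint_iff_inter_eq_empty.1 (B.disj hne)] at h1
    exact hi ((measure_congr h1).trans measure_empty)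
  subst this
  exact ⟨i, hj'.symm, fun i' hi' => A.part_inj hi'.symm hj'⟩

end Partn

/-- The topology of the automorphism group, generated by the cosets of the subgroups fixing a
countable measurable partition. -/
instance : TopologicalSpace AutI :=
  TopologicalSpace.generateFrom
    {U | ∃ (π : AutI) (A : Partn), U = {τ | ∃ σ ∈ A.fix, τ = π * σ}}

theorem Partn.one_mem_fix (A : Partn) : (1 : AutI) ∈ A.fix := fun _ => AutI.preimage_one _

theorem isOpen_of_coset {U : Set AutI}
    (h : ∀ π ∈ U, ∃ A : Partn, ∀ σ ∈ A.fix, π * σ ∈ U) : IsOpen U := by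
  rw [isOpen_iff_forall_mem_open]
  intro π hπ
  obtain ⟨A, hA⟩ := h π hπ
  refine ⟨{τ | ∃ σ ∈ A.fix, τ = π * σ}, ?_, ?_, ⟨1, A.one_mem_fix, (mul_one π).symm⟩⟩
  · rintro _ ⟨σ, hσ, rfl⟩
    exact hA σ hσ
  · exact TopologicalSpace.isOpen_generateFrom_of_mem ⟨π, A, rfl⟩

/-! ### Sets with a continuous right action -/

/-- Sets with a right action of `AutI` (a left action of the opposite group) whose elements have
open stabilizers. -/
structure DGSet : Type 1 where
  carrier : Type
  [action : MulAction AutIᵐᵒᵖ carrier]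
  open_stab : ∀ x : carrier, IsOpen {π : AutI | MulOpposite.op π • x = x}

attribute [instance] DGSet.action

/-- Morphisms are equivariant functions. -/
instance : Category DGSet where
  Hom X Y := X.carrier →[AutIᵐᵒᵖ] Y.carrier
  id X := MulActionHom.id AutIᵐᵒᵖ
  comp f g := g.comp f

theorem isOpen_stab_of_fix {X : Type} [MulAction AutIᵐᵒᵖ X] (x : X) (A : Partn)
    (h : ∀ σ ∈ A.fix, MulOpposite.op σ • x = x) :
    IsOpen {π : AutI | MulOpposite.op π • x = x} := by
  refine isOpen_of_coset fun π hπ => ⟨A, fun σ hσ => ?_⟩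
  change MulOpposite.op (π * σ) • x = x
  rw [MulOpposite.op_mul, mul_smul, show MulOpposite.op π • x = x from hπ, h σ hσ]

/-! ### Countable measured partitions -/

/-- A countable measurable partition with weights of sum `1` on its parts. -/
structure Weighted : Type extends Partn where
  wt : I → ENNReal
  sum_wt : ∑' i, wt i = 1

namespace Weighted

/-- Equality of measured partitions: the partitions are almost-everywhere equal and the weights
agree. -/
def Equiv (P Q : Weighted) : Prop :=
  Partn.AEEq P.toPartn Q.toPartn ∧ ∀ i j, P.part i =ᵐ[volume] Q.part j → P.wt i = Q.wt j

theorem equiv_of_map {P Q : Weighted}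
    (h : ∀ i, ∃ j, P.part i =ᵐ[volume] Q.part j ∧ P.wt i = Q.wt j) : Equiv P Q := by
  refine ⟨fun i => ?_, fun i j hij => ?_⟩
  · obtain ⟨j, hj, -⟩ := h i
    exact ⟨j, hj, fun j' hj' => Q.part_inj hj'.symm hj.symm⟩
  · obtain ⟨j', hj', hw⟩ := h i
    rw [hw, Q.part_inj hj'.symm hij.symm]

theorem Equiv.exists {P Q : Weighted} (h : Equiv P Q) (i : P.I) :
    ∃ j, P.part i =ᵐ[volume] Q.part j ∧ P.wt i = Q.wt j := by
  obtain ⟨j, hj, -⟩ := h.1 i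
  exact ⟨j, hj, h.2 i j hj⟩

theorem Equiv.symm {P Q : Weighted} (h : Equiv P Q) : Equiv Q P :=
  ⟨h.1.symm, fun i j hij => (h.2 j i hij.symm).symm⟩

instance setoid : Setoid Weighted where
  r := Equiv
  iseqv := ⟨fun P => equiv_of_map fun i => ⟨i, ae_eq_refl _, rfl⟩, Equiv.symm, fun h h' =>
    equiv_of_map fun i => by
      obtain ⟨j, hj, hw⟩ := h.exists i
      obtain ⟨k, hk, hw'⟩ := h'.exists j
      exact ⟨k, hj.trans hk, hw.trans hw'⟩⟩

/-- The action on measured partitions: preimages of the parts, with the same weights. -/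
noncomputable def act (P : Weighted) (π : AutI) : Weighted where
  toPartn := P.toPartn.act π
  wt := P.wt
  sum_wt := P.sum_wt

/-- The ordering: the partition of `P` is coarser than that of `Q`, and the weights of `Q`
restrict to those of `P`. -/
def le (P Q : Weighted) : Prop :=
  ∃ p : Q.I → P.I, (∀ j, Q.part j ≤ᵐ[volume] P.part (p j)) ∧
    ∀ i, P.wt i = ∑' j : {j // p j = i}, Q.wt j

/-- `R` is an independent combination of `P` and `Q`: the parts of `R` are exactly the
intersections of a part of `P` and a part of `Q` (in particular all these intersections are
nonnegligible), and the weight of an intersection is the product of the weights. -/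
def IsIndep (P Q R : Weighted) : Prop :=
  (∀ k, ∃ i j, R.part k =ᵐ[volume] (P.part i ∩ Q.part j : Set unitInterval)) ∧
  ∀ i j, ∃ k, R.part k =ᵐ[volume] (P.part i ∩ Q.part j : Set unitInterval) ∧
    R.wt k = P.wt i * Q.wt j

theorem IsIndep.unique {P Q R P' Q' R' : Weighted} (hP : Equiv P P') (hQ : Equiv Q Q')
    (h : IsIndep P Q R) (h' : IsIndep P' Q' R') : Equiv R R' := by
  refine equiv_of_map fun k => ?_
  obtain ⟨i, j, hk⟩ := h.1 k
  obtain ⟨k', hk', hw⟩ := h.2 i j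
  obtain rfl := R.part_inj hk hk'
  obtain ⟨i', hi, hwi⟩ := hP.exists i
  obtain ⟨j', hj, hwj⟩ := hQ.exists j
  obtain ⟨l, hl, hwl⟩ := h'.2 i' j'
  exact ⟨l, hk.trans ((hi.inter hj).trans hl.symm), by rw [hw, hwl, hwi, hwj]⟩

theorem le.act {P Q : Weighted} (h : le P Q) (π : AutI) : le (P.act π) (Q.act π) := by
  obtain ⟨p, hp, hw⟩ := h
  exact ⟨p, fun j => π.rep_qmp.preimage_mono_ae (hp j), hw⟩

theorem IsIndep.act {P Q R : Weighted} (h : IsIndep P Q R) (π : AutI) :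
    IsIndep (P.act π) (Q.act π) (R.act π) := by
  refine ⟨fun k => ?_, fun i j => ?_⟩
  · obtain ⟨i, j, hk⟩ := h.1 k
    exact ⟨i, j, π.rep_qmp.preimage_ae_eq hk⟩
  · obtain ⟨k, hk, hw⟩ := h.2 i j
    exact ⟨k, π.rep_qmp.preimage_ae_eq hk, hw⟩

end Weighted

/-- The set of countable measured partitions of `[0,1]`. -/
def MP : Type := Quotient Weighted.setoid

namespace MP

noncomputable instance : MulAction AutIᵐᵒᵖ MP where
  smul π := Quotient.map (fun P => P.act π.unop) fun P Q h =>
    Weighted.equiv_of_map fun i => by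
      obtain ⟨j, hj, hw⟩ := Weighted.Equiv.exists h i
      exact ⟨j, π.unop.rep_qmp.preimage_ae_eq hj, hw⟩
  one_smul x := by
    induction x using Quotient.inductionOn with | _ P
    exact Quotient.sound (Weighted.equiv_of_map fun i => ⟨i, AutI.preimage_one _, rfl⟩)
  mul_smul π σ x := by
    induction x using Quotient.inductionOn with | _ P
    exact Quotient.sound (Weighted.equiv_of_map fun i => ⟨i, AutI.preimage_mul _ _ _, rfl⟩)

theorem isOpen_stab (x : MP) : IsOpen {π : AutI | MulOpposite.op π • x = x} := by
  induction x using Quotient.inductionOn with | _ P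
  exact isOpen_stab_of_fix _ P.toPartn fun σ hσ =>
    Quotient.sound (Weighted.equiv_of_map fun i => ⟨i, hσ i, rfl⟩)

/-- The ordering on measured partitions. -/
def le (x y : MP) : Prop :=
  ∃ P Q : Weighted, Quotient.mk _ P = x ∧ Quotient.mk _ Q = y ∧ P.le Q

/-- `z` is the independent combination of `x` and `y`. -/
def IsIndep (x y z : MP) : Prop :=
  ∃ P Q R : Weighted, Quotient.mk _ P = x ∧ Quotient.mk _ Q = y ∧ Quotient.mk _ R = z ∧
    P.IsIndep Q R

theorem le.smul {x y : MP} (h : le x y) (π : AutIᵐᵒᵖ) : le (π • x) (π • y) := by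
  obtain ⟨P, Q, rfl, rfl, h⟩ := h
  exact ⟨P.act π.unop, Q.act π.unop, rfl, rfl, h.act _⟩

theorem smul_le_smul_iff {x y : MP} (π : AutIᵐᵒᵖ) : le (π • x) (π • y) ↔ le x y := by
  refine ⟨fun h => ?_, fun h => h.smul π⟩
  have := h.smul π⁻¹
  rwa [inv_smul_smul, inv_smul_smul] at this

theorem IsIndep.smul {x y z : MP} (h : IsIndep x y z) (π : AutIᵐᵒᵖ) :
    IsIndep (π • x) (π • y) (π • z) := by
  obtain ⟨P, Q, R, rfl, rfl, rfl, h⟩ := h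
  exact ⟨P.act π.unop, Q.act π.unop, R.act π.unop, rfl, rfl, rfl, h.act _⟩

theorem IsIndep.unique {x y z z' : MP} (h : IsIndep x y z) (h' : IsIndep x y z') : z = z' := by
  obtain ⟨P, Q, R, hP, hQ, rfl, h⟩ := h
  obtain ⟨P', Q', R', hP', hQ', rfl, h'⟩ := h'
  exact Quotient.sound (h.unique (Quotient.exact (hP.trans hP'.symm))
    (Quotient.exact (hQ.trans hQ'.symm)) h')

/-- The measured partition with a single part of weight `1`. -/
noncomputable def emp : MP := Quotient.mk _
  { I := {0}
    part := fun _ => Set.univ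
    meas := fun _ => MeasurableSet.univ.nullMeasurableSet
    nonnull := fun _ => by simp
    disj := fun i j h => (h (Subsingleton.elim i j)).elim
    cover := Set.iUnion_const _
    wt := fun _ => 1
    sum_wt := by simp }

theorem smul_emp (π : AutIᵐᵒᵖ) : π • emp = emp := rfl

end MP

/-- The `AutI`-set of countable measured partitions. -/
noncomputable def gP : DGSet := ⟨MP, MP.isOpen_stab⟩

/-- The `AutI`-set of pairs of countable measured partitions. -/
noncomputable def gPP : DGSet where
  carrier := MP × MP
  open_stab x := by
    convert (MP.isOpen_stab x.1).inter (MP.isOpen_stab x.2) using 1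
    ext π
    exact Prod.ext_iff

/-- The `AutI`-set of independently combinable pairs, with the pointwise action. -/
noncomputable def gP2 : DGSet where
  carrier := {x : MP × MP // ∃ z, MP.IsIndep x.1 x.2 z}
  action :=
    { smul := fun π x => ⟨π • x.1, by
        obtain ⟨z, hz⟩ := x.2
        exact ⟨π • z, hz.smul π⟩⟩
      one_smul := fun x => Subtype.ext (one_smul _ x.1)
      mul_smul := fun π σ x => Subtype.ext (mul_smul π σ x.1) }
  open_stab x := by
    convert gPP.open_stab x.1 using 1
    ext π
    exact Subtype.ext_iff

/-- A set with the trivial action. -/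
def trivialAction (A : Type) : DGSet where
  carrier := A
  action :=
    { smul := fun _ a => a
      one_smul := fun _ => rfl
      mul_smul := fun _ _ _ => rfl }
  open_stab x := by
    convert isOpen_univ (X := AutI)
    exact Set.eq_univ_of_forall fun _ => rfl

/-- The two-element set of truth values with the trivial action. -/
def gProp : DGSet := trivialAction Prop

/-- The one-point set. -/
def gOne : DGSet := trivialAction PUnit

noncomputable def gFst : gPP ⟶ gP where
  toFun x := x.1
  map_smul' _ _ := rfl

noncomputable def gSnd : gPP ⟶ gP where
  toFun x := x.2
  map_smul' _ _ := rfl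

def gTrue : gOne ⟶ gProp where
  toFun _ := True
  map_smul' _ _ := rfl

noncomputable def gOrd : gPP ⟶ gProp where
  toFun x := MP.le x.1 x.2
  map_smul' π _ := propext (MP.smul_le_smul_iff π)

/-- The inclusion of the independently combinable pairs in all pairs. -/
noncomputable def gInc : gP2 ⟶ gPP where
  toFun x := x.1
  map_smul' _ _ := rfl

/-- Independent combination. -/
noncomputable def gJoin : gP2 ⟶ gP where
  toFun x := x.2.choose
  map_smul' π x := MP.IsIndep.unique (π • x).2.choose_spec (x.2.choose_spec.smul π)

noncomputable def gEmp : gOne ⟶ gP where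
  toFun _ := MP.emp
  map_smul' π _ := (MP.smul_emp π).symm

/-! ### The comparison functor -/

/-- The relation generating the colimit of `F (A.space)` over the partitions `A` of `[0,1]` ordered
by refinement: `x` at `A` is identified with its extension to any finer partition. -/
def ColimRel (F : DSh) (a b : Σ A : Partn, F.obj.obj (op A.space)) : Prop :=
  ∃ p : b.1.space ⟶ a.1.space,
    (∀ j, b.1.part j ≤ᵐ[volume] a.1.part (p.toFun j)) ∧ F.obj.map p.op a.2 = b.2

/-- The set of global elements over `[0,1]` of `F`: the colimit of `F (A.space)` over the countable
measurable partitions `A` of `[0,1]`. -/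
def Colim (F : DSh) : Type := Quot (ColimRel F)

theorem map_id_apply' (F : CSurᵒᵖ ⥤ Type) (Ω : CSur) (x : F.obj (op Ω)) :
    F.map (𝟙 Ω : Ω ⟶ Ω).op x = x := by
  rw [op_id, CategoryTheory.Functor.map_id]
  rfl

/-- The action on the colimit: `[A, x] • π = [A • π, x]`. -/
noncomputable instance (F : DSh) : MulAction AutIᵐᵒᵖ (Colim F) where
  smul π := Quot.map (fun a => ⟨a.1.act π.unop, a.2⟩) fun a b ⟨p, hp, h⟩ =>
    ⟨p, fun j => π.unop.rep_qmp.preimage_mono_ae (hp j), h⟩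
  one_smul x := by
    induction x using Quot.inductionOn with | _ a
    refine (Quot.sound ⟨𝟙 a.1.space, fun j => ?_, ?_⟩).symm
    · exact (AutI.preimage_one _).le
    · exact map_id_apply' F.obj _ a.2
  mul_smul π σ x := by
    induction x using Quot.inductionOn with | _ a
    refine (Quot.sound ⟨𝟙 a.1.space, fun j => ?_, ?_⟩).symm
    · exact (AutI.preimage_mul _ _ _).le
    · exact map_id_apply' F.obj _ a.2

theorem Colim.isOpen_stab (F : DSh) (x : Colim F) :
    IsOpen {π : AutI | MulOpposite.op π • x = x} := by
  induction x using Quot.inductionOn with | _ a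
  refine isOpen_stab_of_fix _ a.1 fun σ hσ => (Quot.sound ⟨𝟙 a.1.space, fun j => ?_, ?_⟩).symm
  · exact (hσ j).le
  · exact map_id_apply' F.obj _ a.2

/-- The functor from atomic sheaves to `AutI`-sets. -/
noncomputable def comparison : DSh ⥤ DGSet where
  obj F := ⟨Colim F, Colim.isOpen_stab F⟩
  map {F G} α :=
    { toFun := Quot.map (fun a => ⟨a.1, α.hom.app _ a.2⟩) fun a b ⟨p, hp, h⟩ =>
        ⟨p, hp, by
          rw [← h]
          exact (NatTrans.naturality_apply α.hom p.op a.2).symm⟩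
      map_smul' := fun π x => by
        induction x using Quot.inductionOn with | _ a
        rfl }
  map_id F := by
    refine MulActionHom.ext fun x => ?_
    induction x using Quot.inductionOn with | _ a
    rfl
  map_comp α β := by
    refine MulActionHom.ext fun x => ?_
    induction x using Quot.inductionOn with | _ a
    rfl

/-! ### Internal resource monoids -/

/-- The data of a resource monoid internal to a category: the carrier `R` and the object `RR` of
pairs of its elements, the object `Pr` of truth values, the domain `D` of the partial
multiplication, the terminal object `One`; the projections, the truth value `true`, the ordering,
the inclusion of the domain, the multiplication, the unit. -/
structure RMData (C : Type*) [Category C] where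
  R : C
  RR : C
  Pr : C
  D : C
  One : C
  fst : RR ⟶ R
  snd : RR ⟶ R
  tt : One ⟶ Pr
  ord : RR ⟶ Pr
  inc : D ⟶ RR
  join : D ⟶ R
  emp : One ⟶ R

namespace RMData

variable {C : Type*} [Category C]

/-- `x ⊑ y` for generalized elements `x`, `y` of `R`. -/
def Le (M : RMData C) {X : C} (x y : X ⟶ M.R) : Prop :=
  ∃ (h : X ⟶ M.RR) (t : X ⟶ M.One), h ≫ M.fst = x ∧ h ≫ M.snd = y ∧ h ≫ M.ord = t ≫ M.tt

/-- `x · y` is defined and equal to `z`, for generalized elements `x`, `y`, `z` of `R`. -/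
def Mul (M : RMData C) {X : C} (x y z : X ⟶ M.R) : Prop :=
  ∃ d : X ⟶ M.D, d ≫ M.inc ≫ M.fst = x ∧ d ≫ M.inc ≫ M.snd = y ∧ d ≫ M.join = z

/-- The axioms of an internal resource monoid: a poset with least element and a monotone partial
commutative monoid structure with the least element as unit. -/
structure IsResourceMonoid (M : RMData C) : Prop where
  isProduct : Nonempty (Limits.IsLimit (Limits.BinaryFan.mk M.fst M.snd))
  isTerminal : Nonempty (Limits.IsTerminal M.One)
  mono_inc : Mono M.inc
  le_refl : ∀ {X : C} (x : X ⟶ M.R), M.Le x x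
  le_trans : ∀ {X : C} (x y z : X ⟶ M.R), M.Le x y → M.Le y z → M.Le x z
  le_antisymm : ∀ {X : C} (x y : X ⟶ M.R), M.Le x y → M.Le y x → x = y
  emp_le : ∀ {X : C} (t : X ⟶ M.One) (x : X ⟶ M.R), M.Le (t ≫ M.emp) x
  emp_mul : ∀ {X : C} (t : X ⟶ M.One) (x : X ⟶ M.R), M.Mul (t ≫ M.emp) x x
  mul_comm : ∀ {X : C} (x y z : X ⟶ M.R), M.Mul x y z → M.Mul y x z
  mul_assoc : ∀ {X : C} (x y z xy xyz : X ⟶ M.R), M.Mul x y xy → M.Mul xy z xyz →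
    ∃ yz : X ⟶ M.R, M.Mul y z yz ∧ M.Mul x yz xyz
  mul_mono : ∀ {X : C} (x x' y y' z' : X ⟶ M.R), M.Le x x' → M.Le y y' → M.Mul x' y' z' →
    ∃ z : X ⟶ M.R, M.Mul x y z ∧ M.Le z z'

/-- `M` corresponds to `N` across the functor `Φ`: `Φ` sends the objects of `M` to those of `N` up
to isomorphism, and the structure morphisms of `M` to those of `N`. -/
def Corresponds {D : Type*} [Category D] (Φ : C ⥤ D) (M : RMData C) (N : RMData D) : Prop :=
  ∃ (eR : Φ.obj M.R ≅ N.R) (eRR : Φ.obj M.RR ≅ N.RR) (ePr : Φ.obj M.Pr ≅ N.Pr)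
    (eD : Φ.obj M.D ≅ N.D) (eOne : Φ.obj M.One ≅ N.One),
    Φ.map M.fst ≫ eR.hom = eRR.hom ≫ N.fst ∧
    Φ.map M.snd ≫ eR.hom = eRR.hom ≫ N.snd ∧
    Φ.map M.tt ≫ ePr.hom = eOne.hom ≫ N.tt ∧
    Φ.map M.ord ≫ ePr.hom = eRR.hom ≫ N.ord ∧
    Φ.map M.inc ≫ eRR.hom = eD.hom ≫ N.inc ∧
    Φ.map M.join ≫ eR.hom = eD.hom ≫ N.join ∧
    Φ.map M.emp ≫ eR.hom = eOne.hom ≫ N.emp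

end RMData

/-- The resource monoid in atomic sheaves. -/
noncomputable def shRM : RMData DSh where
  R := shP
  RR := shPP
  Pr := shProp
  D := shP2
  One := shOne
  fst := shFst
  snd := shSnd
  tt := shTrue
  ord := shOrd
  inc := shInc
  join := shJoin
  emp := shEmp

/-- The resource monoid in `AutI`-sets. -/
noncomputable def gRM : RMData DGSet where
  R := gP
  RR := gPP
  Pr := gProp
  D := gP2
  One := gOne
  fst := gFst
  snd := gSnd
  tt := gTrue
  ord := gOrd
  inc := gInc
  join := gJoin
  emp := gEmp

end ProbSep

/-! The unit interval is a homogeneous object for countable sample spaces. A labelling of `[0,1]` by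
`Ω` is a map to `Ω` with measurable nonnegligible fibres, that is, a countable partition indexed by
`Ω`. The distribution function of normalised Lebesgue measure on a nonnegligible set identifies that
set with `[0,1]` modulo null sets (`exists_nonsingular_iso`). Gluing such identifications part by
part shows that the group acts transitively on the labellings by a given `Ω`
(`Labelling.exists_act_ae_eq`). Hence labellings lift along surjections (`Labelling.exists_over`).
Any two have a common refinement (`Labelling.exists_common`), and refinement maps are unique
(`Labelling.Over.hom_ext`).

These facts give the equivalence. For a sheaf `F`, the map `F Ω → Φ F` at a labelling is injective
(`Colim.mk_injective`), and by the restriction axiom its image contains everything fixed by the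
stabilizer of the labelling (`Colim.exists_mk_of_fixed`). An equivariant map preserves such fixed
elements, so it comes from a natural transformation. Conversely, a set `X` with open stabilizers is
recovered from the sheaf of equivariant maps from labellings to `X` (`labelEval_bijective`).

A probability space on a countable set is the pullback of a discrete one on its atoms. Every
factorization of a pair through a product maps on to the product of the two sets of atoms, so a
natural family takes one value on all of them (`IsFactorization.map_eq`); this is the Day
convolution. A pair factors exactly when nonempty events of the two sides always meet, and its join
is determined on intersections of events, which form a π-system (`ProbOn.joins_iff`). The resource
monoid axioms for sheaves are then checked pointwise.

A measured partition is a labelling together with a discrete space on its labels, so passing to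
atoms gives a bijection with `Φ(P)` (`MP.toColim_injective`, `MP.toColim_surjective`). Over a
sufficiently fine labelling, order and independent combination of measured partitions become order
and join of probability spaces (`MP.Repr.le_iff`, `MP.Repr.isIndep_iff`). This yields the
correspondence and also transports the axioms to the group side. -/

namespace ProbSep

/-! ### Nonnegligible subsets of `[0,1]` are isomorphic modulo negligible sets -/

section Cdf

variable (μ : Measure unitInterval) [IsProbabilityMeasure μ]

/-- The distribution function of a probability measure on `[0,1]`. -/
noncomputable def distFun (x : unitInterval) : unitInterval :=
  ⟨μ.real (Set.Iic x), measureReal_nonneg, measureReal_le_one⟩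

/-- The quantile function of a probability measure on `[0,1]`. -/
noncomputable def quantile (u : unitInterval) : unitInterval := sInf {x | u ≤ distFun μ x}

theorem distFun_mono : Monotone (distFun μ) := fun _ _ h =>
  measureReal_mono (Set.Iic_subset_Iic.2 h)

theorem ofReal_distFun (x : unitInterval) :
    ENNReal.ofReal (distFun μ x : ℝ) = μ (Set.Iic x) :=
  ENNReal.ofReal_toReal (measure_ne_top μ _)

variable [NullSingletonClass μ]

/-- As `z → x`, the indicator of `Set.Iic z` is eventually constant at every point other than `x`,
and `{x}` is null, so the measures converge. -/
theorem continuous_distFun : Continuous (distFun μ) := by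
  refine Continuous.subtype_mk (continuous_iff_continuousAt.2 fun x => ?_) _
  refine (ENNReal.tendsto_toReal (measure_ne_top μ _)).comp ?_
  refine tendsto_measure_of_ae_tendsto_indicator_of_isFiniteMeasure (nhds x) measurableSet_Iic
    (fun _ => measurableSet_Iic) ?_
  have : ∀ᵐ y ∂μ, y ≠ x := by
    rw [ae_iff]
    simp
  filter_upwards [this] with y hy
  rcases lt_or_gt_of_ne hy with h | h
  · filter_upwards [lt_mem_nhds h] with z hz
    exact iff_of_true hz.le h.le
  · filter_upwards [gt_mem_nhds h] with z hz
    exact iff_of_false (not_le.2 hz) (not_le.2 h)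

/-- Intermediate value theorem; the value at `0` vanishes because points are null. -/
theorem distFun_surjective : Function.Surjective (distFun μ) := by
  intro u
  have h0 : distFun μ 0 = 0 := by
    refine Subtype.ext ?_
    have : Set.Iic (0 : unitInterval) = {0} := Set.Iic_bot
    simp [distFun, this, Measure.real]
  have h1 : distFun μ 1 = 1 := by
    refine Subtype.ext ?_
    have : Set.Iic (1 : unitInterval) = Set.univ := Set.Iic_top
    simp [distFun, this, Measure.real]
  have := mem_range_of_exists_le_of_exists_ge (continuous_distFun μ) (c := u)
    ⟨0, by rw [h0]; exact u.2.1⟩ ⟨1, by rw [h1]; exact u.2.2⟩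
  exact this

/-- Continuity makes the set whose infimum defines the quantile closed, so the infimum is attained.
-/
theorem quantile_le_iff {u x : unitInterval} : quantile μ u ≤ x ↔ u ≤ distFun μ x := by
  have hc : IsClosed {x | u ≤ distFun μ x} := isClosed_le continuous_const (continuous_distFun μ)
  have hne : {x | u ≤ distFun μ x}.Nonempty := by
    obtain ⟨x, hx⟩ := distFun_surjective μ u
    exact ⟨x, hx.ge⟩
  exact ⟨fun h => (hc.sInf_mem hne).trans (distFun_mono μ h), fun h => sInf_le h⟩

theorem distFun_quantile (u : unitInterval) : distFun μ (quantile μ u) = u := by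
  refine le_antisymm ?_ ((quantile_le_iff μ).1 le_rfl)
  obtain ⟨x, rfl⟩ := distFun_surjective μ u
  exact distFun_mono μ ((quantile_le_iff μ).2 le_rfl)

theorem quantile_mono : Monotone (quantile μ) := fun _ _ h =>
  (quantile_le_iff μ).2 (h.trans (distFun_quantile μ _).ge)

/-- By the adjunction `quantile_le_iff`, the preimage of `Iic x` is `Iic (distFun μ x)`, whose
length is `μ (Iic x)`. -/
theorem measurePreserving_quantile : MeasurePreserving (quantile μ) volume μ := by
  refine ⟨(quantile_mono μ).measurable, ?_⟩
  have := Measure.isProbabilityMeasure_map (μ := volume) (quantile_mono μ).measurable.aemeasurable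
  refine Measure.ext_of_Iic _ _ fun x => ?_
  rw [Measure.map_apply (quantile_mono μ).measurable measurableSet_Iic, ← ofReal_distFun,
    ← unitInterval.volume_Iic]
  congr 1
  ext u
  exact quantile_le_iff μ

theorem measurePreserving_distFun : MeasurePreserving (distFun μ) μ volume := by
  refine ⟨(distFun_mono μ).measurable, ?_⟩
  have h := Measure.map_map (μ := volume) (distFun_mono μ).measurable (quantile_mono μ).measurable
  rwa [(measurePreserving_quantile μ).map_eq,
    show distFun μ ∘ quantile μ = id from funext (distFun_quantile μ), Measure.map_id] at h

/-- The identity can fail where the distribution function is flat, but it holds on the range of the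
quantile function, and `μ` is the image of Lebesgue measure under that function. -/
theorem quantile_distFun : ∀ᵐ x ∂μ, quantile μ (distFun μ x) = x := by
  have hm : MeasurableSet {x | quantile μ (distFun μ x) = x} :=
    measurableSet_eq_fun ((quantile_mono μ).measurable.comp (distFun_mono μ).measurable)
      measurable_id
  have h : ∀ᵐ x ∂Measure.map (quantile μ) volume, quantile μ (distFun μ x) = x := by
    rw [ae_map_iff (quantile_mono μ).measurable.aemeasurable hm]
    exact Filter.Eventually.of_forall fun u => by rw [distFun_quantile]
  rwa [(measurePreserving_quantile μ).map_eq] at h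

end Cdf

/-- A nonnegligible subset of `[0,1]` is isomorphic to `[0,1]` up to negligible sets. -/
theorem exists_nonsingular_iso {A : Set unitInterval} (hA : volume A ≠ 0) :
    ∃ F G : unitInterval → unitInterval,
      Measure.QuasiMeasurePreserving F (volume.restrict A) volume ∧
      Measure.QuasiMeasurePreserving G volume (volume.restrict A) ∧
      (∀ᵐ x ∂volume.restrict A, G (F x) = x) ∧ ∀ u, F (G u) = u := by
  -- Normalisation by a finite nonzero factor leaves the null sets unchanged, so measure
  -- preservation for `μ` yields quasi-measure-preservation for the restriction.
  let μ : Measure unitInterval := (volume A)⁻¹ • volume.restrict A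
  have hP : IsProbabilityMeasure μ := ProbabilityTheory.cond_isProbabilityMeasure hA
  have hμ : μ ≪ volume.restrict A := Measure.smul_absolutelyContinuous
  have hμ' : volume.restrict A ≪ μ :=
    Measure.absolutelyContinuous_smul (ENNReal.inv_ne_zero.2 (measure_ne_top _ _))
  have hN : NullSingletonClass μ :=
    ⟨fun x => (hμ.trans Measure.absolutelyContinuous_restrict) (measure_singleton x)⟩
  exact ⟨distFun μ, quantile μ,
    (measurePreserving_distFun μ).quasiMeasurePreserving.mono_left hμ',
    (measurePreserving_quantile μ).quasiMeasurePreserving.mono_right hμ,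
    hμ'.ae_le (quantile_distFun μ), distFun_quantile μ⟩

/-! ### Labellings of `[0,1]` -/

/-- A labelling of `[0,1]` by a countable set: the map to its set of parts given by a partition
into nonnegligible Lebesgue-measurable sets. -/
structure Labelling (Ω : Type) : Type where
  toFun : unitInterval → Ω
  meas : ∀ a, NullMeasurableSet (toFun ⁻¹' {a}) volume
  nonnull : ∀ a, volume (toFun ⁻¹' {a}) ≠ 0

namespace Labelling

variable {Ω Ω' : Type}

theorem nullMeasurableSet_preimage [Countable Ω] (ℓ : Labelling Ω) (s : Set Ω) :
    NullMeasurableSet (ℓ.toFun ⁻¹' s) volume := by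
  rw [← Set.biUnion_of_singleton s, Set.preimage_iUnion₂]
  exact NullMeasurableSet.biUnion s.to_countable fun a _ => ℓ.meas a

/-- The image labelling under a surjection. -/
def push [Countable Ω'] (ℓ : Labelling Ω') (p : Ω' → Ω) (hp : Function.Surjective p) :
    Labelling Ω where
  toFun := p ∘ ℓ.toFun
  meas a := ℓ.nullMeasurableSet_preimage (p ⁻¹' {a})
  nonnull a h := by
    obtain ⟨b, rfl⟩ := hp a
    exact ℓ.nonnull b (measure_mono_null (fun x hx => congrArg p hx) h)

/-- The labelling precomposed with an automorphism. -/
noncomputable def act (ℓ : Labelling Ω) (π : AutI) : Labelling Ω where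
  toFun := ℓ.toFun ∘ π.rep
  meas a := (ℓ.meas a).preimage π.rep_qmp
  nonnull a h := by
    have h1 := π⁻¹.rep_qmp.preimage_null h
    rw [Set.preimage_comp, measure_congr (AutI.preimage_mul π π⁻¹ _).symm, mul_inv_cancel,
      measure_congr (AutI.preimage_one _)] at h1
    exact ℓ.nonnull a h1

/-- A property that holds almost everywhere in each part holds almost everywhere. -/
theorem ae_of_restrict [Countable Ω] (ℓ : Labelling Ω) {P : unitInterval → Prop}
    (h : ∀ a, ∀ᵐ x ∂volume.restrict (ℓ.toFun ⁻¹' {a}), P x) : ∀ᵐ x, P x := by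
  have h1 := (ae_restrict_iUnion_iff (fun a => ℓ.toFun ⁻¹' {a}) P).2 h
  rw [← Set.preimage_iUnion, Set.iUnion_of_singleton, Set.preimage_univ,
    Measure.restrict_univ] at h1
  exact h1

/-- A property of labels that holds almost everywhere holds for all labels. -/
theorem forall_of_ae (ℓ : Labelling Ω) {P : Ω → Prop} (h : ∀ᵐ x, P (ℓ.toFun x)) (a : Ω) : P a := by
  by_contra ha
  exact ℓ.nonnull a (measure_mono_null (fun x (hx : ℓ.toFun x = a) hP => ha (hx ▸ hP)) h)

theorem ae_eq_label (ℓ : Labelling Ω) (a : Ω) :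
    ∀ᵐ x ∂volume.restrict (ℓ.toFun ⁻¹' {a}), ℓ.toFun x = a :=
  ae_restrict_mem₀ (ℓ.meas a)

/-- A labelling is only Lebesgue measurable, whereas a map glued from branches chosen by label must
be Borel to lie in `nsMaps`; the choice of branch therefore uses this version. -/
theorem exists_measurable [Countable Ω] [Nonempty Ω] (ℓ : Labelling Ω) :
    ∃ m : unitInterval → Ω, Measurable[_, ⊤] m ∧ ℓ.toFun =ᵐ[volume] m := by
  let _ : MeasurableSpace Ω := ⊤
  have h : NullMeasurable ℓ.toFun volume := fun s _ => ℓ.nullMeasurableSet_preimage s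
  exact ⟨h.aemeasurable.mk, h.aemeasurable.measurable_mk, h.aemeasurable.ae_eq_mk⟩

/-- Automorphisms act transitively on the labellings by a given set. -/
theorem exists_act_ae_eq [Countable Ω] [Nonempty Ω] (ℓ ℓ' : Labelling Ω) :
    ∃ π : AutI, (ℓ.act π).toFun =ᵐ[volume] ℓ'.toFun := by
  let _ : MeasurableSpace Ω := ⊤
  choose F G hF hG hGF hFG using fun a => exists_nonsingular_iso (ℓ.nonnull a)
  choose F' G' hF' hG' hGF' hFG' using fun a => exists_nonsingular_iso (ℓ'.nonnull a)
  -- On the part of `ℓ'` labelled `a`, go to `[0,1]` by `F' a` and back to the part of `ℓ` labelled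
  -- `a` by `G a`. The statement is symmetric in the two labellings, so a second use with the roles
  -- exchanged supplies the inverse.
  have key : ∀ (ℓ ℓ' : Labelling Ω) (F G F' G' : Ω → unitInterval → unitInterval),
      (∀ a, Measure.QuasiMeasurePreserving (G a) volume (volume.restrict (ℓ.toFun ⁻¹' {a}))) →
      (∀ a, Measure.QuasiMeasurePreserving (F' a) (volume.restrict (ℓ'.toFun ⁻¹' {a})) volume) →
      (∀ a, ∀ᵐ x ∂volume.restrict (ℓ'.toFun ⁻¹' {a}), G' a (F' a x) = x) →
      (∀ a u, F a (G a u) = u) →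
      ∀ m m' : unitInterval → Ω, ℓ.toFun =ᵐ[volume] m → ℓ'.toFun =ᵐ[volume] m' → Measurable m' →
        Measure.QuasiMeasurePreserving (fun x => G (m' x) (F' (m' x) x)) volume volume ∧
        (∀ᵐ x, ℓ.toFun (G (m' x) (F' (m' x) x)) = ℓ'.toFun x) ∧
        ∀ᵐ x, (fun y => G' (m y) (F (m y) y)) (G (m' x) (F' (m' x) x)) = x := by
    intro ℓ ℓ' F G F' G' hG hF' hGF' hFG m m' hm hm' hmeas
    have hq : ∀ a, Measure.QuasiMeasurePreserving (fun x => G a (F' a x))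
        (volume.restrict (ℓ'.toFun ⁻¹' {a})) (volume.restrict (ℓ.toFun ⁻¹' {a})) :=
      fun a => (hG a).comp (hF' a)
    have hl : ∀ a, ∀ᵐ x ∂volume.restrict (ℓ'.toFun ⁻¹' {a}), ℓ'.toFun x = a ∧ m' x = a := by
      intro a
      filter_upwards [ℓ'.ae_eq_label a, ae_restrict_of_ae hm'] with x h1 h2
      exact ⟨h1, h2.symm.trans h1⟩
    have hle : ∀ a, ∀ᵐ x ∂volume.restrict (ℓ'.toFun ⁻¹' {a}),
        ℓ.toFun (G a (F' a x)) = a ∧ m (G a (F' a x)) = a := by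
      intro a
      refine (hq a).ae (p := fun y => ℓ.toFun y = a ∧ m y = a) ?_
      filter_upwards [ℓ.ae_eq_label a, ae_restrict_of_ae hm] with x h1 h2
      exact ⟨h1, h2.symm.trans h1⟩
    refine ⟨⟨?_, ?_⟩, ?_, ?_⟩
    · have : Measurable fun z : Ω × unitInterval => G z.1 (F' z.1 z.2) :=
        measurable_from_prod_countable_right fun a => (hG a).measurable.comp (hF' a).measurable
      exact this.comp (hmeas.prodMk measurable_id)
    · refine Measure.AbsolutelyContinuous.mk fun N hN hN0 => ?_
      have hmeas' : Measurable fun x => G (m' x) (F' (m' x) x) := by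
        have : Measurable fun z : Ω × unitInterval => G z.1 (F' z.1 z.2) :=
          measurable_from_prod_countable_right fun a => (hG a).measurable.comp (hF' a).measurable
        exact this.comp (hmeas.prodMk measurable_id)
      rw [Measure.map_apply hmeas' hN]
      -- Null preimages are checked on one part at a time, where the glued map is the single branch
      -- `G a ∘ F' a`.
      refine measure_eq_zero_iff_ae_notMem.2 ?_
      change ∀ᵐ x, ¬ (G (m' x) (F' (m' x) x) ∈ N)
      refine ℓ'.ae_of_restrict fun a => ?_
      have : ∀ᵐ y ∂volume.restrict (ℓ.toFun ⁻¹' {a}), y ∉ N :=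
        ae_restrict_of_ae (measure_eq_zero_iff_ae_notMem.1 hN0)
      filter_upwards [hl a, (hq a).ae this] with x h1 h2
      rwa [h1.2]
    · refine ℓ'.ae_of_restrict fun a => ?_
      filter_upwards [hl a, hle a] with x h1 h2
      rw [h1.1, h1.2, h2.1]
    · refine ℓ'.ae_of_restrict fun a => ?_
      filter_upwards [hl a, hle a, hGF' a] with x h1 h2 h3
      simp only [h1.2, h2.2, hFG, h3]
  obtain ⟨m, hmm, hm⟩ := ℓ.exists_measurable
  obtain ⟨m', hmm', hm'⟩ := ℓ'.exists_measurable
  obtain ⟨hf, hfl, hgf⟩ := key ℓ ℓ' F G F' G' hG hF' hGF' hFG m m' hm hm' hmm'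
  obtain ⟨hg, -, hfg⟩ := key ℓ' ℓ F' G' F G hG' hF hGF hFG' m' m hm' hm hmm
  let f : nsMaps := ⟨_, hf⟩
  let g : nsMaps := ⟨_, hg⟩
  let π : AutI := (⟨(f : nsCon.Quotient), (g : nsCon.Quotient), nsCon.eq.2 hfg,
    nsCon.eq.2 hgf⟩ : nsCon.Quotientˣ)
  refine ⟨π, ?_⟩
  have hπ : π.rep =ᵐ[volume] f.1 := nsCon.eq.1 (AutI.mk_rep π)
  filter_upwards [hπ, hfl] with x h1 h2
  exact (congrArg ℓ.toFun h1).trans h2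

end Labelling

/-! ### Refinements of labellings -/

namespace Labelling

/-- A labelling of `[0,1]` by the natural numbers. -/
theorem exists_nat : Nonempty (Labelling ℕ) := by
  -- The label is `n` for `1/(n+2) < x ≤ 1/(n+1)`. The point `0` gets label `0`, through `1 / 0 = 0`
  -- and truncated subtraction.
  have hm : Measurable fun x : unitInterval => ⌊(1 / x : ℝ)⌋₊ - 1 := by
    refine (measurable_of_countable fun n : ℕ => n - 1).comp (Nat.measurable_floor.comp ?_)
    exact measurable_const.div measurable_subtype_coe
  refine ⟨⟨_, fun n => (hm (measurableSet_singleton n)).nullMeasurableSet, fun n h => ?_⟩⟩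
  have h1 : (0 : ℝ) < n + 1 := by positivity
  have h2 : (0 : ℝ) < n + 2 := by positivity
  let a : unitInterval := ⟨1 / (n + 2), by positivity, by
    rw [div_le_one h2]; linarith⟩
  let b : unitInterval := ⟨1 / (n + 1), by positivity, by
    rw [div_le_one h1]; linarith⟩
  have hab : (a : ℝ) < b := one_div_lt_one_div_of_lt h1 (by linarith)
  have hsub : Set.Ioo a b ⊆ (fun x : unitInterval => ⌊(1 / x : ℝ)⌋₊ - 1) ⁻¹' {n} := by
    rintro x ⟨hax, hxb⟩
    have hax : 1 / ((n : ℝ) + 2) < x := hax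
    have hxb : (x : ℝ) < 1 / ((n : ℝ) + 1) := hxb
    have hx : (0 : ℝ) < x := lt_trans (by positivity) hax
    have : ⌊(1 / x : ℝ)⌋₊ = n + 1 := by
      rw [Nat.floor_eq_iff (by positivity)]
      push_cast
      refine ⟨((lt_one_div hx h1).1 hxb).le, ?_⟩
      have := (one_div_lt h2 hx).1 hax
      linarith
    change _ - 1 = n
    rw [this]
    rfl
  have := measure_mono_null hsub h
  rw [unitInterval.volume_Ioo, ENNReal.ofReal_eq_zero] at this
  linarith

instance nonempty (Ω : CSur) : Nonempty (Labelling Ω.carrier) := by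
  obtain ⟨f, hf⟩ := exists_surjective_nat Ω.carrier
  exact exists_nat.map fun ℓ => ℓ.push f hf

variable {Ω Ω' Ω'' : CSur}

/-- `ℓ'` refines `ℓ` along `p`. -/
def Over (p : Ω' ⟶ Ω) (ℓ' : Labelling Ω'.carrier) (ℓ : Labelling Ω.carrier) : Prop :=
  ∀ᵐ x, p.toFun (ℓ'.toFun x) = ℓ.toFun x

theorem over_push (p : Ω' ⟶ Ω) (ℓ' : Labelling Ω'.carrier) : Over p ℓ' (ℓ'.push p.toFun p.surj) :=
  Filter.Eventually.of_forall fun _ => rfl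

theorem over_id (ℓ : Labelling Ω.carrier) : Over (𝟙 Ω) ℓ ℓ :=
  Filter.Eventually.of_forall fun _ => rfl

theorem Over.symm {ℓ ℓ' : Labelling Ω.carrier} (h : Over (𝟙 Ω) ℓ ℓ') : Over (𝟙 Ω) ℓ' ℓ := by
  filter_upwards [h] with x hx
  exact hx.symm

theorem Over.comp {q : Ω'' ⟶ Ω'} {p : Ω' ⟶ Ω} {ℓ'' : Labelling Ω''.carrier}
    {ℓ' : Labelling Ω'.carrier} {ℓ : Labelling Ω.carrier} (hq : Over q ℓ'' ℓ') (hp : Over p ℓ' ℓ) :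
    Over (q ≫ p) ℓ'' ℓ := by
  filter_upwards [hq, hp] with x h1 h2
  rw [← h2, ← h1]
  rfl

theorem Over.unique {p : Ω' ⟶ Ω} {ℓ' : Labelling Ω'.carrier} {ℓ₁ ℓ₂ : Labelling Ω.carrier}
    (h₁ : Over p ℓ' ℓ₁) (h₂ : Over p ℓ' ℓ₂) : Over (𝟙 Ω) ℓ₁ ℓ₂ := by
  filter_upwards [h₁, h₂] with x h1 h2
  exact h1.symm.trans h2

/-- Each label is taken on a nonnegligible set, so almost-everywhere agreement forces agreement at
every label. Refinement thus behaves as a preorder. -/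
theorem Over.hom_ext {p q : Ω' ⟶ Ω} {ℓ' : Labelling Ω'.carrier} {ℓ : Labelling Ω.carrier}
    (hp : Over p ℓ' ℓ) (hq : Over q ℓ' ℓ) : p = q := by
  refine CSur.Hom.ext (funext (ℓ'.forall_of_ae ?_))
  filter_upwards [hp, hq] with x h1 h2
  exact h1.trans h2.symm

theorem Over.act {p : Ω' ⟶ Ω} {ℓ' : Labelling Ω'.carrier} {ℓ : Labelling Ω.carrier}
    (h : Over p ℓ' ℓ) (π : AutI) : Over p (ℓ'.act π) (ℓ.act π) :=
  π.rep_qmp.ae h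

theorem act_one (ℓ : Labelling Ω.carrier) : Over (𝟙 Ω) (ℓ.act 1) ℓ := by
  filter_upwards [AutI.rep_one] with x hx
  exact congrArg ℓ.toFun hx

theorem act_mul (ℓ : Labelling Ω.carrier) (π σ : AutI) :
    Over (𝟙 Ω) (ℓ.act (π * σ)) ((ℓ.act π).act σ) := by
  filter_upwards [AutI.rep_mul π σ] with x hx
  exact congrArg ℓ.toFun hx

theorem exists_act (ℓ ℓ' : Labelling Ω.carrier) : ∃ π : AutI, Over (𝟙 Ω) (ℓ.act π) ℓ' :=
  exists_act_ae_eq ℓ ℓ'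

/-- Any labelling by `Ω'` has some image labelling under `p`; an automorphism moves that image to
`ℓ` and carries the refinement along. -/
theorem exists_over (p : Ω' ⟶ Ω) (ℓ : Labelling Ω.carrier) :
    ∃ ℓ' : Labelling Ω'.carrier, Over p ℓ' ℓ := by
  obtain ⟨ℓ₀⟩ := (inferInstance : Nonempty (Labelling Ω'.carrier))
  obtain ⟨π, hπ⟩ := exists_act (ℓ₀.push p.toFun p.surj) ℓ
  exact ⟨ℓ₀.act π, ((over_push p ℓ₀).act π).comp hπ⟩

/-- Any two labellings have a common refinement. -/
theorem exists_common {Ω₁ Ω₂ : CSur} (ℓ₁ : Labelling Ω₁.carrier) (ℓ₂ : Labelling Ω₂.carrier) :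
    ∃ (Ω : CSur) (ℓ : Labelling Ω.carrier) (p : Ω ⟶ Ω₁) (q : Ω ⟶ Ω₂), Over p ℓ ℓ₁ ∧ Over q ℓ ℓ₂ := by
  classical
  -- Only pairs of labels with nonnegligible intersection may serve as labels. There are countably
  -- many pairs, so the discarded ones cover a null set, on which `f` takes an arbitrary value.
  let S : Set (Ω₁.carrier × Ω₂.carrier) :=
    {z | volume (ℓ₁.toFun ⁻¹' {z.1} ∩ ℓ₂.toFun ⁻¹' {z.2}) ≠ 0}
  have hae : ∀ᵐ x, (ℓ₁.toFun x, ℓ₂.toFun x) ∈ S := by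
    have : ∀ z : Ω₁.carrier × Ω₂.carrier, ∀ᵐ x, (ℓ₁.toFun x, ℓ₂.toFun x) = z → z ∈ S := by
      intro z
      by_cases hz : z ∈ S
      · exact Filter.Eventually.of_forall fun _ _ => hz
      · refine measure_mono_null (fun x hx => ?_) (not_not.1 hz)
        have hx : (ℓ₁.toFun x, ℓ₂.toFun x) = z := by
          by_contra h
          exact hx fun h' => (h h').elim
        exact ⟨congrArg Prod.fst hx, congrArg Prod.snd hx⟩
    filter_upwards [ae_all_iff.2 this] with x hx
    exact hx _ rfl
  have hz : ∃ z, z ∈ S := by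
    obtain ⟨x, hx⟩ := hae.exists
    exact ⟨_, hx⟩
  have : Nonempty S := ⟨⟨_, hz.choose_spec⟩⟩
  let f : unitInterval → S := fun x =>
    if h : (ℓ₁.toFun x, ℓ₂.toFun x) ∈ S then ⟨_, h⟩ else Classical.arbitrary _
  have hf : ∀ᵐ x, (f x : Ω₁.carrier × Ω₂.carrier) = (ℓ₁.toFun x, ℓ₂.toFun x) := by
    filter_upwards [hae] with x hx
    simp only [f, dif_pos hx]
  have hfib : ∀ z : S, f ⁻¹' {z} =ᵐ[volume]
      (ℓ₁.toFun ⁻¹' {z.1.1} ∩ ℓ₂.toFun ⁻¹' {z.1.2} : Set unitInterval) := by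
    intro z
    filter_upwards [hf] with x hx
    refine propext ?_
    change f x = z ↔ ℓ₁.toFun x = z.1.1 ∧ ℓ₂.toFun x = z.1.2
    rw [Subtype.ext_iff, hx, Prod.ext_iff]
  let ℓ : Labelling S := ⟨f, fun z => ((ℓ₁.meas _).inter (ℓ₂.meas _)).congr (hfib z).symm,
    fun z => by
      rw [measure_congr (hfib z)]
      exact z.2⟩
  have h1 : ∀ᵐ x, (f x).1.1 = ℓ₁.toFun x := by
    filter_upwards [hf] with x hx
    rw [hx]
  have h2 : ∀ᵐ x, (f x).1.2 = ℓ₂.toFun x := by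
    filter_upwards [hf] with x hx
    rw [hx]
  refine ⟨⟨S⟩, ℓ, ⟨fun z => z.1.1, fun a => ?_⟩, ⟨fun z => z.1.2, fun b => ?_⟩, h1, h2⟩
  · refine ℓ₁.forall_of_ae (P := fun a => ∃ z : S, z.1.1 = a) ?_ a
    filter_upwards [h1] with x hx
    exact ⟨_, hx⟩
  · refine ℓ₂.forall_of_ae (P := fun a => ∃ z : S, z.1.2 = a) ?_ b
    filter_upwards [h2] with x hx
    exact ⟨_, hx⟩

end Labelling

/-- An injective coding of a sample space by natural numbers. -/
noncomputable def CSur.code (Ω : CSur) : Ω.carrier → ℕ :=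
  (Countable.exists_injective_nat Ω.carrier).choose

theorem CSur.code_injective (Ω : CSur) : Function.Injective Ω.code :=
  (Countable.exists_injective_nat Ω.carrier).choose_spec

/-- The partition of `[0,1]` into the fibres of a labelling. -/
noncomputable def Labelling.partn {Ω : CSur} (ℓ : Labelling Ω.carrier) : Partn where
  I := Set.range Ω.code
  part i := ℓ.toFun ⁻¹' {a | Ω.code a = i}
  meas _ := ℓ.nullMeasurableSet_preimage _
  nonnull := by
    rintro ⟨_, a, rfl⟩ h
    exact ℓ.nonnull a (measure_mono_null (fun x hx => congrArg Ω.code hx) h)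
  disj i j hij := by
    refine Disjoint.preimage _ (Set.disjoint_left.2 fun a hi hj => hij ?_)
    exact Subtype.ext (hi.symm.trans hj)
  cover := Set.eq_univ_of_forall fun x => Set.mem_iUnion.2 ⟨⟨_, ℓ.toFun x, rfl⟩, rfl⟩

namespace Partn

theorem exists_mem_part (A : Partn) (x : unitInterval) : ∃ i, x ∈ A.part i :=
  Set.mem_iUnion.1 (A.cover ▸ Set.mem_univ x)

theorem eq_of_mem_part (A : Partn) {x : unitInterval} {i j : A.I} (hi : x ∈ A.part i)
    (hj : x ∈ A.part j) : i = j := by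
  by_contra h
  exact Set.disjoint_left.1 (A.disj h) hi hj

/-- The part containing a point. -/
noncomputable def partOf (A : Partn) (x : unitInterval) : A.space.carrier :=
  (A.exists_mem_part x).choose

theorem preimage_partOf (A : Partn) (i : A.space.carrier) : A.partOf ⁻¹' {i} = A.part i := by
  ext x
  have h := (A.exists_mem_part x).choose_spec
  exact ⟨fun hx => hx ▸ h, fun hx => A.eq_of_mem_part h hx⟩

/-- The labelling of the points of `[0,1]` by the parts of a partition. -/
noncomputable def label (A : Partn) : Labelling A.space.carrier where
  toFun := A.partOf
  meas i := by
    rw [A.preimage_partOf i]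
    exact A.meas i
  nonnull i := by
    rw [A.preimage_partOf i]
    exact A.nonnull i

theorem mem_part_iff (A : Partn) (x : unitInterval) (i : A.space.carrier) :
    x ∈ A.part i ↔ A.label.toFun x = i := by
  rw [← A.preimage_partOf i]
  rfl

theorem over_label_iff {Ω : CSur} {A : Partn} (p : Ω ⟶ A.space) (ℓ : Labelling Ω.carrier) :
    Labelling.Over p ℓ A.label ↔ ∀ j, ℓ.toFun ⁻¹' {j} ≤ᵐ[volume] A.part (p.toFun j) := by
  constructor
  · intro h j
    filter_upwards [h] with x hx hxj
    change x ∈ A.part _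
    rw [A.mem_part_iff, ← hx]
    exact congrArg p.toFun hxj
  · intro h
    filter_upwards [ae_all_iff.2 h] with x hx
    have : x ∈ A.part _ := hx (ℓ.toFun x) rfl
    exact ((A.mem_part_iff _ _).1 this).symm

theorem le_part_iff_over {A B : Partn} (p : B.space ⟶ A.space) :
    (∀ j, B.part j ≤ᵐ[volume] A.part (p.toFun j)) ↔ Labelling.Over p B.label A.label := by
  rw [over_label_iff]
  refine forall_congr' fun j => ?_
  rw [← B.preimage_partOf j]
  rfl

end Partn

namespace Labelling

variable {Ω Ω' : CSur}

/-- The part with a given label. -/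
noncomputable def toPart (ℓ : Labelling Ω.carrier) : Ω ⟶ ℓ.partn.space :=
  ⟨fun a => ⟨Ω.code a, a, rfl⟩, by
    rintro ⟨_, a, rfl⟩
    exact ⟨a, rfl⟩⟩

/-- The label of a part. -/
noncomputable def ofPart (ℓ : Labelling Ω.carrier) : ℓ.partn.space ⟶ Ω :=
  ⟨fun i => i.2.choose, fun a => ⟨⟨Ω.code a, a, rfl⟩,
    Ω.code_injective (⟨a, rfl⟩ : ∃ b, Ω.code b = Ω.code a).choose_spec⟩⟩

theorem toPart_ofPart (ℓ : Labelling Ω.carrier) : ℓ.toPart ≫ ℓ.ofPart = 𝟙 Ω :=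
  CSur.Hom.ext (funext fun a => Ω.code_injective (⟨a, rfl⟩ : ∃ b, Ω.code b = Ω.code a).choose_spec)

theorem ofPart_toPart (ℓ : Labelling Ω.carrier) : ℓ.ofPart ≫ ℓ.toPart = 𝟙 ℓ.partn.space :=
  CSur.Hom.ext (funext fun i => Subtype.ext i.2.choose_spec)

theorem over_toPart (ℓ : Labelling Ω.carrier) : Over ℓ.toPart ℓ ℓ.partn.label := by
  refine Filter.Eventually.of_forall fun x => Eq.symm ?_
  rw [← Partn.mem_part_iff]
  rfl

theorem over_ofPart (ℓ : Labelling Ω.carrier) : Over ℓ.ofPart ℓ.partn.label ℓ := by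
  filter_upwards [ℓ.over_toPart] with x hx
  rw [← hx]
  exact congrFun (congrArg CSur.Hom.toFun ℓ.toPart_ofPart) _

end Labelling

/-! ### Elements of the colimit -/

/-- An element in the image is restrictable along `p`, so the uniqueness half of the sheaf condition
applies to it. -/
theorem IsAtomicSheaf.map_injective {F : CSurᵒᵖ ⥤ Type} (hF : IsAtomicSheaf F) {Ω' Ω : CSur}
    (p : Ω' ⟶ Ω) : Function.Injective (F.map p.op) := by
  intro x y h
  have hr : Restrictable F p (F.map p.op x) := by
    intro Ω'' q r hqr
    have h1 : ∀ s : Ω'' ⟶ Ω', F.map s.op (F.map p.op x) = F.map (s ≫ p).op x := fun s => by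
      rw [op_comp, F.map_comp]
      rfl
    rw [h1, h1, hqr]
  exact (hF _ _ p _ hr).unique rfl h.symm

theorem map_comp_apply' (F : CSurᵒᵖ ⥤ Type) {Ω'' Ω' Ω : CSur} (q : Ω'' ⟶ Ω') (p : Ω' ⟶ Ω)
    (x : F.obj (op Ω)) : F.map (q ≫ p).op x = F.map q.op (F.map p.op x) := by
  rw [op_comp, F.map_comp]
  rfl

theorem colimRel_iff {F : DSh} {A B : Partn} {x : F.obj.obj (op A.space)}
    {y : F.obj.obj (op B.space)} : ColimRel F ⟨A, x⟩ ⟨B, y⟩ ↔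
      ∃ p : B.space ⟶ A.space, Labelling.Over p B.label A.label ∧ F.obj.map p.op x = y :=
  exists_congr fun p => and_congr (Partn.le_part_iff_over p) Iff.rfl

namespace Colim

variable {F G : DSh} {Ω Ω' : CSur}

/-- The element of the colimit given by a labelling by `Ω` and an element of `F Ω`. -/
noncomputable def mk (F : DSh) (ℓ : Labelling Ω.carrier) (x : F.obj.obj (op Ω)) : Colim F :=
  Quot.mk _ ⟨ℓ.partn, F.obj.map ℓ.ofPart.op x⟩

theorem mk_over {p : Ω' ⟶ Ω} {ℓ' : Labelling Ω'.carrier} {ℓ : Labelling Ω.carrier}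
    (h : Labelling.Over p ℓ' ℓ) (x : F.obj.obj (op Ω)) :
    mk F ℓ' (F.obj.map p.op x) = mk F ℓ x := by
  refine (Quot.sound (colimRel_iff.2 ⟨ℓ'.ofPart ≫ p ≫ ℓ.toPart, ?_, ?_⟩)).symm
  · exact ℓ'.over_ofPart.comp (h.comp ℓ.over_toPart)
  · rw [← map_comp_apply', ← map_comp_apply', Category.assoc, Category.assoc, ℓ.toPart_ofPart,
      Category.comp_id]

theorem mk_congr {ℓ ℓ' : Labelling Ω.carrier} (h : Labelling.Over (𝟙 Ω) ℓ' ℓ)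
    (x : F.obj.obj (op Ω)) : mk F ℓ' x = mk F ℓ x := by
  rw [← mk_over h x, map_id_apply']

theorem quot_mk (A : Partn) (x : F.obj.obj (op A.space)) :
    (Quot.mk _ ⟨A, x⟩ : Colim F) = mk F A.label x :=
  Quot.sound (colimRel_iff.2 ⟨A.label.ofPart, A.label.over_ofPart, rfl⟩)

theorem exists_mk (z : Colim F) :
    ∃ (Ω : CSur) (ℓ : Labelling Ω.carrier) (x : F.obj.obj (op Ω)), mk F ℓ x = z := by
  induction z using Quot.inductionOn with | _ a
  exact ⟨_, a.1.label, a.2, (quot_mk a.1 a.2).symm⟩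

theorem exists_mk_over (ℓ : Labelling Ω.carrier) (z : Colim F) :
    ∃ (Ω' : CSur) (p : Ω' ⟶ Ω) (ℓ' : Labelling Ω'.carrier) (x : F.obj.obj (op Ω')),
      Labelling.Over p ℓ' ℓ ∧ mk F ℓ' x = z := by
  obtain ⟨Ω₁, ℓ₁, x, rfl⟩ := exists_mk z
  obtain ⟨Ω', ℓ', p, q, hp, hq⟩ := Labelling.exists_common ℓ ℓ₁
  exact ⟨Ω', p, ℓ', _, hp, mk_over hq x⟩

/-- The statement that an element of the colimit agrees with `mk F ℓ x` over common refinements. -/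
def Agrees (ℓ : Labelling Ω.carrier) (x : F.obj.obj (op Ω))
    (b : Σ A : Partn, F.obj.obj (op A.space)) : Prop :=
  ∀ (Ω' : CSur) (ℓ' : Labelling Ω'.carrier) (p : Ω' ⟶ Ω) (q : Ω' ⟶ b.1.space),
    Labelling.Over p ℓ' ℓ → Labelling.Over q ℓ' b.1.label →
      F.obj.map p.op x = F.obj.map q.op b.2

/-- For the converse, a refinement of `b` need not refine `c`; it is refined once more, and
injectivity of restriction in a sheaf brings the equation back down. -/
theorem agrees_congr (ℓ : Labelling Ω.carrier) (x : F.obj.obj (op Ω))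
    {b c : Σ A : Partn, F.obj.obj (op A.space)} (h : ColimRel F b c) :
    Agrees ℓ x b ↔ Agrees ℓ x c := by
  obtain ⟨B, y⟩ := b
  obtain ⟨C, y'⟩ := c
  obtain ⟨r, hr, rfl⟩ := colimRel_iff.1 h
  constructor
  · intro hb Ω' ℓ' p q hp hq
    rw [hb Ω' ℓ' p (q ≫ r) hp (hq.comp hr), map_comp_apply']
  · intro hc Ω' ℓ' p q hp hq
    obtain ⟨Ω₂, ℓ₂, s, t, hs, ht⟩ := Labelling.exists_common ℓ' C.label
    have h1 : s ≫ q = t ≫ r := (hs.comp hq).hom_ext (ht.comp hr)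
    have h2 := hc Ω₂ ℓ₂ (s ≫ p) t (hs.comp hp) ht
    refine F.2.map_injective s ?_
    rw [← map_comp_apply', ← map_comp_apply', h2, h1, map_comp_apply']

/-- The predicate `Agrees ℓ x` descends to the quotient, so it passes from `mk F ℓ x` to `mk F ℓ y`;
testing it at `ℓ` itself gives `x = y`. The equivalence relation generated by `ColimRel` never has
to be described. -/
theorem mk_injective (ℓ : Labelling Ω.carrier) : Function.Injective (mk F ℓ) := by
  intro x y h
  have h1 : Agrees ℓ x ⟨ℓ.partn, F.obj.map ℓ.ofPart.op x⟩ := by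
    intro Ω' ℓ' p q hp hq
    rw [← map_comp_apply', hp.hom_ext (hq.comp ℓ.over_ofPart)]
  have h2 : Quot.lift (Agrees (F := F) ℓ x) (fun b c hbc => propext (agrees_congr ℓ x hbc))
      (mk F ℓ x) := h1
  rw [h] at h2
  have h3 := h2 Ω ℓ (𝟙 Ω) ℓ.toPart ℓ.over_id ℓ.over_toPart
  simpa only [← map_comp_apply', ℓ.toPart_ofPart, map_id_apply'] using h3

theorem mk_eq_mk_iff {Ω₁ Ω₂ : CSur} {ℓ₁ : Labelling Ω₁.carrier} {ℓ₂ : Labelling Ω₂.carrier}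
    {ℓ : Labelling Ω.carrier} {p : Ω ⟶ Ω₁} {q : Ω ⟶ Ω₂} (hp : Labelling.Over p ℓ ℓ₁)
    (hq : Labelling.Over q ℓ ℓ₂) (x : F.obj.obj (op Ω₁)) (y : F.obj.obj (op Ω₂)) :
    mk F ℓ₁ x = mk F ℓ₂ y ↔ F.obj.map p.op x = F.obj.map q.op y := by
  rw [← mk_over hp, ← mk_over hq, (mk_injective ℓ).eq_iff]

theorem smul_mk (π : AutI) (ℓ : Labelling Ω.carrier) (x : F.obj.obj (op Ω)) :
    MulOpposite.op π • mk F ℓ x = mk F (ℓ.act π) x := rfl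

theorem map_mk (α : F ⟶ G) (ℓ : Labelling Ω.carrier) (x : F.obj.obj (op Ω)) :
    (comparison.map α).toFun (mk F ℓ x) = mk G ℓ (α.hom.app _ x) := by
  have h := NatTrans.naturality_apply α.hom ℓ.ofPart.op x
  exact congrArg (fun z => (Quot.mk _ ⟨ℓ.partn, z⟩ : Colim G)) h

end Colim

/-! ### The comparison functor is fully faithful -/

namespace Colim

variable {F G : DSh} {Ω Ω' : CSur}

/-- An element of the colimit fixed by the stabilizer of a labelling is defined over it. -/
theorem exists_mk_of_fixed (ℓ : Labelling Ω.carrier) (z : Colim F)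
    (hz : ∀ π : AutI, Labelling.Over (𝟙 Ω) (ℓ.act π) ℓ → MulOpposite.op π • z = z) :
    ∃ x, mk F ℓ x = z := by
  obtain ⟨Ω', p, ℓ', y, hp, rfl⟩ := exists_mk_over ℓ z
  have hy : Restrictable F.obj p y := by
    intro Ω'' q r hqr
    -- Realise `q` and `r` on one labelling `ℓ''`: its image under `q` is `ℓ'`, and its image under
    -- `r` is a translate of `ℓ'` by some `π`. Since `q ≫ p = r ≫ p`, this `π` stabilizes `ℓ`.
    obtain ⟨ℓ'', hq⟩ := Labelling.exists_over q ℓ'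
    have hr := Labelling.over_push r ℓ''
    obtain ⟨π, hπ⟩ := Labelling.exists_act ℓ' (ℓ''.push r.toFun r.surj)
    have h1 : Labelling.Over (𝟙 Ω) (ℓ.act π) ℓ := by
      refine (hp.act π).unique ?_
      have h2 := (hr.comp (Labelling.over_push p _)).unique (hqr ▸ hq.comp hp)
      have h3 := hπ.comp ((Labelling.over_push p _).comp h2)
      simpa only [Category.id_comp, Category.comp_id] using h3
    have h3 := hz π h1
    -- Invariance under `π` now compares the two pullbacks of `y` over the single labelling `ℓ''`.
    rw [smul_mk, ← mk_congr hπ.symm, ← mk_over hr, ← mk_over hq] at h3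
    exact (mk_injective ℓ'' h3).symm
  obtain ⟨x, rfl, -⟩ := F.2 _ _ p y hy
  exact ⟨x, (mk_over hp x).symm⟩

/-- Equivariance makes the image fixed by the stabilizer of `ℓ`, hence defined over `ℓ`;
transitivity on labellings then shows that one `y` serves for all of them. -/
theorem exists_map_mk (f : Colim F →[AutIᵐᵒᵖ] Colim G) (x : F.obj.obj (op Ω)) :
    ∃ y : G.obj.obj (op Ω), ∀ ℓ : Labelling Ω.carrier, f (mk F ℓ x) = mk G ℓ y := by
  obtain ⟨ℓ⟩ := (inferInstance : Nonempty (Labelling Ω.carrier))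
  obtain ⟨y, hy⟩ := exists_mk_of_fixed ℓ (f (mk F ℓ x)) fun π hπ => by
    rw [← map_smul, smul_mk, mk_congr hπ]
  refine ⟨y, fun ℓ' => ?_⟩
  obtain ⟨π, hπ⟩ := Labelling.exists_act ℓ ℓ'
  rw [← mk_congr hπ, ← mk_congr hπ, ← smul_mk, map_smul, ← hy, smul_mk]

end Colim

instance : comparison.Faithful where
  map_injective {F G} α β h := by
    refine ObjectProperty.hom_ext _ ?_
    ext Ω x
    obtain ⟨ℓ⟩ := (inferInstance : Nonempty (Labelling Ω.unop.carrier))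
    refine Colim.mk_injective ℓ ?_
    have h1 := Colim.map_mk α ℓ x
    rw [h, Colim.map_mk] at h1
    exact h1.symm

/-- The elements provided by `Colim.exists_map_mk` assemble into a natural transformation because
`Colim.mk_injective` makes them unique. -/
instance : comparison.Full where
  map_surjective {F G} f := by
    choose y hy using fun (Ω : CSur) (x : F.obj.obj (op Ω)) => Colim.exists_map_mk f x
    let α : F ⟶ G := ObjectProperty.homMk
      { app := fun Ω => ↾(fun x => y Ω.unop x)
        naturality := by
          intro Ω Ω' p
          ext x
          obtain ⟨ℓ⟩ := (inferInstance : Nonempty (Labelling Ω'.unop.carrier))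
          refine Colim.mk_injective ℓ ?_
          have hp := Labelling.over_push p.unop ℓ
          have h1 := hy _ (F.obj.map p x) ℓ
          have h2 := hy _ x (ℓ.push p.unop.toFun p.unop.surj)
          have h3 := Colim.mk_over hp x
          have h4 := Colim.mk_over hp (y _ x)
          exact (h1.symm.trans (congrArg f.toFun h3)).trans (h2.trans h4.symm) }
    refine ⟨α, MulActionHom.ext fun z => ?_⟩
    obtain ⟨Ω, ℓ, x, rfl⟩ := Colim.exists_mk z
    exact (Colim.map_mk α ℓ x).trans (hy Ω x ℓ).symm

/-! ### The comparison functor is essentially surjective -/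

/-- The presheaf of equivariant maps from the labellings to a set with an action of `AutI`. -/
noncomputable def labelMaps (X : DGSet) : CSurᵒᵖ ⥤ Type where
  obj Ω := {φ : Labelling Ω.unop.carrier → X.carrier // ∀ (π : AutI) ℓ ℓ',
    Labelling.Over (𝟙 Ω.unop) (ℓ.act π) ℓ' → φ ℓ' = MulOpposite.op π • φ ℓ}
  map p := ↾(fun φ => ⟨fun ℓ => φ.1 (ℓ.push p.unop.toFun p.unop.surj), fun π ℓ ℓ' h =>
    φ.2 π _ _ (by
      filter_upwards [h] with x hx
      exact congrArg p.unop.toFun hx)⟩)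
  map_id Ω := by
    ext φ
    rfl
  map_comp p q := by
    ext φ
    rfl

section

variable {X : DGSet} {Ω Ω' : CSur}

theorem labelMaps_congr (φ : (labelMaps X).obj (op Ω)) {ℓ ℓ' : Labelling Ω.carrier}
    (h : Labelling.Over (𝟙 Ω) ℓ ℓ') : φ.1 ℓ' = φ.1 ℓ := by
  have := φ.2 1 ℓ ℓ' (by simpa only [Category.comp_id] using ℓ.act_one.comp h)
  rwa [MulOpposite.op_one, one_smul] at this

theorem labelMaps_map_over {p : Ω' ⟶ Ω} {ℓ' : Labelling Ω'.carrier} {ℓ : Labelling Ω.carrier}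
    (h : Labelling.Over p ℓ' ℓ) (φ : (labelMaps X).obj (op Ω)) :
    ((labelMaps X).map p.op φ).1 ℓ' = φ.1 ℓ :=
  (labelMaps_congr φ ((Labelling.over_push p ℓ').unique h)).symm

theorem labelMaps_ext {φ ψ : (labelMaps X).obj (op Ω)} (ℓ : Labelling Ω.carrier)
    (h : φ.1 ℓ = ψ.1 ℓ) : φ = ψ := by
  refine Subtype.ext (funext fun ℓ' => ?_)
  obtain ⟨π, hπ⟩ := Labelling.exists_act ℓ ℓ'
  rw [φ.2 π ℓ ℓ' hπ, ψ.2 π ℓ ℓ' hπ, h]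

/-- Two labellings over the same `ℓ` are images of a common refinement under maps that agree after
`p`. Restrictability thus makes the value depend on `ℓ` alone, and any choice of lifts defines the
restricted map. -/
theorem labelMaps_isAtomicSheaf (X : DGSet) : IsAtomicSheaf (labelMaps X) := by
  intro Ω' Ω p φ hφ
  have hw : ∀ (ℓ₁ ℓ₂ : Labelling Ω'.carrier) (ℓ : Labelling Ω.carrier),
      Labelling.Over p ℓ₁ ℓ → Labelling.Over p ℓ₂ ℓ → φ.1 ℓ₁ = φ.1 ℓ₂ := by
    intro ℓ₁ ℓ₂ ℓ h₁ h₂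
    obtain ⟨Ω'', ℓ'', q, r, hq, hr⟩ := Labelling.exists_common ℓ₁ ℓ₂
    rw [← labelMaps_map_over hq φ, ← labelMaps_map_over hr φ,
      hφ Ω'' q r ((hq.comp h₁).hom_ext (hr.comp h₂))]
  choose s hs using fun ℓ => Labelling.exists_over p ℓ
  refine ⟨⟨fun ℓ => φ.1 (s ℓ), fun π ℓ ℓ' h => ?_⟩, ?_, ?_⟩
  · rw [← φ.2 π (s ℓ) _ (Labelling.over_id _)]
    refine hw _ _ ℓ' (hs ℓ') ?_
    simpa only [Category.comp_id] using ((hs ℓ).act π).comp h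
  · refine Subtype.ext (funext fun ℓ => ?_)
    exact hw _ _ _ (hs _) (Labelling.over_push p ℓ)
  · intro ψ hψ
    refine Subtype.ext (funext fun ℓ => ?_)
    change ψ.1 ℓ = φ.1 (s ℓ)
    rw [← hψ, labelMaps_map_over (hs ℓ)]

/-- The sheaf of equivariant maps from the labellings to a set with an action of `AutI`. -/
noncomputable def labelSheaf (X : DGSet) : DSh := ⟨labelMaps X, labelMaps_isAtomicSheaf X⟩

end

theorem Labelling.Over.act_over {Ω' Ω : CSur} {p : Ω' ⟶ Ω} {ℓ' : Labelling Ω'.carrier}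
    {ℓ : Labelling Ω.carrier} (h : Labelling.Over p ℓ' ℓ) {σ : AutI}
    (hσ : Labelling.Over (𝟙 Ω') (ℓ'.act σ) ℓ') : Labelling.Over (𝟙 Ω) (ℓ.act σ) ℓ := by
  have h1 := hσ.comp h
  rw [Category.id_comp] at h1
  exact (h.act σ).unique h1

theorem Partn.mem_fix_iff (A : Partn) (σ : AutI) :
    σ ∈ A.fix ↔ Labelling.Over (𝟙 A.space) (A.label.act σ) A.label := by
  constructor
  · intro h
    filter_upwards [ae_all_iff.2 fun i => (h i).mem_iff] with x hx
    exact ((A.mem_part_iff x _).1 ((hx _).1 ((A.mem_part_iff (σ.rep x) _).2 rfl))).symm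
  · intro h i
    filter_upwards [h] with x hx
    have hx : A.label.toFun (σ.rep x) = A.label.toFun x := hx
    refine propext ((A.mem_part_iff (σ.rep x) i).trans ?_)
    rw [hx]
    exact (A.mem_part_iff x i).symm

theorem Labelling.mem_fix_partn_iff {Ω : CSur} (ℓ : Labelling Ω.carrier) (σ : AutI) :
    σ ∈ ℓ.partn.fix ↔ Labelling.Over (𝟙 Ω) (ℓ.act σ) ℓ := by
  rw [Partn.mem_fix_iff]
  exact ⟨fun h => ℓ.over_ofPart.act_over h, fun h => ℓ.over_toPart.act_over h⟩

theorem Partn.mul_mem_fix (A : Partn) {σ τ : AutI} (hσ : σ ∈ A.fix) (hτ : τ ∈ A.fix) :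
    σ * τ ∈ A.fix := fun i =>
  (AutI.preimage_mul σ τ _).trans ((τ.rep_qmp.preimage_ae_eq (hσ i)).trans (hτ i))

/-- The cosets of the stabilizers of partitions form a basis of the topology. -/
theorem exists_fix_of_isOpen {U : Set AutI} (hU : IsOpen U) :
    ∀ π ∈ U, ∃ A : Partn, ∀ σ ∈ A.fix, π * σ ∈ U := by
  induction hU with
  | basic U h =>
    obtain ⟨τ, A, rfl⟩ := h
    rintro _ ⟨ρ, hρ, rfl⟩
    exact ⟨A, fun σ hσ => ⟨ρ * σ, A.mul_mem_fix hρ hσ, mul_assoc _ _ _⟩⟩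
  -- Any partition will do, but one must be exhibited.
  | univ =>
    obtain ⟨ℓ⟩ := Labelling.exists_nat
    exact fun _ _ => ⟨Labelling.partn (Ω := ⟨ℕ⟩) ℓ, fun _ _ => Set.mem_univ _⟩
  | inter U V _ _ hU hV =>
    rintro π ⟨h1, h2⟩
    obtain ⟨A, hA⟩ := hU π h1
    obtain ⟨B, hB⟩ := hV π h2
    -- Whatever fixes a common refinement fixes both partitions.
    obtain ⟨Ω, ℓ, p, q, hp, hq⟩ := Labelling.exists_common A.label B.label
    refine ⟨ℓ.partn, fun σ hσ => ?_⟩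
    rw [ℓ.mem_fix_partn_iff] at hσ
    exact ⟨hA σ ((A.mem_fix_iff σ).2 (hp.act_over hσ)), hB σ ((B.mem_fix_iff σ).2 (hq.act_over hσ))⟩
  | sUnion S _ h =>
    rintro π ⟨U, hUS, hπ⟩
    obtain ⟨A, hA⟩ := h U hUS π hπ
    exact ⟨A, fun σ hσ => ⟨U, hUS, hA σ hσ⟩⟩

/-- A bijective equivariant map is an isomorphism. -/
noncomputable def DGSet.isoOfBijective {X Y : DGSet} (f : X ⟶ Y) (hf : Function.Bijective f.toFun) :
    X ≅ Y where
  hom := f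
  inv := MulActionHom.inverse f (Equiv.ofBijective _ hf).symm
    (Equiv.ofBijective _ hf).left_inv (Equiv.ofBijective _ hf).right_inv
  hom_inv_id := MulActionHom.ext (Equiv.ofBijective _ hf).left_inv
  inv_hom_id := MulActionHom.ext (Equiv.ofBijective _ hf).right_inv

/-- The evaluation of equivariant maps at labellings. -/
noncomputable def labelEval (X : DGSet) : comparison.obj (labelSheaf X) ⟶ X where
  toFun := Quot.lift (fun a => a.2.1 a.1.label) (by
    rintro ⟨A, φ⟩ ⟨B, ψ⟩ h
    obtain ⟨p, hp, rfl⟩ := colimRel_iff.1 h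
    exact (labelMaps_map_over hp φ).symm)
  map_smul' π z := by
    induction z using Quot.inductionOn with | _ a
    obtain ⟨A, φ⟩ := a
    refine φ.2 π.unop A.label (A.act π.unop).label ?_
    refine Filter.Eventually.of_forall fun x => Eq.symm ?_
    refine ((A.act π.unop).mem_part_iff x _).1 ?_
    exact (A.mem_part_iff (π.unop.rep x) _).2 rfl

theorem labelEval_mk {X : DGSet} {Ω : CSur} (ℓ : Labelling Ω.carrier)
    (φ : (labelMaps X).obj (op Ω)) :
    (labelEval X).toFun (Colim.mk (labelSheaf X) ℓ φ) = φ.1 ℓ :=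
  labelMaps_map_over ℓ.over_ofPart φ

/-- Injectivity: an equivariant map on a transitive set of labellings is determined by one value.
Surjectivity: the stabilizer of `x` contains the fixer of some partition `A`, so sending the
translate of `A.label` by `π` to `x` moved by `π` is well defined. -/
theorem labelEval_bijective (X : DGSet) : Function.Bijective (labelEval X).toFun := by
  constructor
  · intro z w h
    obtain ⟨Ω₁, ℓ₁, φ, rfl⟩ := Colim.exists_mk (F := labelSheaf X) z
    obtain ⟨Ω₂, ℓ₂, ψ, rfl⟩ := Colim.exists_mk (F := labelSheaf X) w
    have h : φ.1 ℓ₁ = ψ.1 ℓ₂ := (labelEval_mk ℓ₁ φ).symm.trans (h.trans (labelEval_mk ℓ₂ ψ))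
    obtain ⟨Ω, ℓ, p, q, hp, hq⟩ := Labelling.exists_common ℓ₁ ℓ₂
    refine (Colim.mk_eq_mk_iff hp hq φ ψ).2 (labelMaps_ext ℓ ?_)
    exact (labelMaps_map_over hp φ).trans (h.trans (labelMaps_map_over hq ψ).symm)
  · intro x
    obtain ⟨A, hA⟩ := exists_fix_of_isOpen (X.open_stab x) 1 (by
      change MulOpposite.op 1 • x = x
      rw [MulOpposite.op_one, one_smul])
    have hA : ∀ σ ∈ A.fix, MulOpposite.op σ • x = x := fun σ hσ => by
      have := hA σ hσ
      rwa [one_mul] at this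
    -- If the two translates agree, `π * σ⁻¹` fixes `A` and hence `x`.
    have key : ∀ π σ : AutI, Labelling.Over (𝟙 A.space) (A.label.act π) (A.label.act σ) →
        MulOpposite.op π • x = MulOpposite.op σ • x := by
      intro π σ h
      have h1 : Labelling.Over (𝟙 A.space) (A.label.act (π * σ⁻¹)) A.label := by
        have h2 := (A.label.act_mul π σ⁻¹).comp ((h.act σ⁻¹).comp (A.label.act_mul σ σ⁻¹).symm)
        rw [mul_inv_cancel] at h2
        simpa only [Category.id_comp] using h2.comp A.label.act_one
      have h3 := congrArg (MulOpposite.op σ • ·) (hA _ ((A.mem_fix_iff _).2 h1))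
      simpa only [← mul_smul, ← MulOpposite.op_mul, inv_mul_cancel_right] using h3
    choose π hπ using fun ℓ => Labelling.exists_act A.label ℓ
    let φ : (labelMaps X).obj (op A.space) := ⟨fun ℓ => MulOpposite.op (π ℓ) • x, by
      intro τ ℓ ℓ' h
      rw [← mul_smul, ← MulOpposite.op_mul]
      refine key _ _ ?_
      have h1 := (A.label.act_mul (π ℓ) τ).comp (((hπ ℓ).act τ).comp h)
      simpa only [Category.id_comp] using (hπ ℓ').comp h1.symm⟩
    refine ⟨Colim.mk (labelSheaf X) A.label φ, (labelEval_mk A.label φ).trans ?_⟩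
    exact hA _ ((A.mem_fix_iff _).2 (hπ A.label))

instance : comparison.EssSurj where
  mem_essImage X := ⟨labelSheaf X, ⟨DGSet.isoOfBijective (labelEval X) (labelEval_bijective X)⟩⟩

instance comparison_isEquivalence : comparison.IsEquivalence where

/-! ### Atoms of a probability space, and the Day convolution -/

namespace ProbOn

variable {Ω Ω₁ : CSur}

/-- The set of atoms of a probability space. -/
def atoms (P : ProbOn Ω.carrier) : CSur :=
  @CSur.mk (Quotient P.atomSetoid) _ ⟨Quotient.mk _ (Classical.arbitrary _)⟩

/-- The atom containing a point. -/
def toAtoms (P : ProbOn Ω.carrier) : Ω ⟶ P.atoms := ⟨Quotient.mk _, Quotient.mk_surjective⟩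

/-- The probability space induced on the set of atoms. -/
noncomputable def onAtoms (P : ProbOn Ω.carrier) : ProbOn P.atoms.carrier :=
  P.push P.toAtoms.toFun

theorem pb_onAtoms (P : ProbOn Ω.carrier) : CSur.pb P.toAtoms P.onAtoms = P := by
  refine pull_push _ _ P fun s hs => Set.Subset.antisymm ?_ (Set.subset_preimage_image _ _)
  rintro b ⟨a, ha, hab⟩
  exact (Quotient.exact hab s hs).1 ha

/-- Events of a pullback cannot separate points with the same image under `f`, so the map to atoms
factors through `f`. The factor pulls the atomic space back to `P` because pullback along `f` is
injective. -/
theorem exists_toAtoms_factor (f : Ω ⟶ Ω₁) (P : ProbOn Ω₁.carrier) :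
    ∃ g : Ω₁ ⟶ (CSur.pb f P).atoms, f ≫ g = (CSur.pb f P).toAtoms ∧
      CSur.pb g (CSur.pb f P).onAtoms = P := by
  choose s hs using f.surj
  have h : ∀ a, Quotient.mk (CSur.pb f P).atomSetoid (s (f.toFun a)) = Quotient.mk _ a := by
    intro a
    refine Quotient.sound ?_
    rintro _ ⟨t, -, rfl⟩
    rw [Set.mem_preimage, hs, Set.mem_preimage]
  let g : Ω₁ ⟶ (CSur.pb f P).atoms := ⟨fun b => Quotient.mk _ (s b), by
    rintro ⟨a⟩
    exact ⟨f.toFun a, h a⟩⟩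
  have hg : f ≫ g = (CSur.pb f P).toAtoms := CSur.Hom.ext (funext h)
  refine ⟨g, hg, pull_injective f.toFun f.surj ?_⟩
  change CSur.pb f (CSur.pb g _) = CSur.pb f P
  rw [← CSur.pb_comp, hg, pb_onAtoms]

end ProbOn

theorem CSur.prod_hom_ext {Ω Ω₁ Ω₂ : CSur} {f g : Ω ⟶ Ω₁.prod Ω₂}
    (h₁ : f ≫ CSur.fst Ω₁ Ω₂ = g ≫ CSur.fst Ω₁ Ω₂) (h₂ : f ≫ CSur.snd Ω₁ Ω₂ = g ≫ CSur.snd Ω₁ Ω₂) :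
    f = g := by
  refine CSur.Hom.ext (funext fun a => Prod.ext ?_ ?_)
  · exact congrFun (congrArg CSur.Hom.toFun h₁) a
  · exact congrFun (congrArg CSur.Hom.toFun h₂) a

theorem IsFactorization.exists_toAtoms {Ω Ω₁ Ω₂ : CSur} {p : Ω ⟶ Ω₁.prod Ω₂}
    {P₁ : ProbOn Ω₁.carrier} {P₂ : ProbOn Ω₂.carrier} {x : ProbOn Ω.carrier × ProbOn Ω.carrier}
    (h : IsFactorization p P₁ P₂ x) :
    ∃ (g₁ : Ω₁ ⟶ x.1.atoms) (g₂ : Ω₂ ⟶ x.2.atoms),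
      p ≫ CSur.prodMap g₁ g₂ ≫ CSur.fst _ _ = x.1.toAtoms ∧
      p ≫ CSur.prodMap g₁ g₂ ≫ CSur.snd _ _ = x.2.toAtoms ∧
      CSur.pb g₁ x.1.onAtoms = P₁ ∧ CSur.pb g₂ x.2.onAtoms = P₂ := by
  obtain ⟨x₁, x₂⟩ := x
  obtain ⟨h₁, h₂⟩ := h
  dsimp only at h₁ h₂
  subst h₁ h₂
  obtain ⟨g₁, hg₁, hP₁⟩ := ProbOn.exists_toAtoms_factor (p ≫ CSur.fst Ω₁ Ω₂) P₁
  obtain ⟨g₂, hg₂, hP₂⟩ := ProbOn.exists_toAtoms_factor (p ≫ CSur.snd Ω₁ Ω₂) P₂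
  exact ⟨g₁, g₂, hg₁, hg₂, hP₁, hP₂⟩

/-- A natural family of maps out of `P Ω₁ × P Ω₂` takes equal values at all factorizations of a
pair. -/
theorem IsFactorization.map_eq {H : CSurᵒᵖ ⥤ Type}
    {φ : ∀ Ω₁ Ω₂ : CSur, ProbOn Ω₁.carrier → ProbOn Ω₂.carrier → H.obj (op (Ω₁.prod Ω₂))}
    (hφ : ∀ (Ω₁ Ω₁' Ω₂ Ω₂' : CSur) (f : Ω₁' ⟶ Ω₁) (g : Ω₂' ⟶ Ω₂) (a : ProbOn Ω₁.carrier)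
      (b : ProbOn Ω₂.carrier),
      φ Ω₁' Ω₂' (CSur.pb f a) (CSur.pb g b) = H.map (CSur.prodMap f g).op (φ Ω₁ Ω₂ a b))
    {Ω Ω₁ Ω₂ Ω₁' Ω₂' : CSur} {p : Ω ⟶ Ω₁.prod Ω₂}
    {P₁ : ProbOn Ω₁.carrier} {P₂ : ProbOn Ω₂.carrier} {p' : Ω ⟶ Ω₁'.prod Ω₂'}
    {P₁' : ProbOn Ω₁'.carrier} {P₂' : ProbOn Ω₂'.carrier}
    {x : ProbOn Ω.carrier × ProbOn Ω.carrier} (h : IsFactorization p P₁ P₂ x)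
    (h' : IsFactorization p' P₁' P₂' x) :
    H.map p.op (φ _ _ P₁ P₂) = H.map p'.op (φ _ _ P₁' P₂') := by
  obtain ⟨g₁, g₂, hg₁, hg₂, hP₁, hP₂⟩ := h.exists_toAtoms
  obtain ⟨g₁', g₂', hg₁', hg₂', hP₁', hP₂'⟩ := h'.exists_toAtoms
  -- Both composites have as components the two maps to atoms, which depend only on `x`.
  have hc : p ≫ CSur.prodMap g₁ g₂ = p' ≫ CSur.prodMap g₁' g₂' :=
    CSur.prod_hom_ext (hg₁.trans hg₁'.symm) (hg₂.trans hg₂'.symm)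
  rw [← hP₁, ← hP₂, ← hP₁', ← hP₂', hφ, hφ, ← map_comp_apply', ← map_comp_apply', hc]

/-- Pullbacks of the universal pairing exhaust `DP2`; this is the uniqueness half of the Day
convolution property. -/
theorem IsFactorization.map_dayPairing {Ω Ω₁ Ω₂ : CSur} {p : Ω ⟶ Ω₁.prod Ω₂}
    {P₁ : ProbOn Ω₁.carrier} {P₂ : ProbOn Ω₂.carrier} {x : DP2.obj (op Ω)}
    (h : IsFactorization p P₁ P₂ x.1) : DP2.map p.op (dayPairing Ω₁ Ω₂ P₁ P₂) = x := by
  refine Subtype.ext (Prod.ext ?_ ?_)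
  · exact (CSur.pb_comp p (CSur.fst Ω₁ Ω₂) P₁).symm.trans h.1
  · exact (CSur.pb_comp p (CSur.snd Ω₁ Ω₂) P₂).symm.trans h.2

theorem isFactorization_dayPairing {Ω₁ Ω₂ : CSur} (P₁ : ProbOn Ω₁.carrier)
    (P₂ : ProbOn Ω₂.carrier) :
    IsFactorization (𝟙 (Ω₁.prod Ω₂)) P₁ P₂ (dayPairing Ω₁ Ω₂ P₁ P₂).1 :=
  ⟨by rw [Category.id_comp]; rfl, by rw [Category.id_comp]; rfl⟩

theorem isDayConvolution_dayPairing : IsDayConvolution shP.obj shP.obj shP2.obj dayPairing := by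
  refine ⟨?_, ?_⟩
  · intro Ω₁ Ω₁' Ω₂ Ω₂' f g a b
    refine Subtype.ext (Prod.ext ?_ ?_)
    · exact (CSur.pb_comp (CSur.fst _ _) f a).symm.trans
        (CSur.pb_comp (CSur.prodMap f g) (CSur.fst _ _) a)
    · exact (CSur.pb_comp (CSur.snd _ _) g b).symm.trans
        (CSur.pb_comp (CSur.prodMap f g) (CSur.snd _ _) b)
  · intro H φ hφ
    choose Ω₁ Ω₂ p P₁ P₂ h using fun (Ω : CSur) (x : DP2.obj (op Ω)) => x.2
    let ψ : DP2 ⟶ H :=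
      { app := fun Ω => ↾(fun x => H.map (p Ω.unop x).op (φ _ _ (P₁ Ω.unop x) (P₂ Ω.unop x)))
        naturality := by
          intro Ω Ω' q
          ext x
          exact (IsFactorization.map_eq hφ (h _ (DP2.map q x)) ((h _ x).comp q.unop)).trans
            (map_comp_apply' H q.unop _ _) }
    refine ⟨ψ, fun Ω₁' Ω₂' a b => ?_, fun χ hχ => ?_⟩
    · exact (IsFactorization.map_eq hφ (h _ (dayPairing Ω₁' Ω₂' a b))
        (isFactorization_dayPairing a b)).trans (map_id_apply' H _ _)
    · ext Ω x
      have h1 := (h Ω.unop x).map_dayPairing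
      have h2 := NatTrans.naturality_apply χ (p Ω.unop x).op
        (dayPairing _ _ (P₁ Ω.unop x) (P₂ Ω.unop x))
      refine (congrArg (χ.app Ω) h1).symm.trans (h2.trans ?_)
      exact congrArg (H.map (p Ω.unop x).op) (hχ _ _ _ _)

/-! ### The resource monoid of probability spaces -/

/-- The intersections of an event of `m₁` and an event of `m₂`. -/
def interSets {Ω : Type} (m₁ m₂ : MeasurableSpace Ω) : Set (Set Ω) :=
  {u | ∃ s t, MeasurableSet[m₁] s ∧ MeasurableSet[m₂] t ∧ u = s ∩ t}

theorem sup_eq_generateFrom_interSets {Ω : Type} (m₁ m₂ : MeasurableSpace Ω) :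
    m₁ ⊔ m₂ = MeasurableSpace.generateFrom (interSets m₁ m₂) := by
  refine le_antisymm (sup_le ?_ ?_) (MeasurableSpace.generateFrom_le ?_)
  · exact fun s hs => MeasurableSpace.measurableSet_generateFrom
      ⟨s, Set.univ, hs, MeasurableSet.univ, (Set.inter_univ s).symm⟩
  · exact fun s hs => MeasurableSpace.measurableSet_generateFrom
      ⟨Set.univ, s, MeasurableSet.univ, hs, (Set.univ_inter s).symm⟩
  · rintro _ ⟨s, t, hs, ht, rfl⟩
    exact @MeasurableSet.inter _ (m₁ ⊔ m₂) _ _ ((le_sup_left : m₁ ≤ _) s hs)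
      ((le_sup_right : m₂ ≤ _) t ht)

theorem isPiSystem_interSets {Ω : Type} (m₁ m₂ : MeasurableSpace Ω) :
    IsPiSystem (interSets m₁ m₂) := by
  rintro _ ⟨s, t, hs, ht, rfl⟩ _ ⟨s', t', hs', ht', rfl⟩ -
  exact ⟨s ∩ s', t ∩ t', @MeasurableSet.inter _ m₁ _ _ hs hs',
    @MeasurableSet.inter _ m₂ _ _ ht ht', Set.inter_inter_inter_comm _ _ _ _⟩

namespace ProbOn

theorem le_refl {Ω : Type} (P : ProbOn Ω) : P.le P := ⟨_root_.le_refl _, fun _ _ => rfl⟩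

theorem le_trans {Ω : Type} {P Q R : ProbOn Ω} (h : P.le Q) (h' : Q.le R) : P.le R :=
  ⟨h.1.trans h'.1, fun s hs => (h'.2 s (h.1 s hs)).trans (h.2 s hs)⟩

theorem le_antisymm {Ω : Type} {P Q : ProbOn Ω} (h : P.le Q) (h' : Q.le P) : P = Q :=
  ext' (_root_.le_antisymm h.1 h'.1) fun s hs => (h.2 s hs).symm

theorem triv_le {Ω : Type} [Nonempty Ω] (P : ProbOn Ω) : (triv Ω).le P := by
  refine ⟨bot_le, fun s hs => ?_⟩
  let _ := P.alg
  have := P.prob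
  rcases MeasurableSpace.measurableSet_bot_iff.1 hs with rfl | rfl
  · simp
  · let _ : MeasurableSpace Ω := ⊥
    have := (triv Ω).prob
    exact P.prob.measure_univ.trans (measure_univ (μ := (triv Ω).meas)).symm

/-- Trimming the measure of `Q` to the events of `P` reduces this to uniqueness of a probability
measure on a π-system. -/
theorem le_of_isPiSystem {Ω : Type} {P Q : ProbOn Ω} (hPQ : P.alg ≤ Q.alg) {C : Set (Set Ω)}
    (hP : P.alg = MeasurableSpace.generateFrom C) (hC : IsPiSystem C)
    (h : ∀ s ∈ C, Q.meas s = P.meas s) : P.le Q := by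
  have := Q.prob
  let Q' : ProbOn Ω := ⟨P.alg, Q.meas.trim hPQ, ⟨(trim_measurableSet_eq hPQ MeasurableSet.univ).trans measure_univ⟩⟩
  have hmeas : ∀ s, MeasurableSet[P.alg] s → Q'.meas s = Q.meas s :=
    fun s hs => trim_measurableSet_eq hPQ hs
  have hQ' : Q' = P := by
    refine eq_of_isPiSystem hP hP hC fun s hs => ?_
    rw [hmeas s (hP ▸ MeasurableSpace.measurableSet_generateFrom hs), h s hs]
  refine ⟨hPQ, fun s hs => ?_⟩
  rw [← hmeas s hs, hQ']

variable {Ω : CSur}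

/-- The events of `P` and `Q` are combinatorially independent. -/
def Compatible (P Q : ProbOn Ω.carrier) : Prop :=
  ∀ s t : Set Ω.carrier, MeasurableSet[P.alg] s → MeasurableSet[Q.alg] t →
    s.Nonempty → t.Nonempty → (s ∩ t).Nonempty

/-- `R` is the join of `P` and `Q`. -/
def Joins (P Q R : ProbOn Ω.carrier) : Prop := ∃ h : Factors Ω (P, Q), joinVal h = R

theorem factors_iff_compatible {P Q : ProbOn Ω.carrier} : Factors Ω (P, Q) ↔ Compatible P Q :=
  ⟨fun h _ _ => h.inter_nonempty, factors_of_inter_nonempty (P, Q)⟩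

theorem Compatible.exists_joins {P Q : ProbOn Ω.carrier} (h : Compatible P Q) :
    ∃ R, Joins P Q R :=
  ⟨_, factors_iff_compatible.2 h, rfl⟩

theorem Joins.compatible {P Q R : ProbOn Ω.carrier} (h : Joins P Q R) : Compatible P Q :=
  factors_iff_compatible.1 h.1

theorem Joins.alg_eq {P Q R : ProbOn Ω.carrier} (h : Joins P Q R) : R.alg = P.alg ⊔ Q.alg := by
  obtain ⟨h, rfl⟩ := h
  obtain ⟨Ω₁, Ω₂, p, P₁, P₂, hp⟩ := id h
  obtain ⟨h₁, h₂⟩ := id hp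
  dsimp only at h₁ h₂
  rw [hp.joinVal_eq h, ← h₁, ← h₂]
  change MeasurableSpace.comap p.toFun (P₁.alg.comap Prod.fst ⊔ P₂.alg.comap Prod.snd) = _
  rw [MeasurableSpace.comap_sup, MeasurableSpace.comap_comp, MeasurableSpace.comap_comp]
  rfl

theorem Joins.meas_inter {P Q R : ProbOn Ω.carrier} (h : Joins P Q R) {s t : Set Ω.carrier}
    (hs : MeasurableSet[P.alg] s) (ht : MeasurableSet[Q.alg] t) :
    R.meas (s ∩ t) = P.meas s * Q.meas t := by
  obtain ⟨h, rfl⟩ := h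
  obtain ⟨Ω₁, Ω₂, p, P₁, P₂, hp⟩ := id h
  obtain ⟨h₁, h₂⟩ := id hp
  dsimp only at h₁ h₂
  rw [hp.joinVal_eq h]
  rw [← h₁] at hs ⊢
  rw [← h₂] at ht ⊢
  obtain ⟨s, hs, rfl⟩ := hs
  obtain ⟨t, ht, rfl⟩ := ht
  rw [pull_apply _ _ _ hs, pull_apply _ _ _ ht, ← prod_apply, ← pull_apply p.toFun p.surj]
  · rfl
  · let _ := P₁.alg
    let _ := P₂.alg
    exact MeasurableSet.prod hs ht

/-- This describes the join by events alone, without reference to a factorization. Compatibility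
provides some join, and agreement on the π-system of intersections identifies it with `R`. -/
theorem joins_iff {P Q R : ProbOn Ω.carrier} : Joins P Q R ↔ Compatible P Q ∧
    R.alg = P.alg ⊔ Q.alg ∧ ∀ s t, MeasurableSet[P.alg] s → MeasurableSet[Q.alg] t →
      R.meas (s ∩ t) = P.meas s * Q.meas t := by
  refine ⟨fun h => ⟨h.compatible, h.alg_eq, fun _ _ => h.meas_inter⟩, fun ⟨h, ha, hm⟩ => ?_⟩
  obtain ⟨R', hR'⟩ := h.exists_joins
  have : R' = R := by
    refine eq_of_isPiSystem (hR'.alg_eq.trans (sup_eq_generateFrom_interSets _ _))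
      (ha.trans (sup_eq_generateFrom_interSets _ _)) (isPiSystem_interSets _ _) ?_
    rintro _ ⟨s, t, hs, ht, rfl⟩
    rw [hm s t hs ht, hR'.meas_inter hs ht]
  rwa [← this]

theorem Joins.unique {P Q R R' : ProbOn Ω.carrier} (h : Joins P Q R) (h' : Joins P Q R') :
    R = R' := h.2.symm.trans h'.2

theorem triv_joins (P : ProbOn Ω.carrier) : Joins (triv Ω.carrier) P P := by
  let _ : MeasurableSpace Ω.carrier := ⊥
  have := (triv Ω.carrier).prob
  refine joins_iff.2 ⟨fun s t hs ht hs' ht' => ?_, (bot_sup_eq _).symm, fun s t hs ht => ?_⟩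
  · rcases MeasurableSpace.measurableSet_bot_iff.1 hs with rfl | rfl
    · exact (Set.not_nonempty_empty hs').elim
    · rwa [Set.univ_inter]
  · rcases MeasurableSpace.measurableSet_bot_iff.1 hs with rfl | rfl
    · rw [Set.empty_inter, measure_empty, measure_empty, zero_mul]
    · rw [Set.univ_inter, show (triv Ω.carrier).meas Set.univ = 1 from measure_univ, one_mul]

theorem Joins.symm {P Q R : ProbOn Ω.carrier} (h : Joins P Q R) : Joins Q P R := by
  refine joins_iff.2 ⟨fun s t hs ht hs' ht' => ?_, h.alg_eq.trans (sup_comm _ _),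
    fun s t hs ht => ?_⟩
  · rw [Set.inter_comm]
    exact h.compatible t s ht hs ht' hs'
  · rw [Set.inter_comm, h.meas_inter ht hs, mul_comm]

/-- A nonempty event of the join contains a nonempty intersection of events. -/
theorem exists_inter_subset {P Q : ProbOn Ω.carrier} {t : Set Ω.carrier}
    (ht : MeasurableSet[P.alg ⊔ Q.alg] t) (ht' : t.Nonempty) :
    ∃ a b, MeasurableSet[P.alg] a ∧ MeasurableSet[Q.alg] b ∧ a.Nonempty ∧ b.Nonempty ∧
      a ∩ b ⊆ t := by
  -- Both algebras, hence their supremum, consist of preimages under `f`. So `t` contains, with any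
  -- point `c`, the whole intersection of the two atoms of `c`.
  let f : Ω.carrier → P.atoms.carrier × Q.atoms.carrier :=
    fun x => (P.toAtoms.toFun x, Q.toAtoms.toFun x)
  have h1 : P.alg ≤ MeasurableSpace.comap f ⊤ := by
    intro s hs
    rw [← P.pb_onAtoms] at hs
    obtain ⟨u, -, rfl⟩ := hs
    exact ⟨Prod.fst ⁻¹' u, trivial, rfl⟩
  have h2 : Q.alg ≤ MeasurableSpace.comap f ⊤ := by
    intro s hs
    rw [← Q.pb_onAtoms] at hs
    obtain ⟨u, -, rfl⟩ := hs
    exact ⟨Prod.snd ⁻¹' u, trivial, rfl⟩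
  obtain ⟨u, -, rfl⟩ := sup_le h1 h2 t ht
  obtain ⟨c, hc⟩ := ht'
  refine ⟨_, _, P.measurableSet_class c, Q.measurableSet_class c, ⟨c, P.atomSetoid.refl c⟩,
    ⟨c, Q.atomSetoid.refl c⟩, ?_⟩
  rintro d ⟨hd, hd'⟩
  have : f d = f c := Prod.ext (Quotient.sound (P.atomSetoid.symm hd))
    (Quotient.sound (Q.atomSetoid.symm hd'))
  rwa [Set.mem_preimage, this]

/-- Both bracketings generate the same algebra and multiply measures on triple intersections, which
form a generating π-system. -/
theorem Joins.assoc {P Q R PQ PQR : ProbOn Ω.carrier} (h : Joins P Q PQ) (h' : Joins PQ R PQR) :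
    ∃ QR, Joins Q R QR ∧ Joins P QR PQR := by
  have hP : P.alg ≤ PQ.alg := h.alg_eq ▸ le_sup_left
  have hQ : Q.alg ≤ PQ.alg := h.alg_eq ▸ le_sup_right
  have hQR : Compatible Q R := fun s t hs ht => h'.compatible s t (hQ s hs) ht
  obtain ⟨QR, hQR⟩ := hQR.exists_joins
  -- A nonempty event of `QR` contains some `a ∩ b` with both sides nonempty. Then `s ∩ a` is a
  -- nonempty event of `PQ`, and so it meets `b`.
  have hc : Compatible P QR := by
    intro s t hs ht hs' ht'
    rw [hQR.alg_eq] at ht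
    obtain ⟨a, b, ha, hb, ha', hb', hab⟩ := exists_inter_subset ht ht'
    have h1 := h'.compatible (s ∩ a) b
      (@MeasurableSet.inter _ PQ.alg _ _ (hP s hs) (hQ a ha)) hb (h.compatible s a hs ha hs' ha') hb'
    rw [Set.inter_assoc] at h1
    exact h1.mono (Set.inter_subset_inter_right _ hab)
  obtain ⟨S, hS⟩ := hc.exists_joins
  have hgen : P.alg ⊔ (Q.alg ⊔ R.alg) = MeasurableSpace.generateFrom
      {u | ∃ s v, MeasurableSet[P.alg] s ∧ v ∈ interSets Q.alg R.alg ∧ u = s ∩ v} := by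
    refine _root_.le_antisymm (sup_le ?_ (sup_le ?_ ?_)) (MeasurableSpace.generateFrom_le ?_)
    · exact fun s hs => MeasurableSpace.measurableSet_generateFrom
        ⟨s, _, hs, ⟨Set.univ, Set.univ, MeasurableSet.univ, MeasurableSet.univ, rfl⟩, by simp⟩
    · exact fun s hs => MeasurableSpace.measurableSet_generateFrom
        ⟨Set.univ, _, MeasurableSet.univ, ⟨s, Set.univ, hs, MeasurableSet.univ, rfl⟩, by simp⟩
    · exact fun s hs => MeasurableSpace.measurableSet_generateFrom
        ⟨Set.univ, _, MeasurableSet.univ, ⟨Set.univ, s, MeasurableSet.univ, hs, rfl⟩, by simp⟩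
    · rintro _ ⟨s, v, hs, hv, rfl⟩
      refine @MeasurableSet.inter _ (P.alg ⊔ (Q.alg ⊔ R.alg)) _ _
        ((le_sup_left : P.alg ≤ _) s hs) ((le_sup_right : Q.alg ⊔ R.alg ≤ _) v ?_)
      rw [sup_eq_generateFrom_interSets]
      exact MeasurableSpace.measurableSet_generateFrom hv
  refine ⟨QR, hQR, ?_⟩
  have : S = PQR := by
    refine eq_of_isPiSystem (hS.alg_eq.trans ((congrArg _ hQR.alg_eq).trans hgen))
      (h'.alg_eq.trans ((congrArg (· ⊔ R.alg) h.alg_eq).trans ((sup_assoc _ _ _).trans hgen)))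
      ?_ ?_
    · rintro _ ⟨s, v, hs, hv, rfl⟩ _ ⟨s', v', hs', hv', rfl⟩ -
      have hvv : v ∩ v' ∈ interSets Q.alg R.alg := by
        obtain ⟨a, b, ha, hb, rfl⟩ := hv
        obtain ⟨a', b', ha', hb', rfl⟩ := hv'
        exact ⟨a ∩ a', b ∩ b', @MeasurableSet.inter _ Q.alg _ _ ha ha',
          @MeasurableSet.inter _ R.alg _ _ hb hb', Set.inter_inter_inter_comm _ _ _ _⟩
      exact ⟨s ∩ s', v ∩ v', @MeasurableSet.inter _ P.alg _ _ hs hs', hvv,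
        Set.inter_inter_inter_comm _ _ _ _⟩
    · rintro _ ⟨s, _, hs, ⟨a, b, ha, hb, rfl⟩, rfl⟩
      have hab : MeasurableSet[QR.alg] (a ∩ b) := by
        rw [hQR.alg_eq, sup_eq_generateFrom_interSets]
        exact MeasurableSpace.measurableSet_generateFrom ⟨a, b, ha, hb, rfl⟩
      rw [hS.meas_inter hs hab, hQR.meas_inter ha hb, ← Set.inter_assoc,
        h'.meas_inter (@MeasurableSet.inter _ PQ.alg _ _ (hP s hs) (hQ a ha)) hb,
        h.meas_inter hs ha, mul_assoc]
  rwa [← this]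

theorem Joins.mono {P P' Q Q' R' : ProbOn Ω.carrier} (hP : P.le P') (hQ : Q.le Q')
    (h : Joins P' Q' R') : ∃ R, Joins P Q R ∧ R.le R' := by
  have hc : Compatible P Q := fun s t hs ht => h.compatible s t (hP.1 s hs) (hQ.1 t ht)
  obtain ⟨R, hR⟩ := hc.exists_joins
  refine ⟨R, hR, le_of_isPiSystem ?_ (hR.alg_eq.trans (sup_eq_generateFrom_interSets _ _))
    (isPiSystem_interSets _ _) ?_⟩
  · rw [hR.alg_eq, h.alg_eq]
    exact sup_le_sup hP.1 hQ.1
  · rintro _ ⟨s, t, hs, ht, rfl⟩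
    rw [hR.meas_inter hs ht, h.meas_inter (hP.1 s hs) (hQ.1 t ht), hP.2 s hs, hQ.2 t ht]

/-- Factoring through a product descends along surjections because it is a condition on meeting
events. Joins can therefore be tested over any refinement. -/
theorem joins_pb {Ω' : CSur} (q : Ω' ⟶ Ω) {P Q R : ProbOn Ω.carrier} :
    Joins (CSur.pb q P) (CSur.pb q Q) (CSur.pb q R) ↔ Joins P Q R := by
  constructor
  · rintro ⟨h, h'⟩
    have hF : Factors Ω (P, Q) := Factors.of_comp q h
    exact ⟨hF, pull_injective q.toFun q.surj ((joinVal_comp q hF).symm.trans h')⟩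
  · rintro ⟨h, rfl⟩
    exact ⟨h.comp q, joinVal_comp q h⟩

end ProbOn

/-! ### Generalized elements of the sheaf of probability spaces -/

section Sheaf

variable {X : DSh}

/-- The value of a generalized element of `shP`. -/
def probVal (x : X ⟶ shP) {Ω : CSur} (a : X.obj.obj (op Ω)) : ProbOn Ω.carrier :=
  x.hom.app (op Ω) a

theorem probVal_ext {x y : X ⟶ shP}
    (h : ∀ (Ω : CSur) (a : X.obj.obj (op Ω)), probVal x a = probVal y a) : x = y := by
  refine ObjectProperty.hom_ext _ ?_
  ext Ω a
  exact h Ω.unop a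

theorem probVal_map (x : X ⟶ shP) {Ω Ω' : CSur} (p : Ω' ⟶ Ω) (a : X.obj.obj (op Ω)) :
    probVal x (X.obj.map p.op a) = CSur.pb p (probVal x a) :=
  NatTrans.naturality_apply x.hom p.op a

/-- The pairing of two generalized elements of `shP`. -/
noncomputable def shPair (x y : X ⟶ shP) : X ⟶ shPP :=
  ObjectProperty.homMk
    { app := fun Ω => ↾(fun a => (probVal x a, probVal y a))
      naturality := by
        intro Ω Ω' p
        ext a
        exact Prod.ext (probVal_map x p.unop a) (probVal_map y p.unop a) }

/-- With its analogue for `Mul`, this turns the internal axioms into statements about probability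
spaces on each sample space. -/
theorem shRM_le_iff (x y : X ⟶ shP) :
    shRM.Le x y ↔ ∀ (Ω : CSur) (a : X.obj.obj (op Ω)), (probVal x a).le (probVal y a) := by
  constructor
  · rintro ⟨h, t, rfl, rfl, ht⟩ Ω a
    have h1 := congrArg (fun f : X ⟶ shProp => f.hom.app (op Ω) a) ht
    exact of_eq_true h1
  · intro h
    refine ⟨shPair x y, ObjectProperty.homMk { app := fun _ => ↾(fun _ => PUnit.unit) }, rfl, rfl,
      ObjectProperty.hom_ext _ ?_⟩
    ext Ω a
    exact eq_true (h Ω.unop a)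

theorem shRM_mul_iff (x y z : X ⟶ shP) :
    shRM.Mul x y z ↔ ∀ (Ω : CSur) (a : X.obj.obj (op Ω)),
      ProbOn.Joins (probVal x a) (probVal y a) (probVal z a) := by
  constructor
  · rintro ⟨d, rfl, rfl, rfl⟩ Ω a
    exact ⟨(d.hom.app (op Ω) a).2, rfl⟩
  · intro h
    let d : X ⟶ shP2 := ObjectProperty.homMk
      { app := fun Ω => ↾(fun a => ⟨(probVal x a, probVal y a), (h Ω.unop a).1⟩)
        naturality := by
          intro Ω Ω' p
          ext a
          exact Subtype.ext (Prod.ext (probVal_map x p.unop a) (probVal_map y p.unop a)) }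
    exact ⟨d, rfl, rfl, probVal_ext fun Ω a => (h Ω a).2⟩

/-- Joins are unique and stable under pullback, so a pointwise choice is automatically natural. -/
theorem exists_joins_of_forall (x y : X ⟶ shP)
    (h : ∀ (Ω : CSur) (a : X.obj.obj (op Ω)), ∃ R, ProbOn.Joins (probVal x a) (probVal y a) R) :
    ∃ z : X ⟶ shP, ∀ (Ω : CSur) (a : X.obj.obj (op Ω)),
      ProbOn.Joins (probVal x a) (probVal y a) (probVal z a) := by
  choose z hz using h
  refine ⟨ObjectProperty.homMk
    { app := fun Ω => ↾(fun a => z Ω.unop a)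
      naturality := by
        intro Ω Ω' p
        ext a
        have h1 := hz _ (X.obj.map p a)
        have h2 := (ProbOn.joins_pb p.unop).2 (hz _ a)
        rw [← probVal_map, ← probVal_map] at h2
        exact h1.unique h2 }, hz⟩

theorem shRM_isResourceMonoid : shRM.IsResourceMonoid where
  isProduct := ⟨Limits.BinaryFan.IsLimit.mk _ (fun f g => shPair f g) (fun _ _ => rfl)
    (fun _ _ => rfl) (fun f g m h₁ h₂ => by
      refine ObjectProperty.hom_ext _ ?_
      ext Ω a
      subst h₁ h₂
      rfl)⟩
  isTerminal := ⟨Limits.IsTerminal.ofUniqueHom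
    (fun _ => ObjectProperty.homMk { app := fun _ => ↾(fun _ => PUnit.unit) })
    (fun _ _ => rfl)⟩
  mono_inc := ⟨fun {Z} f g h => by
    refine ObjectProperty.hom_ext _ ?_
    ext Ω a
    exact Subtype.ext (congrArg (fun k : Z ⟶ shPP => k.hom.app Ω a) h)⟩
  le_refl x := (shRM_le_iff x x).2 fun _ _ => ProbOn.le_refl _
  le_trans x y z h h' := (shRM_le_iff x z).2 fun Ω a =>
    ProbOn.le_trans ((shRM_le_iff x y).1 h Ω a) ((shRM_le_iff y z).1 h' Ω a)
  le_antisymm x y h h' := probVal_ext fun Ω a =>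
    ProbOn.le_antisymm ((shRM_le_iff x y).1 h Ω a) ((shRM_le_iff y x).1 h' Ω a)
  emp_le t x := (shRM_le_iff _ x).2 fun _ _ => ProbOn.triv_le _
  emp_mul t x := (shRM_mul_iff _ x x).2 fun _ _ => ProbOn.triv_joins _
  mul_comm x y z h := (shRM_mul_iff y x z).2 fun Ω a => ((shRM_mul_iff x y z).1 h Ω a).symm
  mul_assoc x y z xy xyz h h' := by
    replace h := (shRM_mul_iff _ _ _).1 h
    replace h' := (shRM_mul_iff _ _ _).1 h'
    have key := fun Ω a => (h Ω a).assoc (h' Ω a)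
    obtain ⟨yz, hyz⟩ := exists_joins_of_forall y z fun Ω a => ⟨_, (key Ω a).choose_spec.1⟩
    refine ⟨yz, (shRM_mul_iff _ _ _).2 hyz, (shRM_mul_iff _ _ _).2 fun Ω a => ?_⟩
    obtain ⟨w, hw, hw'⟩ := key Ω a
    rwa [(hyz Ω a).unique hw]
  mul_mono x x' y y' z' hx hy h := by
    replace hx := (shRM_le_iff _ _).1 hx
    replace hy := (shRM_le_iff _ _).1 hy
    replace h := (shRM_mul_iff _ _ _).1 h
    have key := fun Ω a => ProbOn.Joins.mono (hx Ω a) (hy Ω a) (h Ω a)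
    obtain ⟨z, hz⟩ := exists_joins_of_forall x y fun Ω a => ⟨_, (key Ω a).choose_spec.1⟩
    refine ⟨z, (shRM_mul_iff _ _ _).2 hz, (shRM_le_iff _ _).2 fun Ω a => ?_⟩
    obtain ⟨w, hw, hw'⟩ := key Ω a
    rwa [(hz Ω a).unique hw]

end Sheaf

/-! ### Discrete probability spaces -/

namespace ProbOn

/-- The discrete probability space with given weights. -/
noncomputable def disc {Ω : Type} (w : Ω → ENNReal) (hw : ∑' a, w a = 1) : ProbOn Ω :=
  letI : MeasurableSpace Ω := ⊤
  { alg := ⊤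
    meas := Measure.sum fun a => w a • Measure.dirac a
    prob := ⟨by simpa [Measure.sum_apply] using hw⟩ }

theorem disc_singleton {Ω : Type} {w : Ω → ENNReal} {hw : ∑' a, w a = 1} (a : Ω) :
    (disc w hw).meas {a} = w a := by
  classical
  let _ : MeasurableSpace Ω := ⊤
  change (Measure.sum fun a => w a • Measure.dirac a) {a} = w a
  rw [Measure.sum_apply _ (MeasurableSet.singleton a), tsum_eq_single a]
  · simp
  · intro b hb
    simp [hb]

theorem eq_of_singleton {Ω : Type} [Countable Ω] {P Q : ProbOn Ω} (hP : P.alg = ⊤) (hQ : Q.alg = ⊤)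
    (h : ∀ a, P.meas {a} = Q.meas {a}) : P = Q := by
  obtain ⟨m, μ, hμ⟩ := P
  obtain ⟨m', ν, hν⟩ := Q
  obtain rfl : m = ⊤ := hP
  obtain rfl : m' = ⊤ := hQ
  let _ : MeasurableSpace Ω := ⊤
  obtain rfl : μ = ν := Measure.ext_of_singleton h
  rfl

theorem meas_eq_tsum {Ω : Type} [Countable Ω] {P : ProbOn Ω} (hP : P.alg = ⊤) (s : Set Ω) :
    P.meas s = ∑' a : s, P.meas {(a : Ω)} := by
  obtain ⟨m, μ, hμ⟩ := P
  obtain rfl : m = ⊤ := hP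
  let _ : MeasurableSpace Ω := ⊤
  rw [tsum_subtype s fun a => μ {a}]
  exact (Measure.tsum_indicator_apply_singleton μ s trivial).symm

theorem tsum_singleton {Ω : Type} [Countable Ω] {P : ProbOn Ω} (hP : P.alg = ⊤) :
    ∑' a, P.meas {a} = 1 := by
  rw [← P.prob.measure_univ, meas_eq_tsum hP, tsum_univ (fun a => P.meas {a})]

theorem prod_alg_eq_top {Ω Ω' : Type} [Countable Ω] [Countable Ω'] {P : ProbOn Ω} {Q : ProbOn Ω'}
    (hP : P.alg = ⊤) (hQ : Q.alg = ⊤) : (P.prod Q).alg = ⊤ := by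
  obtain ⟨m, μ, hμ⟩ := P
  obtain ⟨m', ν, hν⟩ := Q
  obtain rfl : m = ⊤ := hP
  obtain rfl : m' = ⊤ := hQ
  refine eq_top_iff.2 fun s _ => ?_
  let _ : MeasurableSpace Ω := ⊤
  let _ : MeasurableSpace Ω' := ⊤
  exact s.to_countable.measurableSet

end ProbOn

/-- Each fibre of `p` is a union of fibres of `q`. This is how inclusions of σ-algebras become
refinement maps of partitions. -/
theorem CSur.exists_factor {Ω Ω₁ Ω₂ : CSur} (p : Ω ⟶ Ω₁) (q : Ω ⟶ Ω₂)
    (h : MeasurableSpace.comap p.toFun ⊤ ≤ MeasurableSpace.comap q.toFun ⊤) :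
    ∃ s : Ω₂ ⟶ Ω₁, q ≫ s = p := by
  have key : ∀ a b, q.toFun a = q.toFun b → p.toFun a = p.toFun b := by
    intro a b hab
    obtain ⟨t, -, ht⟩ := h (p.toFun ⁻¹' {p.toFun b}) ⟨_, trivial, rfl⟩
    have hb : b ∈ q.toFun ⁻¹' t := ht ▸ rfl
    have ha : a ∈ q.toFun ⁻¹' t := by
      rwa [Set.mem_preimage, hab]
    rw [ht] at ha
    exact ha
  choose r hr using q.surj
  have hs : ∀ a, p.toFun (r (q.toFun a)) = p.toFun a := fun a => key _ _ (hr _)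
  refine ⟨⟨fun c => p.toFun (r c), fun d => ?_⟩, CSur.Hom.ext (funext hs)⟩
  obtain ⟨a, rfl⟩ := p.surj d
  exact ⟨q.toFun a, hs a⟩

theorem injective_of_top_le_comap {X Y : Type} {f : X → Y}
    (h : ⊤ ≤ MeasurableSpace.comap f ⊤) : Function.Injective f := by
  intro a b hab
  obtain ⟨t, -, ht⟩ := h {b} trivial
  have hb : b ∈ f ⁻¹' t := ht ▸ rfl
  have ha : a ∈ f ⁻¹' t := by rwa [Set.mem_preimage, hab]
  rw [ht] at ha
  exact ha

theorem top_le_comap_of_injective {X Y : Type} {f : X → Y} (hf : Function.Injective f) :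
    MeasurableSpace.comap f ⊤ = ⊤ :=
  eq_top_iff.2 fun s _ => ⟨f '' s, trivial, Set.preimage_image_eq s hf⟩

theorem Labelling.Over.of_comp {Ω'' Ω' Ω : CSur} {q : Ω'' ⟶ Ω'} {p : Ω' ⟶ Ω}
    {ℓ'' : Labelling Ω''.carrier} {ℓ' : Labelling Ω'.carrier} {ℓ : Labelling Ω.carrier}
    (hq : Labelling.Over q ℓ'' ℓ') (h : Labelling.Over (q ≫ p) ℓ'' ℓ) : Labelling.Over p ℓ' ℓ := by
  filter_upwards [hq, h] with x h1 h2
  rw [← h1, ← h2]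
  rfl

/-! ### Measured partitions as elements of the colimit -/

namespace Partn

variable {A B : Partn}

theorem eq_of_le_part {s : Set unitInterval} (hs : volume s ≠ 0) {i j : A.I}
    (hi : s ≤ᵐ[volume] A.part i) (hj : s ≤ᵐ[volume] A.part j) : i = j := by
  by_contra h
  refine hs (measure_eq_zero_iff_ae_notMem.2 ?_)
  filter_upwards [hi, hj] with x h1 h2 hx
  exact h (A.eq_of_mem_part (h1 hx) (h2 hx))

/-- A map of indices compatible with the parts is surjective. -/
theorem surjective_of_le_part {p : B.I → A.I} (hp : ∀ j, B.part j ≤ᵐ[volume] A.part (p j)) :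
    Function.Surjective p := by
  intro i
  obtain ⟨j, hj⟩ := B.exists_inter _ (A.nonnull i)
  refine ⟨j, eq_of_le_part hj ?_ ?_⟩
  · filter_upwards [hp j] with x hx h
    exact hx h.1
  · exact Filter.Eventually.of_forall fun x h => h.2

theorem part_ae_eq_of_injective {s : B.space ⟶ A.space} (hs : Labelling.Over s B.label A.label)
    (hinj : Function.Injective s.toFun) (j : B.space.carrier) :
    B.part j =ᵐ[volume] A.part (s.toFun j) := by
  filter_upwards [hs] with x hx
  refine propext ((B.mem_part_iff x j).trans (Iff.trans ?_ (A.mem_part_iff x _).symm))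
  rw [← hx, hinj.eq_iff]

end Partn

namespace Weighted

/-- The weights of a measured partition. -/
def weight (W : Weighted) : W.space.carrier → ENNReal := W.wt

/-- The discrete probability space on the set of parts of a measured partition. -/
noncomputable def disc (W : Weighted) : ProbOn W.space.carrier := ProbOn.disc W.weight W.sum_wt

variable {W V U : Weighted}

theorem disc_alg (W : Weighted) : W.disc.alg = ⊤ := rfl

theorem measurableSet_disc (W : Weighted) (s : Set W.space.carrier) : MeasurableSet[W.disc.alg] s :=
  trivial

theorem disc_singleton (i : W.space.carrier) : W.disc.meas {i} = W.weight i :=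
  ProbOn.disc_singleton i

theorem disc_apply_fiber {Ω : Type} (s : W.space.carrier → Ω) (b : Ω) :
    W.disc.meas (s ⁻¹' {b}) = ∑' j : {j // s j = b}, W.weight j.1 := by
  rw [ProbOn.meas_eq_tsum W.disc_alg]
  exact tsum_congr fun j => disc_singleton _

theorem injective_of_pb_eq_disc {Ω : CSur} {P : ProbOn Ω.carrier} {s : W.space ⟶ Ω}
    (h : CSur.pb s P = W.disc) : Function.Injective s.toFun := by
  refine injective_of_top_le_comap ?_
  rw [← W.disc_alg, ← h]
  exact MeasurableSpace.comap_mono le_top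

/-- The pullback of a full σ-algebra is full exactly when `s` is injective; measures on countable
discrete spaces are then compared on singletons. -/
theorem pb_eq_disc_iff {Ω : CSur} {P : ProbOn Ω.carrier} (hP : P.alg = ⊤) (s : W.space ⟶ Ω) :
    CSur.pb s P = W.disc ↔
      Function.Injective s.toFun ∧ ∀ i, W.weight i = P.meas {s.toFun i} := by
  have hm : Function.Injective s.toFun → ∀ i, (CSur.pb s P).meas {i} = P.meas {s.toFun i} := by
    intro hs i
    rw [← ProbOn.pull_apply s.toFun s.surj P (hP ▸ trivial), ← Set.image_singleton,
      Set.preimage_image_eq _ hs]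
  constructor
  · intro h
    have hs := injective_of_pb_eq_disc h
    exact ⟨hs, fun i => by rw [← hm hs, h, disc_singleton]⟩
  · rintro ⟨hs, hw⟩
    refine ProbOn.eq_of_singleton ?_ W.disc_alg fun i => ?_
    · rw [ProbOn.pull_alg, hP, top_le_comap_of_injective hs]
    · rw [hm hs, disc_singleton, hw]

/-- This begins a dictionary, continued by `le_iff` and `isIndep_iff`: relations between measured
partitions amount to maps between their sets of parts, respecting labels and discrete spaces. -/
theorem equiv_iff : Equiv W V ↔ ∃ s : W.space ⟶ V.space,
    Labelling.Over s W.label V.label ∧ CSur.pb s V.disc = W.disc := by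
  constructor
  · intro h
    choose s hs hw using h.exists
    have hs' := fun i => (hs i).le
    refine ⟨⟨s, Partn.surjective_of_le_part hs'⟩, (Partn.le_part_iff_over _).1 hs', ?_⟩
    refine (pb_eq_disc_iff V.disc_alg _).2 ⟨fun i j hij => ?_, fun i => ?_⟩
    · have hij : s i = s j := hij
      exact W.part_inj (hs i) (hij ▸ hs j)
    · exact (hw i).trans (disc_singleton (W := V) (s i)).symm
  · rintro ⟨s, hs, h⟩
    obtain ⟨hinj, hw⟩ := (pb_eq_disc_iff V.disc_alg s).1 h
    exact equiv_of_map fun i => ⟨s.toFun i, Partn.part_ae_eq_of_injective hs hinj i,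
      (hw i).trans (disc_singleton (W := V) _)⟩

theorem le_iff : W.le V ↔ ∃ s : V.space ⟶ W.space,
    Labelling.Over s V.label W.label ∧ (CSur.pb s W.disc).le V.disc := by
  have key : ∀ s : V.space ⟶ W.space, (CSur.pb s W.disc).le V.disc ↔
      ∀ i : W.space.carrier, W.weight i = ∑' j : {j // s.toFun j = i}, V.weight j.1 := by
    intro s
    constructor
    · rintro ⟨-, h⟩ i
      rw [← disc_apply_fiber, h _ ⟨{i}, trivial, rfl⟩, ProbOn.pull_apply _ _ _ (W.measurableSet_disc _),
        disc_singleton]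
    · intro h
      refine ⟨le_top, ?_⟩
      rintro _ ⟨t, -, rfl⟩
      have : V.disc.push s.toFun = W.disc := by
        refine ProbOn.eq_of_singleton (eq_top_iff.2 fun _ _ => trivial) W.disc_alg fun i => ?_
        rw [ProbOn.push_apply _ _ (V.measurableSet_disc _), disc_apply_fiber, disc_singleton, h]
      rw [ProbOn.pull_apply _ _ _ (W.measurableSet_disc _), ← this, ProbOn.push_apply _ _ (V.measurableSet_disc _)]
  constructor
  · rintro ⟨s, hs, hw⟩
    exact ⟨⟨s, Partn.surjective_of_le_part hs⟩, (Partn.le_part_iff_over _).1 hs, (key _).2 hw⟩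
  · rintro ⟨s, hs, h⟩
    exact ⟨s.toFun, (Partn.le_part_iff_over s).2 hs, (key s).1 h⟩

theorem isIndep_iff : W.IsIndep V U ↔ ∃ s : U.space ⟶ W.space.prod V.space,
    Labelling.Over (s ≫ CSur.fst _ _) U.label W.label ∧
    Labelling.Over (s ≫ CSur.snd _ _) U.label V.label ∧
    CSur.pb s (W.disc.prod V.disc) = U.disc := by
  have halg : (W.disc.prod V.disc).alg = ⊤ := ProbOn.prod_alg_eq_top W.disc_alg V.disc_alg
  have hpt : ∀ i j, (W.disc.prod V.disc).meas {(i, j)} = W.weight i * V.weight j := by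
    intro i j
    rw [← Set.singleton_prod_singleton, ProbOn.prod_apply, disc_singleton, disc_singleton]
  constructor
  · rintro ⟨h₁, h₂⟩
    choose f g hfg using h₁
    have hf : ∀ k, U.part k ≤ᵐ[volume] W.part (f k) := fun k =>
      (hfg k).le.trans (Filter.Eventually.of_forall fun x hx => hx.1)
    have hg : ∀ k, U.part k ≤ᵐ[volume] V.part (g k) := fun k =>
      (hfg k).le.trans (Filter.Eventually.of_forall fun x hx => hx.2)
    -- A nonnegligible part lies in only one part of each factor, so the chosen indices `f k` and `g
    -- k` are forced; surjectivity of the pair follows.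
    have hu : ∀ k i j, U.part k =ᵐ[volume] (W.part i ∩ V.part j : Set unitInterval) →
        f k = i ∧ g k = j := by
      intro k i j hk
      exact ⟨Partn.eq_of_le_part (U.nonnull k) (hf k)
          (hk.le.trans (Filter.Eventually.of_forall fun x hx => hx.1)),
        Partn.eq_of_le_part (U.nonnull k) (hg k)
          (hk.le.trans (Filter.Eventually.of_forall fun x hx => hx.2))⟩
    let s : U.space ⟶ W.space.prod V.space := ⟨fun k => (f k, g k), by
      rintro ⟨i, j⟩
      obtain ⟨k, hk, -⟩ := h₂ i j
      obtain ⟨h1, h2⟩ := hu k i j hk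
      exact ⟨k, Prod.ext h1 h2⟩⟩
    refine ⟨s, (Partn.le_part_iff_over (s ≫ CSur.fst _ _)).1 hf,
      (Partn.le_part_iff_over (s ≫ CSur.snd _ _)).1 hg,
      (pb_eq_disc_iff halg s).2 ⟨fun k k' hkk => ?_, fun k => ?_⟩⟩
    · have h1 : f k = f k' := congrArg Prod.fst hkk
      have h2 : g k = g k' := congrArg Prod.snd hkk
      exact U.part_inj (hfg k) (h1 ▸ h2 ▸ hfg k')
    · obtain ⟨k', hk', hw⟩ := h₂ (f k) (g k)
      obtain rfl := U.part_inj hk' (hfg k)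
      exact hw.trans (hpt _ _).symm
  · rintro ⟨s, hs₁, hs₂, h⟩
    obtain ⟨hinj, hw⟩ := (pb_eq_disc_iff halg s).1 h
    have hpart : ∀ k i j, s.toFun k = (i, j) →
        U.part k =ᵐ[volume] (W.part i ∩ V.part j : Set unitInterval) := by
      intro k i j hk
      filter_upwards [hs₁, hs₂] with x h1 h2
      refine propext ((U.mem_part_iff x k).trans (Iff.trans ?_
        (and_congr (W.mem_part_iff x i) (V.mem_part_iff x j)).symm))
      rw [← h1, ← h2, ← hinj.eq_iff, hk, Prod.ext_iff]
      rfl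
    refine ⟨fun k => ⟨_, _, hpart k _ _ rfl⟩, fun i j => ?_⟩
    obtain ⟨k, hk⟩ := s.surj (i, j)
    exact ⟨k, hpart k i j hk, (hw k).trans (by rw [hk]; exact hpt i j)⟩

end Weighted

/-! ### Measured partitions and the colimit of the sheaf of probability spaces -/

/-- The element of the colimit of the sheaf of probability spaces given by a labelling by `Ω` and a
probability space on `Ω`. -/
noncomputable def Colim.prob {Ω : CSur} (ℓ : Labelling Ω.carrier) (P : ProbOn Ω.carrier) :
    Colim shP := Colim.mk shP ℓ P

namespace Colim

variable {Ω Ω' : CSur}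

theorem prob_over {p : Ω' ⟶ Ω} {ℓ' : Labelling Ω'.carrier} {ℓ : Labelling Ω.carrier}
    (h : Labelling.Over p ℓ' ℓ) (P : ProbOn Ω.carrier) : prob ℓ' (CSur.pb p P) = prob ℓ P :=
  mk_over (F := shP) h P

theorem prob_injective (ℓ : Labelling Ω.carrier) : Function.Injective (prob ℓ) :=
  mk_injective (F := shP) ℓ

theorem prob_eq_prob_iff {Ω₁ Ω₂ : CSur} {ℓ₁ : Labelling Ω₁.carrier} {ℓ₂ : Labelling Ω₂.carrier}
    {ℓ : Labelling Ω.carrier} {p : Ω ⟶ Ω₁} {q : Ω ⟶ Ω₂} (hp : Labelling.Over p ℓ ℓ₁)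
    (hq : Labelling.Over q ℓ ℓ₂) (P : ProbOn Ω₁.carrier) (Q : ProbOn Ω₂.carrier) :
    prob ℓ₁ P = prob ℓ₂ Q ↔ CSur.pb p P = CSur.pb q Q :=
  mk_eq_mk_iff (F := shP) hp hq P Q

theorem exists_prob (z : Colim shP) :
    ∃ (Ω : CSur) (ℓ : Labelling Ω.carrier) (P : ProbOn Ω.carrier), prob ℓ P = z :=
  exists_mk z

end Colim

namespace MP

/-- A measured partition as an element of the colimit of the sheaf of probability spaces. -/
noncomputable def toColim : MP → Colim shP :=
  Quotient.lift (fun W => Colim.prob W.label W.disc) fun W V h => by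
    obtain ⟨s, hs, hd⟩ := Weighted.equiv_iff.1 h
    rw [← Colim.prob_over hs V.disc, hd]

theorem toColim_smul (π : AutIᵐᵒᵖ) (x : MP) : toColim (π • x) = π • toColim x := by
  induction x using Quotient.inductionOn with | _ W
  refine Colim.mk_congr (F := shP) (ℓ := W.label.act π.unop) (ℓ' := (W.act π.unop).label) ?_ W.disc
  refine Filter.Eventually.of_forall fun x => ?_
  refine ((W.act π.unop).mem_part_iff x _).1 ?_
  exact (W.mem_part_iff (π.unop.rep x) _).2 rfl

/-- Over a common refinement the two pulled-back discrete spaces coincide, so their σ-algebras do.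
This yields a map between the sets of parts, and cancelling the pullback along `p` gives the
equality of discrete spaces. -/
theorem toColim_injective : Function.Injective toColim := by
  intro x y h
  induction x using Quotient.inductionOn with | _ W
  induction y using Quotient.inductionOn with | _ V
  obtain ⟨Ω, ℓ, p, q, hp, hq⟩ := Labelling.exists_common W.label V.label
  have h1 : CSur.pb p W.disc = CSur.pb q V.disc := (Colim.prob_eq_prob_iff hp hq W.disc V.disc).1 h
  have h2 : MeasurableSpace.comap q.toFun ⊤ = MeasurableSpace.comap p.toFun ⊤ :=
    (congrArg ProbOn.alg h1).symm
  obtain ⟨s, rfl⟩ := CSur.exists_factor q p h2.le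
  rw [CSur.pb_comp] at h1
  exact Quotient.sound (Weighted.equiv_iff.2
    ⟨s, hp.of_comp hq, (ProbOn.pull_injective _ p.surj h1).symm⟩)

theorem exists_toColim_eq (A : Partn) (P : ProbOn A.space.carrier) (hP : P.alg = ⊤) :
    ∃ x, toColim x = Colim.prob A.label P := by
  let W : Weighted :=
    { A with
      wt := fun i => P.meas {i}
      sum_wt := ProbOn.tsum_singleton hP }
  refine ⟨Quotient.mk _ W, ?_⟩
  have : W.disc = P := ProbOn.eq_of_singleton W.disc_alg hP fun i => W.disc_singleton i
  exact congrArg (Colim.prob A.label) this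

/-- On a countable set every atom is an event, and any set of atoms is a countable union of them. -/
theorem onAtoms_alg {Ω : CSur} (P : ProbOn Ω.carrier) : P.onAtoms.alg = ⊤ := by
  refine eq_top_iff.2 fun s _ => ?_
  have : MeasurableSet[P.alg] (⋃ a ∈ P.toAtoms.toFun ⁻¹' s, {b | P.atomSetoid a b}) :=
    @MeasurableSet.biUnion _ _ P.alg _ _ (Set.to_countable _) fun a _ => P.measurableSet_class a
  change MeasurableSet[P.alg] (P.toAtoms.toFun ⁻¹' s)
  convert this
  ext b
  simp only [Set.mem_iUnion, exists_prop]
  constructor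
  · exact fun hb => ⟨b, hb, P.atomSetoid.refl b⟩
  · rintro ⟨a, ha, hab⟩
    have : P.toAtoms.toFun a = P.toAtoms.toFun b := Quotient.sound hab
    rwa [Set.mem_preimage, ← this]

/-- Coarsening the labelling to the atoms of `P` makes the space discrete without changing the
colimit element, and a discrete space is a choice of weights. -/
theorem toColim_surjective : Function.Surjective toColim := by
  intro z
  obtain ⟨Ω, ℓ, P, rfl⟩ := Colim.exists_prob z
  have h1 := Colim.prob_over (Labelling.over_push P.toAtoms ℓ) P.onAtoms
  let ℓ' := ℓ.push P.toAtoms.toFun P.toAtoms.surj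
  have h2 := Colim.prob_over (ℓ'.over_ofPart) P.onAtoms
  obtain ⟨x, hx⟩ := exists_toColim_eq ℓ'.partn (CSur.pb ℓ'.ofPart P.onAtoms) (by
    rw [ProbOn.pull_alg, onAtoms_alg]
    refine top_le_comap_of_injective fun i j hij => ?_
    have h3 := fun k => congrFun (congrArg CSur.Hom.toFun ℓ'.ofPart_toPart) k
    exact (h3 i).symm.trans ((congrArg ℓ'.toPart.toFun hij).trans (h3 j)))
  refine ⟨x, hx.trans (h2.trans (h1.symm.trans ?_))⟩
  exact congrArg (Colim.prob ℓ) P.pb_onAtoms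

/-! ### Measured partitions represented over a common labelling -/

/-- The labelled probability space `P` represents the measured partition `x`. -/
def Repr {Ω : CSur} (ℓ : Labelling Ω.carrier) (P : ProbOn Ω.carrier) (x : MP) : Prop :=
  toColim x = Colim.prob ℓ P

variable {Ω : CSur} {ℓ : Labelling Ω.carrier} {P Q R : ProbOn Ω.carrier} {x y z : MP}

theorem Repr.over {Ω' : CSur} {p : Ω' ⟶ Ω} {ℓ' : Labelling Ω'.carrier} (h : Repr ℓ P x)
    (hp : Labelling.Over p ℓ' ℓ) : Repr ℓ' (CSur.pb p P) x :=
  Eq.trans h (Colim.prob_over hp P).symm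

theorem Repr.eq_iff (hx : Repr ℓ P x) (hy : Repr ℓ Q y) : x = y ↔ P = Q := by
  rw [← toColim_injective.eq_iff, hx, hy, (Colim.prob_injective ℓ).eq_iff]

theorem exists_repr (x : MP) : ∃ (Ω : CSur) (ℓ : Labelling Ω.carrier) (P : ProbOn Ω.carrier),
    Repr ℓ P x := by
  obtain ⟨Ω, ℓ, P, h⟩ := Colim.exists_prob (toColim x)
  exact ⟨Ω, ℓ, P, h.symm⟩

theorem exists_repr₂ (x y : MP) : ∃ (Ω : CSur) (ℓ : Labelling Ω.carrier)
    (P Q : ProbOn Ω.carrier), Repr ℓ P x ∧ Repr ℓ Q y := by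
  obtain ⟨Ω₁, ℓ₁, P, hP⟩ := exists_repr x
  obtain ⟨Ω₂, ℓ₂, Q, hQ⟩ := exists_repr y
  obtain ⟨Ω, ℓ, p, q, hp, hq⟩ := Labelling.exists_common ℓ₁ ℓ₂
  exact ⟨Ω, ℓ, _, _, hP.over hp, hQ.over hq⟩

theorem exists_repr₃ (x y z : MP) : ∃ (Ω : CSur) (ℓ : Labelling Ω.carrier)
    (P Q R : ProbOn Ω.carrier), Repr ℓ P x ∧ Repr ℓ Q y ∧ Repr ℓ R z := by
  obtain ⟨Ω₁, ℓ₁, P, Q, hP, hQ⟩ := exists_repr₂ x y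
  obtain ⟨Ω₂, ℓ₂, R, hR⟩ := exists_repr z
  obtain ⟨Ω, ℓ, p, q, hp, hq⟩ := Labelling.exists_common ℓ₁ ℓ₂
  exact ⟨Ω, ℓ, _, _, _, hP.over hp, hQ.over hp, hR.over hq⟩

theorem exists_of_repr (ℓ : Labelling Ω.carrier) (P : ProbOn Ω.carrier) : ∃ x, Repr ℓ P x :=
  toColim_surjective _

/-- Over a fine enough labelling, a represented measured partition is the pullback of the discrete
space on its parts. -/
theorem Repr.pb_eq_disc {W : Weighted} (h : Repr ℓ P (Quotient.mk _ W)) {Ω' : CSur} {t : Ω' ⟶ Ω}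
    {p : Ω' ⟶ W.space} {ℓ' : Labelling Ω'.carrier} (ht : Labelling.Over t ℓ' ℓ)
    (hp : Labelling.Over p ℓ' W.label) : CSur.pb t P = CSur.pb p W.disc :=
  ((Colim.prob_eq_prob_iff hp ht W.disc P).1 h).symm

/-- Both sides may be tested over a labelling refining all those involved. There `P` and `Q` pull
back to the discrete spaces on the parts, and inclusion of their algebras is the same as a
refinement map. -/
theorem _root_.ProbSep.Weighted.le_iff_of_repr {W V : Weighted} (hW : Repr ℓ P (Quotient.mk _ W))
    (hV : Repr ℓ Q (Quotient.mk _ V)) : W.le V ↔ P.le Q := by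
  obtain ⟨Ω₁, ℓ₁, p, q, hp, hq⟩ := Labelling.exists_common W.label V.label
  obtain ⟨Ω', ℓ', t, u, ht, hu⟩ := Labelling.exists_common ℓ ℓ₁
  rw [← ProbOn.le_pull t.toFun t.surj]
  change _ ↔ (CSur.pb t P).le (CSur.pb t Q)
  rw [hW.pb_eq_disc ht (hu.comp hp), hV.pb_eq_disc ht (hu.comp hq), Weighted.le_iff]
  generalize u ≫ p = p', u ≫ q = q', hu.comp hp = hp', hu.comp hq = hq'
  constructor
  · rintro ⟨s, hs, h⟩
    rw [hp'.hom_ext (hq'.comp hs), CSur.pb_comp]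
    exact (ProbOn.le_pull _ q'.surj _ _).2 h
  · intro h
    obtain ⟨s, rfl⟩ := CSur.exists_factor p' q' h.1
    refine ⟨s, hq'.of_comp hp', ?_⟩
    rw [CSur.pb_comp] at h
    exact (ProbOn.le_pull _ q'.surj _ _).1 h

theorem _root_.ProbSep.Weighted.isIndep_iff_of_repr {W V U : Weighted}
    (hW : Repr ℓ P (Quotient.mk _ W)) (hV : Repr ℓ Q (Quotient.mk _ V))
    (hU : Repr ℓ R (Quotient.mk _ U)) : W.IsIndep V U ↔ ProbOn.Joins P Q R := by
  obtain ⟨Ω₁, ℓ₁, p, q, hp, hq⟩ := Labelling.exists_common W.label V.label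
  obtain ⟨Ω₂, ℓ₂, v, r, hv, hr⟩ := Labelling.exists_common ℓ₁ U.label
  obtain ⟨Ω', ℓ', t, u, ht, hu⟩ := Labelling.exists_common ℓ ℓ₂
  have hp' := hu.comp (hv.comp hp)
  have hq' := hu.comp (hv.comp hq)
  have hr' := hu.comp hr
  rw [← ProbOn.joins_pb t, hW.pb_eq_disc ht hp', hV.pb_eq_disc ht hq', hU.pb_eq_disc ht hr',
    Weighted.isIndep_iff]
  generalize u ≫ v ≫ p = p', u ≫ v ≫ q = q', u ≫ r = r' at hp' hq' hr' ⊢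
  constructor
  · rintro ⟨s, hs₁, hs₂, h⟩
    have hf : IsFactorization (r' ≫ s) W.disc V.disc (CSur.pb p' W.disc, CSur.pb q' V.disc) := by
      constructor
      · rw [Category.assoc, ← hp'.hom_ext (hr'.comp hs₁)]
      · rw [Category.assoc, ← hq'.hom_ext (hr'.comp hs₂)]
    refine ⟨⟨_, _, _, _, _, hf⟩, (hf.joinVal_eq _).trans ?_⟩
    rw [CSur.pb_comp, h]
  · intro h
    -- Surjectivity on the product is combinatorial independence: the fibres over `i` and `j` are
    -- nonempty events, so they meet.
    let m : Ω' ⟶ W.space.prod V.space := ⟨fun a => (p'.toFun a, q'.toFun a), by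
      rintro ⟨i, j⟩
      obtain ⟨a, ha⟩ := p'.surj i
      obtain ⟨b, hb⟩ := q'.surj j
      obtain ⟨c, hc, hc'⟩ := h.compatible (p'.toFun ⁻¹' {i}) (q'.toFun ⁻¹' {j})
        ⟨{i}, trivial, rfl⟩ ⟨{j}, trivial, rfl⟩ ⟨a, ha⟩ ⟨b, hb⟩
      exact ⟨c, Prod.ext hc hc'⟩⟩
    have hf : IsFactorization m W.disc V.disc (CSur.pb p' W.disc, CSur.pb q' V.disc) :=
      ⟨rfl, rfl⟩
    have h1 : CSur.pb m (W.disc.prod V.disc) = CSur.pb r' U.disc :=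
      (hf.joinVal_eq h.1).symm.trans h.2
    -- Equality of the join with the pullback of `U.disc` gives equal σ-algebras, so `m` factors
    -- through the parts of `U`.
    have h2 : MeasurableSpace.comap m.toFun ⊤ = MeasurableSpace.comap r'.toFun ⊤ := by
      have := congrArg ProbOn.alg h1
      rwa [ProbOn.pull_alg, ProbOn.pull_alg,
        ProbOn.prod_alg_eq_top W.disc_alg V.disc_alg, U.disc_alg] at this
    obtain ⟨s, hs⟩ := CSur.exists_factor m r' h2.le
    rw [← hs, CSur.pb_comp] at h1
    refine ⟨s, hr'.of_comp ?_, hr'.of_comp ?_, ProbOn.pull_injective _ r'.surj h1⟩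
    · rw [← Category.assoc, hs]
      exact hp'
    · rw [← Category.assoc, hs]
      exact hq'

theorem Repr.le_iff (hx : Repr ℓ P x) (hy : Repr ℓ Q y) : le x y ↔ P.le Q := by
  constructor
  · rintro ⟨W, V, rfl, rfl, h⟩
    exact (Weighted.le_iff_of_repr hx hy).1 h
  · intro h
    induction x using Quotient.inductionOn with | _ W
    induction y using Quotient.inductionOn with | _ V
    exact ⟨W, V, rfl, rfl, (Weighted.le_iff_of_repr hx hy).2 h⟩

theorem Repr.isIndep_iff (hx : Repr ℓ P x) (hy : Repr ℓ Q y) (hz : Repr ℓ R z) :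
    IsIndep x y z ↔ ProbOn.Joins P Q R := by
  constructor
  · rintro ⟨W, V, U, rfl, rfl, rfl, h⟩
    exact (Weighted.isIndep_iff_of_repr hx hy hz).1 h
  · intro h
    induction x using Quotient.inductionOn with | _ W
    induction y using Quotient.inductionOn with | _ V
    induction z using Quotient.inductionOn with | _ U
    exact ⟨W, V, U, rfl, rfl, rfl, (Weighted.isIndep_iff_of_repr hx hy hz).2 h⟩

theorem repr_triv (ℓ : Labelling Ω.carrier) (W : Weighted) [Subsingleton W.I] :
    Repr ℓ (ProbOn.triv Ω.carrier) (Quotient.mk _ W) := by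
  have hs : Subsingleton W.space.carrier := inferInstanceAs (Subsingleton W.I)
  let p : Ω ⟶ W.space := ⟨fun _ => Classical.arbitrary _, fun i =>
    ⟨Classical.arbitrary _, Subsingleton.elim _ _⟩⟩
  have hp : Labelling.Over p ℓ W.label := Filter.Eventually.of_forall fun x => Subsingleton.elim _ _
  have hd : W.disc = ProbOn.triv W.space.carrier := by
    refine ProbOn.eq_of_singleton W.disc_alg
      (eq_top_iff.2 fun s _ => @Subsingleton.measurableSet _ _ _ s) fun i => ?_
    rw [Set.eq_univ_of_forall (s := {i}) fun j => Subsingleton.elim j i]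
    exact W.disc.prob.measure_univ.trans (ProbOn.triv W.space.carrier).prob.measure_univ.symm
  refine (Colim.prob_over hp W.disc).symm.trans ?_
  rw [hd]
  exact congrArg _ (ProbOn.triv_pull p.toFun p.surj)

theorem repr_emp (ℓ : Labelling Ω.carrier) : Repr ℓ (ProbOn.triv Ω.carrier) emp := by
  unfold emp
  exact @repr_triv Ω ℓ _ (inferInstanceAs (Subsingleton ({0} : Set ℕ)))

end MP

/-! ### The two resource monoids correspond -/

theorem Colim.map_injective {F G : DSh} (α : F ⟶ G)
    (hα : ∀ Ω, Function.Injective (α.hom.app Ω)) : Function.Injective (comparison.map α).toFun := by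
  intro z w h
  obtain ⟨Ω₁, ℓ₁, a, rfl⟩ := Colim.exists_mk (F := F) z
  obtain ⟨Ω₂, ℓ₂, b, rfl⟩ := Colim.exists_mk (F := F) w
  obtain ⟨Ω, ℓ, p, q, hp, hq⟩ := Labelling.exists_common ℓ₁ ℓ₂
  have h1 := (Colim.map_mk α ℓ₁ a).symm.trans (h.trans (Colim.map_mk α ℓ₂ b))
  have h2 := (Colim.mk_eq_mk_iff hp hq _ _).1 h1
  refine (Colim.mk_eq_mk_iff hp hq a b).2 (hα _ ?_)
  exact (NatTrans.naturality_apply α.hom p.op a).trans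
    (h2.trans (NatTrans.naturality_apply α.hom q.op b).symm)

/-- The comparison functor sends a constant sheaf to a set with the trivial action. -/
noncomputable def constIso (A : Type) :
    comparison.obj ⟨(Functor.const CSurᵒᵖ).obj A, const_isAtomicSheaf A⟩ ≅ trivialAction A :=
  DGSet.isoOfBijective
    { toFun := Quot.lift (fun a => a.2) (by
        rintro a b ⟨p, -, h⟩
        exact h)
      map_smul' := fun π z => by
        induction z using Quot.inductionOn with | _ a
        rfl } (by
    constructor
    · intro z w h
      obtain ⟨Ω₁, ℓ₁, a, rfl⟩ :=
        Colim.exists_mk (F := ⟨(Functor.const CSurᵒᵖ).obj A, const_isAtomicSheaf A⟩) z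
      obtain ⟨Ω₂, ℓ₂, b, rfl⟩ :=
        Colim.exists_mk (F := ⟨(Functor.const CSurᵒᵖ).obj A, const_isAtomicSheaf A⟩) w
      obtain ⟨Ω, ℓ, p, q, hp, hq⟩ := Labelling.exists_common ℓ₁ ℓ₂
      exact (Colim.mk_eq_mk_iff hp hq a b).2 h
    · intro a
      obtain ⟨ℓ⟩ := Labelling.nonempty ⟨PUnit⟩
      exact ⟨Quot.mk _ ⟨ℓ.partn, a⟩, rfl⟩)

theorem constIso_mk {A : Type} {Ω : CSur} (ℓ : Labelling Ω.carrier) (a : A) :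
    (constIso A).hom.toFun (Colim.mk ⟨(Functor.const CSurᵒᵖ).obj A, const_isAtomicSheaf A⟩ ℓ a) = a :=
  rfl

/-- The isomorphism `Φ(P) ≅ P̄`. -/
noncomputable def probIso : comparison.obj shP ≅ gP :=
  (DGSet.isoOfBijective (X := gP) (Y := comparison.obj shP)
    { toFun := MP.toColim
      map_smul' := MP.toColim_smul } ⟨MP.toColim_injective, MP.toColim_surjective⟩).symm

/-- The map underlying `probIso`. -/
noncomputable def ofColim (z : Colim shP) : MP := probIso.hom.toFun z

theorem repr_ofColim {Ω : CSur} (ℓ : Labelling Ω.carrier) (P : ProbOn Ω.carrier) :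
    MP.Repr ℓ P (ofColim (Colim.prob ℓ P)) :=
  (Equiv.ofBijective _ ⟨MP.toColim_injective, MP.toColim_surjective⟩).right_inv _

theorem ofColim_eq_iff {Ω : CSur} {ℓ : Labelling Ω.carrier} {P : ProbOn Ω.carrier} {x : MP} :
    ofColim (Colim.prob ℓ P) = x ↔ MP.Repr ℓ P x := by
  constructor
  · rintro rfl
    exact repr_ofColim ℓ P
  · exact fun h => ((repr_ofColim ℓ P).eq_iff h).2 rfl

theorem ofColim_smul (π : AutIᵐᵒᵖ) (z : Colim shP) : ofColim (π • z) = π • ofColim z :=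
  probIso.hom.map_smul' π z

theorem ofColim_injective : Function.Injective ofColim :=
  (Equiv.ofBijective _ ⟨MP.toColim_injective, MP.toColim_surjective⟩).symm.injective

/-- The measured partitions of an element of `Φ(P × P)`. -/
noncomputable def pairMap : comparison.obj shPP ⟶ gPP where
  toFun z := (ofColim ((comparison.map shFst).toFun z), ofColim ((comparison.map shSnd).toFun z))
  map_smul' π z := Prod.ext
    ((congrArg ofColim ((comparison.map shFst).map_smul' π z)).trans (ofColim_smul π _))
    ((congrArg ofColim ((comparison.map shSnd).map_smul' π z)).trans (ofColim_smul π _))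

theorem pairMap_mk {Ω : CSur} (ℓ : Labelling Ω.carrier) (x : DPP.obj (op Ω)) :
    pairMap.toFun (Colim.mk shPP ℓ x) =
      (ofColim (Colim.prob ℓ x.1), ofColim (Colim.prob ℓ x.2)) :=
  Prod.ext (congrArg ofColim (Colim.map_mk shFst ℓ x)) (congrArg ofColim (Colim.map_mk shSnd ℓ x))

theorem pairMap_bijective : Function.Bijective pairMap.toFun := by
  constructor
  · intro z w h
    obtain ⟨Ω₁, ℓ₁, a, rfl⟩ := Colim.exists_mk (F := shPP) z
    obtain ⟨Ω₂, ℓ₂, b, rfl⟩ := Colim.exists_mk (F := shPP) w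
    obtain ⟨Ω, ℓ, p, q, hp, hq⟩ := Labelling.exists_common ℓ₁ ℓ₂
    have h1 := (pairMap_mk ℓ₁ a).symm.trans (h.trans (pairMap_mk ℓ₂ b))
    refine (Colim.mk_eq_mk_iff hp hq a b).2 (Prod.ext ?_ ?_)
    · exact (Colim.prob_eq_prob_iff hp hq a.1 b.1).1 (ofColim_injective (congrArg Prod.fst h1))
    · exact (Colim.prob_eq_prob_iff hp hq a.2 b.2).1 (ofColim_injective (congrArg Prod.snd h1))
  · rintro ⟨x, y⟩
    obtain ⟨Ω, ℓ, P, Q, hP, hQ⟩ := MP.exists_repr₂ x y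
    refine ⟨Colim.mk shPP ℓ (P, Q), (pairMap_mk ℓ (P, Q)).trans ?_⟩
    exact Prod.ext (ofColim_eq_iff.2 hP) (ofColim_eq_iff.2 hQ)

theorem pairMap_inc_mk {Ω : CSur} (ℓ : Labelling Ω.carrier) (x : DP2.obj (op Ω)) :
    pairMap.toFun ((comparison.map shInc).toFun (Colim.mk shP2 ℓ x)) =
      (ofColim (Colim.prob ℓ x.1.1), ofColim (Colim.prob ℓ x.1.2)) :=
  (congrArg pairMap.toFun (Colim.map_mk shInc ℓ x)).trans (pairMap_mk ℓ x.1)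

/-- This both places the pair in `gP2` and, by uniqueness of independent combinations, shows that
the joins correspond. -/
theorem isIndep_pairMap_inc (z : Colim shP2) :
    MP.IsIndep (pairMap.toFun ((comparison.map shInc).toFun z)).1
      (pairMap.toFun ((comparison.map shInc).toFun z)).2
      (ofColim ((comparison.map shJoin).toFun z)) := by
  obtain ⟨Ω, ℓ, x, rfl⟩ := Colim.exists_mk z
  have h1 := pairMap_inc_mk ℓ x
  have h2 : (comparison.map shJoin).toFun (Colim.mk shP2 ℓ x) = Colim.prob ℓ (joinVal x.2) :=
    Colim.map_mk shJoin ℓ x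
  have h3 : MP.IsIndep (ofColim (Colim.prob ℓ x.1.1)) (ofColim (Colim.prob ℓ x.1.2))
      (ofColim (Colim.prob ℓ (joinVal x.2))) :=
    ((repr_ofColim ℓ _).isIndep_iff (repr_ofColim ℓ _) (repr_ofColim ℓ _)).2 ⟨x.2, rfl⟩
  have h4 := congrArg Prod.fst h1
  have h5 := congrArg Prod.snd h1
  rw [← h2] at h3
  exact h4 ▸ h5 ▸ h3

/-- The pair of measured partitions of an element of `Φ(P²_⊥)`. -/
noncomputable def indepMap : comparison.obj shP2 ⟶ gP2 where
  toFun z := ⟨pairMap.toFun ((comparison.map shInc).toFun z), _, isIndep_pairMap_inc z⟩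
  map_smul' π z := Subtype.ext
    ((congrArg pairMap.toFun ((comparison.map shInc).map_smul' π z)).trans (pairMap.map_smul' π _))

/-- For surjectivity, an independent pair and its combination are represented over one labelling,
where independence says that the representing pair factors through a product. -/
theorem indepMap_bijective : Function.Bijective indepMap.toFun := by
  constructor
  · intro z w h
    exact Colim.map_injective shInc (fun _ => Subtype.val_injective)
      (pairMap_bijective.1 (congrArg Subtype.val h))
  · rintro ⟨⟨x, y⟩, z, h⟩
    obtain ⟨Ω, ℓ, P, Q, R, hP, hQ, hR⟩ := MP.exists_repr₃ x y z
    obtain ⟨hF, -⟩ := (hP.isIndep_iff hQ hR).1 h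
    refine ⟨Colim.mk shP2 ℓ ⟨(P, Q), hF⟩, Subtype.ext ?_⟩
    refine (pairMap_inc_mk ℓ ⟨(P, Q), hF⟩).trans ?_
    exact Prod.ext (ofColim_eq_iff.2 hP) (ofColim_eq_iff.2 hQ)

theorem shRM_corresponds_gRM : RMData.Corresponds comparison shRM gRM := by
  -- The squares for the projections and the inclusion commute by definition, since `pairMap` and
  -- `indepMap` are built from those maps.
  refine ⟨probIso, DGSet.isoOfBijective pairMap pairMap_bijective, constIso Prop,
    DGSet.isoOfBijective indepMap indepMap_bijective, constIso PUnit, rfl, rfl, ?_, ?_, rfl, ?_, ?_⟩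
  · refine MulActionHom.ext fun z => ?_
    obtain ⟨Ω, ℓ, a, rfl⟩ := Colim.exists_mk (F := shOne) z
    exact (congrArg (constIso Prop).hom.toFun (Colim.map_mk shTrue ℓ a)).trans
      (constIso_mk ℓ _)
  · refine MulActionHom.ext fun z => ?_
    obtain ⟨Ω, ℓ, a, rfl⟩ := Colim.exists_mk (F := shPP) z
    have h1 : (constIso Prop).hom.toFun ((comparison.map shOrd).toFun (Colim.mk shPP ℓ a)) =
        ProbOn.le a.1 a.2 :=
      (congrArg (constIso Prop).hom.toFun (Colim.map_mk shOrd ℓ a)).trans (constIso_mk ℓ _)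
    refine h1.trans ((propext ?_).trans (congrArg gOrd.toFun (pairMap_mk ℓ a)).symm)
    exact ((repr_ofColim ℓ _).le_iff (repr_ofColim ℓ _)).symm
  · refine MulActionHom.ext fun z => ?_
    exact (isIndep_pairMap_inc z).unique (indepMap.toFun z).2.choose_spec
  · refine MulActionHom.ext fun z => ?_
    obtain ⟨Ω, ℓ, a, rfl⟩ := Colim.exists_mk (F := shOne) z
    refine (congrArg ofColim (Colim.map_mk shEmp ℓ a)).trans ?_
    exact ofColim_eq_iff.2 (MP.repr_emp ℓ)

/-! ### The resource monoid of measured partitions -/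

section Group

variable {X : DGSet}

/-- The value of a generalized element of `gP`. -/
def partVal (x : X ⟶ gP) (a : X.carrier) : MP := x.toFun a

theorem partVal_ext {x y : X ⟶ gP} (h : ∀ a, partVal x a = partVal y a) : x = y :=
  MulActionHom.ext h

/-- The pairing of two generalized elements of `gP`. -/
noncomputable def gPair (x y : X ⟶ gP) : X ⟶ gPP where
  toFun a := (partVal x a, partVal y a)
  map_smul' π a := Prod.ext (x.map_smul' π a) (y.map_smul' π a)

theorem gRM_le_iff (x y : X ⟶ gP) :
    gRM.Le x y ↔ ∀ a : X.carrier, MP.le (partVal x a) (partVal y a) := by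
  constructor
  · rintro ⟨h, t, rfl, rfl, ht⟩ a
    exact of_eq_true (congrArg (fun f : X ⟶ gProp => f.toFun a) ht)
  · intro h
    exact ⟨gPair x y, { toFun := fun _ => PUnit.unit, map_smul' := fun _ _ => rfl }, rfl, rfl,
      MulActionHom.ext fun a => eq_true (h a)⟩

theorem gRM_mul_iff (x y z : X ⟶ gP) :
    gRM.Mul x y z ↔ ∀ a : X.carrier, MP.IsIndep (partVal x a) (partVal y a) (partVal z a) := by
  constructor
  · rintro ⟨d, rfl, rfl, rfl⟩ a
    exact (d.toFun a).2.choose_spec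
  · intro h
    let d : X ⟶ gP2 :=
      { toFun := fun a => ⟨(partVal x a, partVal y a), _, h a⟩
        map_smul' := fun π a => Subtype.ext ((gPair x y).map_smul' π a) }
    exact ⟨d, rfl, rfl, partVal_ext fun a => MP.IsIndep.unique (d.toFun a).2.choose_spec (h a)⟩

theorem exists_isIndep_of_forall (x y : X ⟶ gP)
    (h : ∀ a : X.carrier, ∃ z, MP.IsIndep (partVal x a) (partVal y a) z) :
    ∃ z : X ⟶ gP, ∀ a : X.carrier, MP.IsIndep (partVal x a) (partVal y a) (partVal z a) := by
  choose z hz using h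
  refine ⟨{ toFun := z, map_smul' := fun π a => ?_ }, hz⟩
  exact MP.IsIndep.unique (hz (π • a)) (by
    have h2 : partVal x (π • a) = π • partVal x a := x.map_smul' π a
    have h3 : partVal y (π • a) = π • partVal y a := y.map_smul' π a
    rw [h2, h3]
    exact (hz a).smul π)

end Group

/-! ### Axioms for measured partitions, transported from probability spaces -/

namespace MP

variable {x x' y y' z z' : MP}

theorem IsIndep.symm (h : IsIndep x y z) : IsIndep y x z := by
  obtain ⟨Ω, ℓ, P, Q, R, hP, hQ, hR⟩ := exists_repr₃ x y z
  exact (hQ.isIndep_iff hP hR).2 ((hP.isIndep_iff hQ hR).1 h).symm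

theorem emp_isIndep (x : MP) : IsIndep emp x x := by
  obtain ⟨Ω, ℓ, P, hP⟩ := exists_repr x
  exact ((repr_emp ℓ).isIndep_iff hP hP).2 (ProbOn.triv_joins P)

theorem emp_le (x : MP) : le emp x := by
  obtain ⟨Ω, ℓ, P, hP⟩ := exists_repr x
  exact ((repr_emp ℓ).le_iff hP).2 (ProbOn.triv_le P)

theorem le_refl (x : MP) : le x x := by
  obtain ⟨Ω, ℓ, P, hP⟩ := exists_repr x
  exact (hP.le_iff hP).2 (ProbOn.le_refl P)

theorem le_trans (h : le x y) (h' : le y z) : le x z := by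
  obtain ⟨Ω, ℓ, P, Q, R, hP, hQ, hR⟩ := exists_repr₃ x y z
  exact (hP.le_iff hR).2 (ProbOn.le_trans ((hP.le_iff hQ).1 h) ((hQ.le_iff hR).1 h'))

theorem le_antisymm (h : le x y) (h' : le y x) : x = y := by
  obtain ⟨Ω, ℓ, P, Q, hP, hQ⟩ := exists_repr₂ x y
  exact (hP.eq_iff hQ).2 (ProbOn.le_antisymm ((hP.le_iff hQ).1 h) ((hQ.le_iff hP).1 h'))

/-- An independent combination is represented over any labelling that represents the factors. -/
theorem Repr.exists_of_isIndep {Ω : CSur} {ℓ : Labelling Ω.carrier} {P Q : ProbOn Ω.carrier}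
    (hx : Repr ℓ P x) (hy : Repr ℓ Q y) (h : IsIndep x y z) :
    ∃ R, ProbOn.Joins P Q R ∧ Repr ℓ R z := by
  obtain ⟨Ω₁, ℓ₁, R₁, hR₁⟩ := exists_repr z
  obtain ⟨Ω', ℓ', t, u, ht, hu⟩ := Labelling.exists_common ℓ ℓ₁
  obtain ⟨hF, -⟩ := ((hx.over ht).isIndep_iff (hy.over ht) (hR₁.over hu)).1 h
  -- The combination `z` is at first represented only over a refinement, but factorization descends
  -- to `ℓ`. The join formed there represents some independent combination, which must be `z` by
  -- uniqueness.
  obtain ⟨R, hR⟩ : ∃ R, ProbOn.Joins P Q R := ⟨_, Factors.of_comp t hF, rfl⟩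
  obtain ⟨z', hz'⟩ := exists_of_repr ℓ R
  obtain rfl := ((hx.isIndep_iff hy hz').2 hR).unique h
  exact ⟨R, hR, hz'⟩

/-- One labelling representing `x`, `y` and `z` also represents the successive combinations, so
associativity of joins on its sample space suffices. -/
theorem IsIndep.assoc {xy xyz : MP} (h : IsIndep x y xy) (h' : IsIndep xy z xyz) :
    ∃ yz, IsIndep y z yz ∧ IsIndep x yz xyz := by
  obtain ⟨Ω, ℓ, P, Q, R, hP, hQ, hR⟩ := exists_repr₃ x y z
  obtain ⟨PQ, hj, hPQ⟩ := hP.exists_of_isIndep hQ h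
  obtain ⟨PQR, hj', hPQR⟩ := hPQ.exists_of_isIndep hR h'
  obtain ⟨QR, h₁, h₂⟩ := hj.assoc hj'
  obtain ⟨yz, hyz⟩ := exists_of_repr ℓ QR
  exact ⟨yz, (hQ.isIndep_iff hR hyz).2 h₁, (hP.isIndep_iff hyz hPQR).2 h₂⟩

theorem IsIndep.mono (hx : le x x') (hy : le y y') (h : IsIndep x' y' z') :
    ∃ z, IsIndep x y z ∧ le z z' := by
  obtain ⟨Ω₁, ℓ₁, P, P', hP, hP'⟩ := exists_repr₂ x x'
  obtain ⟨Ω₂, ℓ₂, Q, Q', hQ, hQ'⟩ := exists_repr₂ y y'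
  obtain ⟨Ω, ℓ, p, q, hp, hq⟩ := Labelling.exists_common ℓ₁ ℓ₂
  obtain ⟨R', hj, hR'⟩ := (hP'.over hp).exists_of_isIndep (hQ'.over hq) h
  obtain ⟨R, h₁, h₂⟩ := ProbOn.Joins.mono (((hP.over hp).le_iff (hP'.over hp)).1 hx)
    (((hQ.over hq).le_iff (hQ'.over hq)).1 hy) hj
  obtain ⟨z, hz⟩ := exists_of_repr ℓ R
  exact ⟨z, ((hP.over hp).isIndep_iff (hQ.over hq) hz).2 h₁, (hz.le_iff hR').2 h₂⟩

end MP

theorem gRM_isResourceMonoid : gRM.IsResourceMonoid where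
  isProduct := ⟨Limits.BinaryFan.IsLimit.mk _ (fun f g => gPair f g) (fun _ _ => rfl)
    (fun _ _ => rfl) (fun f g m h₁ h₂ => by
      subst h₁ h₂
      rfl)⟩
  isTerminal := ⟨Limits.IsTerminal.ofUniqueHom
    (fun _ => { toFun := fun _ => PUnit.unit, map_smul' := fun _ _ => rfl })
    (fun _ _ => rfl)⟩
  mono_inc := ⟨fun {Z} f g h => MulActionHom.ext fun a =>
    Subtype.ext (congrArg (fun k : Z ⟶ gPP => k.toFun a) h)⟩
  le_refl x := (gRM_le_iff x x).2 fun _ => MP.le_refl _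
  le_trans x y z h h' := (gRM_le_iff x z).2 fun a =>
    MP.le_trans ((gRM_le_iff x y).1 h a) ((gRM_le_iff y z).1 h' a)
  le_antisymm x y h h' := partVal_ext fun a =>
    MP.le_antisymm ((gRM_le_iff x y).1 h a) ((gRM_le_iff y x).1 h' a)
  emp_le t x := (gRM_le_iff _ x).2 fun _ => MP.emp_le _
  emp_mul t x := (gRM_mul_iff _ x x).2 fun _ => MP.emp_isIndep _
  mul_comm x y z h := (gRM_mul_iff y x z).2 fun a => ((gRM_mul_iff x y z).1 h a).symm
  mul_assoc x y z xy xyz h h' := by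
    have key := fun a => ((gRM_mul_iff _ _ _).1 h a).assoc ((gRM_mul_iff _ _ _).1 h' a)
    obtain ⟨yz, hyz⟩ := exists_isIndep_of_forall y z fun a => ⟨_, (key a).choose_spec.1⟩
    refine ⟨yz, (gRM_mul_iff _ _ _).2 hyz, (gRM_mul_iff _ _ _).2 fun a => ?_⟩
    obtain ⟨w, hw, hw'⟩ := key a
    rwa [(hyz a).unique hw]
  mul_mono x x' y y' z' hx hy h := by
    have key := fun a => MP.IsIndep.mono ((gRM_le_iff _ _).1 hx a) ((gRM_le_iff _ _).1 hy a)
      ((gRM_mul_iff _ _ _).1 h a)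
    obtain ⟨z, hz⟩ := exists_isIndep_of_forall x y fun a => ⟨_, (key a).choose_spec.1⟩
    refine ⟨z, (gRM_mul_iff _ _ _).2 hz, (gRM_le_iff _ _).2 fun a => ?_⟩
    obtain ⟨w, hw, hw'⟩ := key a
    rwa [(hz a).unique hw]

end ProbSep

theorem mainTheorem4 :
    ProbSep.comparison.IsEquivalence ∧
    ProbSep.IsDayConvolution ProbSep.shP.obj ProbSep.shP.obj ProbSep.shP2.obj
      ProbSep.dayPairing ∧
    ProbSep.shRM.IsResourceMonoid ∧
    ProbSep.gRM.IsResourceMonoid ∧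
    ProbSep.RMData.Corresponds ProbSep.comparison ProbSep.shRM ProbSep.gRM :=
  ⟨ProbSep.comparison_isEquivalence, ProbSep.isDayConvolution_dayPairing,
    ProbSep.shRM_isResourceMonoid, ProbSep.gRM_isResourceMonoid, ProbSep.shRM_corresponds_gRM⟩
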